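/- An element of $\mathrm{SO}_n$ is called a rotation if its fixed point subspace has codimension two; a rotation group is a finite subgroup of $\mathrm{SO}_n$ generated by rotations. A subgroup $G$ is imprimitive if $\mathbb{R}^n$ is a direct sum of nonzero proper subspaces $V_1,\dots,V_l$ such that for all $g\in G$ and all $i$ there is a $j$ with $g(V_i)=V_j$; otherwise $G$ is primitive. Let $W(I_2(4))<\mathrm{O}_2$ be the dihedral group of order $8$ generated by the reflections $\mathrm{diag}(1,-1)$ and $e_1\leftrightarrow e_2$. Let $H=W(I_2(4))\otimes W(I_2(4))\otimes W(I_2(4))<\mathrm{SO}_8$, acting on $\mathbb{R}^8=\mathbb{R}^2\otimes\mathbb{R}^2\otimes\mathbb{R}^2$, and let $N=N_{\mathrm{SO}_8}(H)$ be its normalizer. The group $H/\{\pm1\}$ is a vector space over $\mathbb{F}_2$ with a nondegenerate quadratic form $Q$, where $Q(\{\pm h\})=0$ if $h^2=1$ and $Q(\{\pm h\})=1$ if $h^2=-1$, and $N$ acts on it by conjugation. Let $O^+(Q)$ be the subgroup of the orthogonal group $O(Q)$ of elements with Dickson invariant $0$, i.e. of those $g\in O(Q)$ for which $g-1$ has even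 rank, and let $L$ be the preimage of $O^+(Q)$ in $N$. Lemma. The only primitive rotation group $G$ with $H<G\le N$ is the group $L$. That is, for every subgroup $G$ of $\mathrm{SO}_8$: $G$ is a primitive rotation group with $H<G\le N$ if and only if $G=L$. -/

import Mathlib

open Module Matrix
open scoped Kronecker

namespace RotationGroup

/-! ### Rotation groups and primitive groups -/

section General

variable {n : Type} [Fintype n] [DecidableEq n]

/-- A rotation (orthogonal pseudoreflection): its fixed point subspace has codimension two. -/
def IsRotation (g : Matrix.specialOrthogonalGroup n ℝ) : Prop :=
  finrank ℝ (LinearMap.ker (Matrix.toLin' g.1 - LinearMap.id)) + 2 = Fintype.card n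

/-- A rotation group: a finite group generated by rotations. -/
def IsRotationGroup (G : Subgroup (Matrix.specialOrthogonalGroup n ℝ)) : Prop :=
  Finite G ∧ Subgroup.closure {g | g ∈ G ∧ IsRotation g} = G

/-- `G` is imprimitive: the space is the (internal) direct sum of nonzero proper subspaces
`V 0, …, V (l - 1)`, each of which is carried onto one of them by every element of `G`. -/
def IsImprimitive (G : Subgroup (Matrix.specialOrthogonalGroup n ℝ)) : Prop :=
  ∃ (l : ℕ) (V : Fin l → Submodule ℝ (n → ℝ)),
    DirectSum.IsInternal V ∧ (∀ i, V i ≠ ⊥ ∧ V i ≠ ⊤) ∧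
      ∀ g ∈ G, ∀ i, ∃ j, (V i).map (Matrix.toLin' g.1) = V j

/-- A group is primitive if it is not imprimitive. -/
def IsPrimitive (G : Subgroup (Matrix.specialOrthogonalGroup n ℝ)) : Prop :=
  ¬ IsImprimitive G

end General

/-! ### Isometries of a quadratic form over the field with two elements, Dickson invariant -/

/-- An alternating bilinear form has even rank. -/
theorem exists_finrank_eq_finrank_ker_add {K : Type*} [Field K] :
    ∀ (n : ℕ) {V : Type _} [AddCommGroup V] [Module K V] [FiniteDimensional K V]
      (B : LinearMap.BilinForm K V), B.IsAlt → finrank K V = n →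
      ∃ k : ℕ, finrank K V = finrank K (LinearMap.ker B) + 2 * k := by
  intro n
  induction n using Nat.strong_induction_on with
  | _ n ih =>
    intro V _ _ _ B hB hn
    by_cases h0 : B = 0
    · refine ⟨0, ?_⟩
      subst h0
      rw [LinearMap.ker_zero, finrank_top]
      rfl
    · obtain ⟨u, v, huv⟩ : ∃ u v, B u v ≠ 0 := by
        by_contra! hc
        exact h0 (LinearMap.ext fun u => LinearMap.ext fun v => hc u v)
      have hvu : B v u ≠ 0 := fun h => huv ((LinearMap.BilinForm.IsAlt.eq_iff hB).2 h)
      let f : V →ₗ[K] K × K := (B u).prod (B v)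
      have hfapp : ∀ y, f y = (B u y, B v y) := fun _ => rfl
      have huu : B u u = 0 := hB u
      have hvv : B v v = 0 := hB v
      have key : ∀ y : V, y - (B v y / B v u) • u - (B u y / B u v) • v ∈ LinearMap.ker f := by
        intro y
        rw [LinearMap.mem_ker, hfapp]
        simp only [map_sub, map_smul, huu, hvv, smul_eq_mul, Prod.mk_eq_zero]
        constructor <;> field_simp <;> ring
      have hf : LinearMap.range f = ⊤ := by
        rw [LinearMap.range_eq_top]
        rintro ⟨a, b⟩
        refine ⟨(b / B v u) • u + (a / B u v) • v, ?_⟩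
        rw [hfapp]
        simp only [map_add, map_smul, huu, hvv, smul_eq_mul, Prod.mk.injEq]
        constructor <;> field_simp <;> ring
      have hdim := LinearMap.finrank_range_add_finrank_ker f
      rw [hf, finrank_top, finrank_prod, finrank_self] at hdim
      let B' : LinearMap.BilinForm K (LinearMap.ker f) :=
        LinearMap.BilinForm.restrict B (LinearMap.ker f)
      have hB' : B'.IsAlt := fun x => hB x
      obtain ⟨k, hk⟩ := ih (finrank K (LinearMap.ker f)) (by omega) B' hB' rfl
      have hker : (LinearMap.ker B').map (LinearMap.ker f).subtype = LinearMap.ker B := by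
        ext x
        simp only [Submodule.mem_map, LinearMap.mem_ker, Submodule.subtype_apply]
        constructor
        · rintro ⟨⟨x, hx⟩, hx', rfl⟩
          have hx1 : B u x = 0 ∧ B v x = 0 := by
            simpa [f] using hx
          have e1 : B x u = 0 := (LinearMap.BilinForm.IsAlt.eq_iff hB).2 hx1.1
          have e2 : B x v = 0 := (LinearMap.BilinForm.IsAlt.eq_iff hB).2 hx1.2
          ext y
          have := LinearMap.congr_fun hx' ⟨_, key y⟩
          have h3 : B x (y - (B v y / B v u) • u - (B u y / B u v) • v) = 0 := this
          simpa [e1, e2] using h3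
        · intro hx
          have hxf : x ∈ LinearMap.ker f := by
            have e1 : B u x = 0 := (LinearMap.BilinForm.IsAlt.eq_iff hB).2 (by simp [hx])
            have e2 : B v x = 0 := (LinearMap.BilinForm.IsAlt.eq_iff hB).2 (by simp [hx])
            simp [f, e1, e2]
          refine ⟨⟨x, hxf⟩, ?_, rfl⟩
          ext y
          change B x y = 0
          simp [hx]
      have hk2 : finrank K (LinearMap.ker B') = finrank K (LinearMap.ker B) := by
        rw [← hker]
        exact (Submodule.finrank_map_subtype_eq _ _).symm
      exact ⟨k + 1, by omega⟩

section Dickson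

variable {V : Type*} [AddCommGroup V] [Module (ZMod 2) V]

/-- The orthogonal group `O(Q)`: the linear automorphisms preserving `Q`. -/
def IsometryGroup (Q : QuadraticForm (ZMod 2) V) : Subgroup (V ≃ₗ[ZMod 2] V) where
  carrier := {g | ∀ v, Q (g v) = Q v}
  one_mem' _ := rfl
  mul_mem' {g h} hg hh v := by
    change Q (g (h v)) = Q v
    rw [hg, hh]
  inv_mem' {g} hg v := by
    have := hg (g⁻¹ v)
    rw [← this]
    congr 1
    exact g.apply_symm_apply v

/-- The Dickson invariant of `g ∈ O(Q)`: the rank of `g - 1`, modulo two. -/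
noncomputable def dicksonInvariant (g : V ≃ₗ[ZMod 2] V) : ZMod 2 :=
  (finrank (ZMod 2) (LinearMap.range ((g : V →ₗ[ZMod 2] V) - LinearMap.id)) : ℕ)

/-- On `O(Q)`, with `Q` nondegenerate, the Dickson invariant is multiplicative. -/
theorem dicksonInvariant_inv_mul [FiniteDimensional (ZMod 2) V] (Q : QuadraticForm (ZMod 2) V)
    (hQ : Q.polarBilin.Nondegenerate) {g h : V ≃ₗ[ZMod 2] V}
    (hg : g ∈ IsometryGroup Q) (hh : h ∈ IsometryGroup Q) :
    dicksonInvariant (h⁻¹ * g) = dicksonInvariant g + dicksonInvariant h := by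
  have two : ∀ x : V, x + x = 0 := fun x => by
    rw [← two_smul (ZMod 2) x]
    exact zero_smul _ x
  have neg : ∀ x : V, -x = x := fun x => neg_eq_of_add_eq_zero_left (two x)
  have two' : ∀ x : ZMod 2, x + x = 0 := by decide
  have neg' : ∀ x : ZMod 2, -x = x := by decide
  set B : LinearMap.BilinForm (ZMod 2) V := Q.polarBilin with hB
  have Bapp : ∀ x y, B x y = Q (x + y) - Q x - Q y := fun _ _ => rfl
  have Balt : B.IsAlt := fun x => by
    rw [Bapp, two, QuadraticMap.map_zero, sub_sub, two', sub_zero]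
  have Brefl : B.IsRefl := Balt.isRefl
  have Binv : ∀ k ∈ IsometryGroup Q, ∀ x y, B (k x) (k y) = B x y := by
    intro k hk x y
    rw [Bapp, Bapp, ← map_add, hk, hk, hk]
  have Bself : ∀ k ∈ IsometryGroup Q, ∀ x, B x (k x - x) = Q (k x - x) := by
    intro k hk x
    have e : k x - x = k x + x := by rw [sub_eq_add_neg, neg]
    rw [map_sub, Balt x, sub_zero, Bapp, hk, sub_sub, two', sub_zero, e, add_comm]
  let S : (V ≃ₗ[ZMod 2] V) → (V →ₗ[ZMod 2] V) := fun k => (k : V →ₗ[ZMod 2] V) - LinearMap.id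
  have Sapp : ∀ k x, S k x = k x - x := fun _ _ => rfl
  have orth : ∀ k ∈ IsometryGroup Q, B.orthogonal (LinearMap.range (S k)) = LinearMap.ker (S k) := by
    intro k hk
    ext x
    rw [LinearMap.BilinForm.mem_orthogonal_iff, LinearMap.mem_ker, Sapp]
    constructor
    · intro hx
      have : B (k x - x) = 0 := by
        refine LinearMap.ext fun y => ?_
        obtain ⟨z, rfl⟩ := k.surjective y
        rw [LinearMap.zero_apply, Brefl.eq_iff]
        have h1 := hx (S k z) ⟨z, rfl⟩
        rw [Sapp, map_sub, LinearMap.sub_apply] at h1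
        rw [map_sub, Binv k hk, ← neg' (_ - _), neg_sub]
        exact h1
      exact hQ.1 _ fun y => LinearMap.congr_fun this y
    · rintro hx _ ⟨z, rfl⟩
      have e : B (k z) x = B z x := by
        nth_rewrite 1 [← sub_eq_zero.1 hx]
        exact Binv k hk z x
      rw [Sapp, map_sub, LinearMap.sub_apply, e, sub_self]
  have dbl : ∀ W : Submodule (ZMod 2) V, B.orthogonal (B.orthogonal W) = W :=
    LinearMap.BilinForm.orthogonal_orthogonal hQ Brefl
  have orth_sup : ∀ W W' : Submodule (ZMod 2) V,
      B.orthogonal (W ⊔ W') = B.orthogonal W ⊓ B.orthogonal W' := by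
    intro W W'
    apply le_antisymm
    · exact le_inf (LinearMap.BilinForm.orthogonal_le le_sup_left)
        (LinearMap.BilinForm.orthogonal_le le_sup_right)
    · rintro x ⟨h1, h2⟩ y hy
      obtain ⟨a, ha, b, hb, rfl⟩ := Submodule.mem_sup.1 hy
      have e1 : B a x = 0 := h1 a ha
      have e2 : B b x = 0 := h2 b hb
      change B (a + b) x = 0
      rw [map_add, LinearMap.add_apply, e1, e2, add_zero]
  have orth_inf : B.orthogonal (LinearMap.range (S g) ⊓ LinearMap.range (S h)) =
      LinearMap.ker (S g) ⊔ LinearMap.ker (S h) := by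
    rw [← dbl (LinearMap.range (S g)), ← dbl (LinearMap.range (S h)), orth g hg, orth h hh,
      ← orth_sup, dbl]
  set f : V × V →ₗ[ZMod 2] V := (S g).coprod (S h) with hf
  have fapp : ∀ a b, f (a, b) = S g a + S h b := fun a b => by simp [hf]
  let β : LinearMap.BilinForm (ZMod 2) (LinearMap.ker f) :=
    LinearMap.BilinForm.restrict
      (B.compl₁₂ (LinearMap.fst (ZMod 2) V V + LinearMap.snd (ZMod 2) V V)
        (S g ∘ₗ LinearMap.fst (ZMod 2) V V)) (LinearMap.ker f)
  have βapp : ∀ x y, β x y = B (x.1.1 + x.1.2) (S g y.1.1) := fun _ _ => rfl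
  have memW : ∀ a b, (a, b) ∈ LinearMap.ker f ↔ S g a = S h b := fun a b => by
    rw [LinearMap.mem_ker, fapp, add_eq_zero_iff_eq_neg, neg]
  have βalt : β.IsAlt := by
    rintro ⟨⟨a, b⟩, hab⟩
    rw [memW] at hab
    rw [βapp]
    change B (a + b) (S g a) = 0
    rw [map_add, LinearMap.add_apply]
    nth_rewrite 2 [hab]
    rw [Sapp, Sapp, Bself g hg, Bself h hh, ← Sapp, ← Sapp, hab, two']
  obtain ⟨k, hk⟩ := exists_finrank_eq_finrank_ker_add _ β βalt rfl
  let D : V →ₗ[ZMod 2] V × V := LinearMap.id.prod LinearMap.id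
  have Dapp : ∀ x, D x = (x, x) := fun _ => rfl
  have Dinj : Function.Injective D := fun x y hxy => congrArg Prod.fst hxy
  let T : V →ₗ[ZMod 2] V := (g : V →ₗ[ZMod 2] V) - (h : V →ₗ[ZMod 2] V)
  have Tapp : ∀ x, T x = g x - h x := fun _ => rfl
  have Rad : (LinearMap.ker β).map (LinearMap.ker f).subtype =
      (LinearMap.ker (S g)).prod (LinearMap.ker (S h)) ⊔ (LinearMap.ker T).map D := by
    apply le_antisymm
    · rintro _ ⟨⟨⟨a, b⟩, hab⟩, hx, rfl⟩
      have h1 : a + b ∈ LinearMap.ker (S g) ⊔ LinearMap.ker (S h) := by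
        rw [← orth_inf]
        rintro _ ⟨⟨a', rfl⟩, ⟨b', hb'⟩⟩
        have := LinearMap.congr_fun hx ⟨(a', b'), (memW a' b').2 hb'.symm⟩
        exact Brefl.eq_iff.1 this
      obtain ⟨p, hp, q, hq, hpq⟩ := Submodule.mem_sup.1 h1
      have hc : a - p = b - q := by
        have : a - p = -(b - q) := by
          rw [← add_eq_zero_iff_eq_neg]
          rw [show a - p + (b - q) = (a + b) - (p + q) by abel, hpq, sub_self]
        rw [this, neg]
      refine Submodule.mem_sup.2 ⟨(p, q), ⟨hp, hq⟩, (a - p, a - p), ⟨a - p, ?_, rfl⟩, ?_⟩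
      · have h2 : S g (a - p) = S h (a - p) := by
          nth_rewrite 2 [hc]
          rw [map_sub, map_sub, LinearMap.mem_ker.1 hp, LinearMap.mem_ker.1 hq, sub_zero, sub_zero]
          exact (memW a b).1 hab
        rw [Sapp, Sapp] at h2
        change T (a - p) = 0
        rw [Tapp, sub_left_inj.1 h2, sub_self]
      · nth_rewrite 2 [hc]
        simp
    · refine sup_le ?_ ?_
      · rintro ⟨p, q⟩ ⟨hp, hq⟩
        refine ⟨⟨(p, q), (memW p q).2 (hp.trans hq.symm)⟩, ?_, rfl⟩
        change β _ = 0
        ext ⟨⟨a, b⟩, hab⟩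
        rw [memW] at hab
        change B (p + q) (S g a) = 0
        have e1 : B p (S g a) = 0 := by
          rw [Brefl.eq_iff]
          have : p ∈ B.orthogonal (LinearMap.range (S g)) := by rw [orth g hg]; exact hp
          exact this _ ⟨a, rfl⟩
        have e2 : B q (S h b) = 0 := by
          rw [Brefl.eq_iff]
          have : q ∈ B.orthogonal (LinearMap.range (S h)) := by rw [orth h hh]; exact hq
          exact this _ ⟨b, rfl⟩
        rw [map_add, LinearMap.add_apply, e1, hab, e2, add_zero]
      · rintro _ ⟨c, hc, rfl⟩
        have hc' : g c = h c := sub_eq_zero.1 hc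
        refine ⟨⟨(c, c), (memW c c).2 (by rw [Sapp, Sapp, hc'])⟩, ?_, rfl⟩
        change β _ = 0
        ext ⟨⟨a, b⟩, hab⟩
        change B (c + c) (S g a) = 0
        rw [two, map_zero, LinearMap.zero_apply]
  have Inf : (LinearMap.ker (S g)).prod (LinearMap.ker (S h)) ⊓ (LinearMap.ker T).map D =
      (LinearMap.ker (S g) ⊓ LinearMap.ker (S h)).map D := by
    ext ⟨x, y⟩
    constructor
    · rintro ⟨⟨hx, hy⟩, c, hc, hcd⟩
      obtain ⟨rfl, rfl⟩ := Prod.ext_iff.1 hcd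
      exact ⟨c, ⟨hx, hy⟩, rfl⟩
    · rintro ⟨c, ⟨hx, hy⟩, hcd⟩
      obtain ⟨rfl, rfl⟩ := Prod.ext_iff.1 hcd
      refine ⟨⟨hx, hy⟩, c, ?_, rfl⟩
      have h1 : g c - c = 0 := hx
      have h2 : h c - c = 0 := hy
      change g c - h c = 0
      rw [sub_eq_zero.1 h1, sub_eq_zero.1 h2, sub_self]
  have d1 : finrank (ZMod 2) (LinearMap.ker β) = finrank (ZMod 2)
      ↥((LinearMap.ker (S g)).prod (LinearMap.ker (S h)) ⊔ (LinearMap.ker T).map D) := by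
    rw [← Rad, Submodule.finrank_map_subtype_eq]
  have d2 := Submodule.finrank_sup_add_finrank_inf_eq
    ((LinearMap.ker (S g)).prod (LinearMap.ker (S h))) ((LinearMap.ker T).map D)
  have map_D : ∀ W : Submodule (ZMod 2) V,
      finrank (ZMod 2) (W.map D) = finrank (ZMod 2) W := fun W =>
    (Submodule.equivMapOfInjective D Dinj W).finrank_eq.symm
  have d3 : finrank (ZMod 2) ((LinearMap.ker (S g)).prod (LinearMap.ker (S h))) =
      finrank (ZMod 2) (LinearMap.ker (S g)) + finrank (ZMod 2) (LinearMap.ker (S h)) := by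
    rw [← finrank_prod]
    exact LinearEquiv.finrank_eq
      { toFun := fun x => (⟨x.1.1, x.2.1⟩, ⟨x.1.2, x.2.2⟩)
        map_add' := fun _ _ => rfl
        map_smul' := fun _ _ => rfl
        invFun := fun x => ⟨(x.1.1, x.2.1), x.1.2, x.2.2⟩
        left_inv := fun _ => rfl
        right_inv := fun _ => rfl }
  rw [Inf, map_D, map_D, d3] at d2
  have d4 := LinearMap.finrank_range_add_finrank_ker f
  rw [finrank_prod, hf, LinearMap.range_coprod, ← hf] at d4
  have d5 := LinearMap.BilinForm.finrank_orthogonal hQ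
    (LinearMap.range (S g) ⊔ LinearMap.range (S h))
  rw [orth_sup, orth g hg, orth h hh] at d5
  have d6 := Submodule.finrank_le (LinearMap.range (S g) ⊔ LinearMap.range (S h))
  have d7 := LinearMap.finrank_range_add_finrank_ker (S g)
  have d8 := LinearMap.finrank_range_add_finrank_ker (S h)
  have d9 := LinearMap.finrank_range_add_finrank_ker T
  have d10 : finrank (ZMod 2) (LinearMap.range (S (h⁻¹ * g))) =
      finrank (ZMod 2) (LinearMap.range T) := by
    have : T = (h : V →ₗ[ZMod 2] V) ∘ₗ S (h⁻¹ * g) := by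
      refine LinearMap.ext fun x => ?_
      have e : h ((h⁻¹ * g) x) = g x := h.apply_symm_apply (g x)
      change g x - h x = h ((h⁻¹ * g) x - x)
      rw [map_sub, e]
    rw [this, LinearMap.range_comp]
    exact (LinearEquiv.finrank_map_eq h _).symm
  change ((finrank (ZMod 2) (LinearMap.range (S (h⁻¹ * g))) : ℕ) : ZMod 2) =
    (finrank (ZMod 2) (LinearMap.range (S g)) : ℕ) + (finrank (ZMod 2) (LinearMap.range (S h)) : ℕ)
  rw [d10, ← Nat.cast_add, ZMod.natCast_eq_natCast_iff]
  change _ % 2 = _ % 2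
  omega

theorem dicksonInvariant_one : dicksonInvariant (1 : V ≃ₗ[ZMod 2] V) = 0 := by
  have : (((1 : V ≃ₗ[ZMod 2] V) : V →ₗ[ZMod 2] V) - LinearMap.id) = 0 := by
    ext x
    exact sub_self x
  rw [dicksonInvariant, this, LinearMap.range_zero, finrank_bot, Nat.cast_zero]

/-- `O⁺(Q)`: the elements of `O(Q)` whose Dickson invariant is `0`. -/
def SpecialIsometryGroup [FiniteDimensional (ZMod 2) V] (Q : QuadraticForm (ZMod 2) V)
    (hQ : Q.polarBilin.Nondegenerate) : Subgroup (V ≃ₗ[ZMod 2] V) where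
  carrier := {g | g ∈ IsometryGroup Q ∧ dicksonInvariant g = 0}
  one_mem' := ⟨one_mem _, dicksonInvariant_one⟩
  inv_mem' {g} hg := by
    refine ⟨inv_mem hg.1, ?_⟩
    have := dicksonInvariant_inv_mul Q hQ (one_mem (IsometryGroup Q)) hg.1
    rwa [mul_one, dicksonInvariant_one, zero_add, hg.2] at this
  mul_mem' {g h} hg hh := by
    refine ⟨mul_mem hg.1 hh.1, ?_⟩
    have h1 := dicksonInvariant_inv_mul Q hQ (one_mem (IsometryGroup Q)) hg.1
    rw [mul_one, dicksonInvariant_one, zero_add, hg.2] at h1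
    have h2 := dicksonInvariant_inv_mul Q hQ hh.1 (inv_mem hg.1)
    rwa [inv_inv, h1, hh.2, add_zero] at h2
end Dickson

/-! ### The group `H`, its normalizer `N` and the quotient `H / {±1}` -/

/-- `SO₈`, acting on `ℝ⁸ = ℝ² ⊗ ℝ² ⊗ ℝ²` in the basis `e_i ⊗ e_j ⊗ e_k`. -/
abbrev SO8 : Type := Matrix.specialOrthogonalGroup (Fin 2 × Fin 2 × Fin 2) ℝ

/-- The reflection `e₁ ↦ e₁`, `e₂ ↦ -e₂`. -/
def refl₁ : Matrix.orthogonalGroup (Fin 2) ℝ :=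
  ⟨!![1, 0; 0, -1], by
    rw [Matrix.mem_orthogonalGroup_iff]
    ext i j; fin_cases i <;> fin_cases j <;>
      simp [Matrix.mul_apply, Fin.sum_univ_two, Matrix.transpose_apply]⟩

/-- The reflection interchanging `e₁` and `e₂`. -/
def refl₂ : Matrix.orthogonalGroup (Fin 2) ℝ :=
  ⟨!![0, 1; 1, 0], by
    rw [Matrix.mem_orthogonalGroup_iff]
    ext i j; fin_cases i <;> fin_cases j <;>
      simp [Matrix.mul_apply, Fin.sum_univ_two, Matrix.transpose_apply]⟩

/-- The reflection group `W(I₂(4)) < O₂`, dihedral of order `8`; it is generated by two reflections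
in lines at an angle of `π / 4`. -/
def WI24 : Subgroup (Matrix.orthogonalGroup (Fin 2) ℝ) := Subgroup.closure {refl₁, refl₂}

/-- The tensor product `(a, b, c) ↦ a ⊗ b ⊗ c` of three orthogonal transformations of `ℝ²`. -/
def tensorHom : Matrix.orthogonalGroup (Fin 2) ℝ × Matrix.orthogonalGroup (Fin 2) ℝ ×
    Matrix.orthogonalGroup (Fin 2) ℝ →* SO8 where
  toFun w := ⟨w.1.1 ⊗ₖ (w.2.1.1 ⊗ₖ w.2.2.1), by
    rw [Matrix.mem_specialOrthogonalGroup_iff]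
    refine ⟨Matrix.kronecker_mem_unitary w.1.2 (Matrix.kronecker_mem_unitary w.2.1.2 w.2.2.2), ?_⟩
    have h : ∀ u : Matrix.orthogonalGroup (Fin 2) ℝ, u.1.det ^ 4 = 1 := fun u => by
      have := congrArg Matrix.det ((Matrix.mem_orthogonalGroup_iff _ _).1 u.2)
      rw [Matrix.det_mul, Matrix.det_transpose, Matrix.det_one] at this
      nlinarith
    simp only [Matrix.det_kronecker, Fintype.card_prod, Fintype.card_fin, mul_pow, ← pow_mul]
    norm_num [h]⟩
  map_one' := Subtype.ext (by simp)
  map_mul' u v := Subtype.ext (by simp [Matrix.mul_kronecker_mul])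

theorem WI24_form {w : Matrix.orthogonalGroup (Fin 2) ℝ} (hw : w ∈ WI24) :
    ∃ a b : ℝ, (a = 1 ∨ a = -1) ∧ (b = 1 ∨ b = -1) ∧
      (w.1 = !![a, 0; 0, b] ∨ w.1 = !![0, a; b, 0]) := by
  induction hw using Subgroup.closure_induction with
  | mem x hx =>
    rcases hx with rfl | rfl
    · exact ⟨1, -1, by simp, by simp, Or.inl rfl⟩
    · exact ⟨1, 1, by simp, by simp, Or.inr rfl⟩
  | one => exact ⟨1, 1, by simp, by simp, Or.inl Matrix.one_fin_two⟩
  | mul x y _ _ hx hy =>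
    obtain ⟨a, b, ha, hb, h⟩ := hx
    obtain ⟨c, d, hc, hd, h'⟩ := hy
    rcases h with h | h <;> rcases h' with h' | h'
    · refine ⟨a * c, b * d, ?_, ?_, Or.inl ?_⟩
      · rcases ha with rfl | rfl <;> rcases hc with rfl | rfl <;> simp
      · rcases hb with rfl | rfl <;> rcases hd with rfl | rfl <;> simp
      · change x.1 * y.1 = _
        rw [h, h']
        simp
    · refine ⟨a * c, b * d, ?_, ?_, Or.inr ?_⟩
      · rcases ha with rfl | rfl <;> rcases hc with rfl | rfl <;> simp
      · rcases hb with rfl | rfl <;> rcases hd with rfl | rfl <;> simp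
      · change x.1 * y.1 = _
        rw [h, h']
        simp
    · refine ⟨a * d, b * c, ?_, ?_, Or.inr ?_⟩
      · rcases ha with rfl | rfl <;> rcases hd with rfl | rfl <;> simp
      · rcases hb with rfl | rfl <;> rcases hc with rfl | rfl <;> simp
      · change x.1 * y.1 = _
        rw [h, h']
        simp
    · refine ⟨a * d, b * c, ?_, ?_, Or.inl ?_⟩
      · rcases ha with rfl | rfl <;> rcases hd with rfl | rfl <;> simp
      · rcases hb with rfl | rfl <;> rcases hc with rfl | rfl <;> simp
      · change x.1 * y.1 = _
        rw [h, h']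
        simp
  | inv x _ hx =>
    obtain ⟨a, b, ha, hb, h⟩ := hx
    have hinv : (x⁻¹).1 = x.1ᵀ := rfl
    rcases h with h | h
    · refine ⟨a, b, ha, hb, Or.inl ?_⟩
      rw [hinv, h]
      ext i j; fin_cases i <;> fin_cases j <;> simp
    · refine ⟨b, a, hb, ha, Or.inr ?_⟩
      rw [hinv, h]
      ext i j; fin_cases i <;> fin_cases j <;> simp

theorem WI24_sq {w : Matrix.orthogonalGroup (Fin 2) ℝ} (hw : w ∈ WI24) :
    w.1 * w.1 = 1 ∨ w.1 * w.1 = -1 := by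
  obtain ⟨a, b, ha, hb, h⟩ := WI24_form hw
  rcases h with h | h <;> rw [h, Matrix.mul_fin_two, Matrix.one_fin_two] <;>
    rcases ha with rfl | rfl <;> rcases hb with rfl | rfl <;> simp

theorem WI24_finite : (WI24 : Set (Matrix.orthogonalGroup (Fin 2) ℝ)).Finite := by
  have hS : ({1, -1} : Set ℝ).Finite := by simp
  have h1 := (hS.prod hS).image (fun p : ℝ × ℝ => !![p.1, 0; 0, p.2])
  have h2 := (hS.prod hS).image (fun p : ℝ × ℝ => !![0, p.1; p.2, 0])
  refine Set.Finite.subset ((h1.union h2).preimage (Subtype.val_injective.injOn)) ?_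
  intro w hw
  obtain ⟨a, b, ha, hb, h⟩ := WI24_form hw
  rcases h with h | h
  · exact Or.inl ⟨(a, b), ⟨ha, hb⟩, h.symm⟩
  · exact Or.inr ⟨(a, b), ⟨ha, hb⟩, h.symm⟩

/-- `H = W(I₂(4)) ⊗ W(I₂(4)) ⊗ W(I₂(4)) < SO₈`. -/
def H : Subgroup SO8 := (WI24.prod (WI24.prod WI24)).map tensorHom

theorem mem_H {h : SO8} : h ∈ H ↔ ∃ a ∈ WI24, ∃ b ∈ WI24, ∃ c ∈ WI24,
    h = tensorHom (a, b, c) := by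
  constructor
  · rintro ⟨⟨a, b, c⟩, ⟨ha, hb, hc⟩, rfl⟩
    exact ⟨a, ha, b, hb, c, hc, rfl⟩
  · rintro ⟨a, ha, b, hb, c, hc, rfl⟩
    exact ⟨(a, b, c), ⟨ha, hb, hc⟩, rfl⟩

instance : Finite H := by
  have : (H : Set SO8).Finite := by
    have h := (WI24_finite.prod (WI24_finite.prod WI24_finite)).image tensorHom
    refine h.subset ?_
    rintro _ ⟨⟨a, b, c⟩, ⟨ha, hb, hc⟩, rfl⟩
    exact ⟨(a, b, c), ⟨ha, hb, hc⟩, rfl⟩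
  exact this.to_subtype

/-- The normalizer `N` of `H` in `SO₈`. -/
abbrev N : Subgroup SO8 := Subgroup.normalizer (H : Set SO8)

/-- The matrix of an element of `H`. -/
abbrev mat (h : H) : Matrix (Fin 2 × Fin 2 × Fin 2) (Fin 2 × Fin 2 × Fin 2) ℝ := h.1.1

theorem mat_mul (h k : H) : mat (h * k) = mat h * mat k := rfl

theorem mat_one : mat 1 = 1 := rfl

theorem mat_inj {h k : H} (e : mat h = mat k) : h = k := Subtype.ext (Subtype.ext e)

theorem mat_sq (h : H) : mat h * mat h = 1 ∨ mat h * mat h = -1 := by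
  obtain ⟨a, ha, b, hb, c, hc, e⟩ := mem_H.1 h.2
  have e' : mat h = a.1 ⊗ₖ (b.1 ⊗ₖ c.1) := congrArg Subtype.val e
  have neg_left : ∀ {m : Type} {n : Type} (A : Matrix m m ℝ) (B : Matrix n n ℝ),
      (-A) ⊗ₖ B = -(A ⊗ₖ B) := fun A B => by ext; simp
  have neg_right : ∀ {m : Type} {n : Type} (A : Matrix m m ℝ) (B : Matrix n n ℝ),
      A ⊗ₖ (-B) = -(A ⊗ₖ B) := fun A B => by ext; simp
  rw [e', ← Matrix.mul_kronecker_mul, ← Matrix.mul_kronecker_mul]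
  rcases WI24_sq ha with h1 | h1 <;> rcases WI24_sq hb with h2 | h2 <;>
    rcases WI24_sq hc with h3 | h3 <;> rw [h1, h2, h3] <;>
    simp [neg_left, neg_right]

/-- The subgroup `{±1}` of `H`. -/
def signSubgroup : Subgroup H where
  carrier := {h | mat h = 1 ∨ mat h = -1}
  one_mem' := Or.inl rfl
  mul_mem' {h k} hh hk := by
    change mat (h * k) = 1 ∨ mat (h * k) = -1
    rw [mat_mul]
    rcases hh with e | e <;> rcases hk with e' | e' <;> rw [e, e'] <;> simp
  inv_mem' {h} hh := by
    have key : mat h⁻¹ * mat h = 1 := by rw [← mat_mul, inv_mul_cancel, mat_one]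
    rcases hh with e | e
    · left
      rwa [e, mul_one] at key
    · right
      rw [e, mul_neg, mul_one] at key
      change mat h⁻¹ = -1
      rw [← key, neg_neg]

instance : signSubgroup.Normal where
  conj_mem h hh k := by
    have key : mat k * mat k⁻¹ = 1 := by rw [← mat_mul, mul_inv_cancel, mat_one]
    change mat (k * h * k⁻¹) = 1 ∨ mat (k * h * k⁻¹) = -1
    rw [mat_mul, mat_mul]
    rcases hh with e | e <;> rw [e] <;> simp [key]

theorem mem_signSubgroup {h : H} : h ∈ signSubgroup ↔ mat h = 1 ∨ mat h = -1 := Iff.rfl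

open Classical in
/-- `sqType h` is `0` if `h² = 1`, and `1` otherwise, that is, if `h² = -1` (see `mat_sq`). -/
noncomputable def sqType (h : H) : ZMod 2 := if mat h * mat h = 1 then 0 else 1

/-- The scalar matrix `(-1) ^ x`. -/
def sgn (x : ZMod 2) : Matrix (Fin 2 × Fin 2 × Fin 2) (Fin 2 × Fin 2 × Fin 2) ℝ :=
  if x = 0 then 1 else -1

theorem zmod_cases : ∀ x : ZMod 2, x = 0 ∨ x = 1 := by decide

theorem sgn_zero : sgn 0 = 1 := if_pos rfl

theorem sgn_one : sgn 1 = -1 := if_neg (by decide)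

theorem sgn_add (x y : ZMod 2) : sgn (x + y) = sgn x * sgn y := by
  have h : (1 : ZMod 2) + 1 = 0 := by decide
  rcases zmod_cases x with rfl | rfl <;> rcases zmod_cases y with rfl | rfl <;>
    simp [sgn_zero, sgn_one, h]

theorem sgn_comm (x : ZMod 2) (M : Matrix (Fin 2 × Fin 2 × Fin 2) (Fin 2 × Fin 2 × Fin 2) ℝ) :
    M * sgn x = sgn x * M := by
  rcases zmod_cases x with rfl | rfl <;> simp [sgn_zero, sgn_one]

theorem sgn_mul_self (x : ZMod 2) : sgn x * sgn x = 1 := by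
  rcases zmod_cases x with rfl | rfl <;> simp [sgn_zero, sgn_one]

theorem one_ne_neg_one :
    (1 : Matrix (Fin 2 × Fin 2 × Fin 2) (Fin 2 × Fin 2 × Fin 2) ℝ) ≠ -1 := by
  intro h
  have := congrFun (congrFun h (0, 0, 0)) (0, 0, 0)
  simp at this
  norm_num at this

theorem sgn_inj {x y : ZMod 2} (h : sgn x = sgn y) : x = y := by
  rcases zmod_cases x with rfl | rfl <;> rcases zmod_cases y with rfl | rfl
  · rfl
  · rw [sgn_zero, sgn_one] at h
    exact absurd h one_ne_neg_one
  · rw [sgn_zero, sgn_one] at h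
    exact absurd h.symm one_ne_neg_one
  · rfl

theorem mat_sq_eq (h : H) : mat h * mat h = sgn (sqType h) := by
  by_cases e : mat h * mat h = 1
  · rw [sqType, if_pos e, sgn_zero, e]
  · rw [sqType, if_neg e, sgn_one, (mat_sq h).resolve_left e]

/-- `h k = (-1) ^ commType h k • k h`, see `mat_comm`. -/
noncomputable def commType (h k : H) : ZMod 2 := sqType (h * k) - sqType h - sqType k

theorem mat_comm (h k : H) : mat h * mat k = sgn (commType h k) * (mat k * mat h) := by
  have e1 := mat_sq_eq (h * k)
  have e2 : sqType (h * k) = (sqType k + sqType h) + commType h k := by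
    rw [commType]; ring
  have e3 : mat h * mat k * (mat h * mat k) * (mat k * mat h) =
      sgn (sqType k + sqType h) * (mat h * mat k) := by
    calc _ = mat h * mat k * (mat h * (mat k * mat k) * mat h) := by simp only [mul_assoc]
      _ = mat h * mat k * (sgn (sqType k) * (mat h * mat h)) := by
        rw [mat_sq_eq k, sgn_comm, mul_assoc (sgn _)]
      _ = _ := by rw [mat_sq_eq h, ← sgn_add, sgn_comm]
  rw [mat_mul] at e1
  rw [e1, e2, sgn_add, mul_assoc] at e3
  have e4 := congrArg (sgn (sqType k + sqType h) * ·) e3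
  simp only [← mul_assoc, sgn_mul_self, one_mul] at e4
  rw [← mul_assoc]
  exact e4.symm

theorem mat_mul_inv (h : H) : mat h * mat h⁻¹ = 1 := by rw [← mat_mul, mul_inv_cancel, mat_one]

theorem commType_mul_left (h h' k : H) :
    commType (h * h') k = commType h k + commType h' k := by
  apply sgn_inj
  have e1 := mat_comm (h * h') k
  have e2 : mat (h * h') * mat k =
      sgn (commType h k + commType h' k) * (mat k * mat (h * h')) := by
    rw [mat_mul, mul_assoc, mat_comm h' k, ← mul_assoc, sgn_comm, mul_assoc, ← mul_assoc (mat h),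
      mat_comm h k, add_comm, sgn_add]
    simp only [mul_assoc]
  rw [e1] at e2
  have e3 := congrArg (· * mat (k * (h * h'))⁻¹) e2
  simpa only [← mat_mul k, mul_assoc, mat_mul_inv, mul_one] using e3

theorem sqType_congr {h k : H} (e : h⁻¹ * k ∈ signSubgroup) : sqType h = sqType k := by
  have : mat k = mat h * mat (h⁻¹ * k) := by rw [← mat_mul, mul_inv_cancel_left]
  apply sgn_inj
  rw [← mat_sq_eq, ← mat_sq_eq, this]
  rcases e with e | e <;> rw [e] <;> simp

instance : CommGroup (H ⧸ signSubgroup) where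
  mul_comm x y := by
    induction x using QuotientGroup.induction_on with | _ h
    induction y using QuotientGroup.induction_on with | _ k
    rw [← QuotientGroup.mk_mul, ← QuotientGroup.mk_mul, QuotientGroup.eq]
    have e : mat ((h * k)⁻¹ * (k * h)) = sgn (commType k h) := by
      rw [mat_mul, mat_mul k, mat_comm k h, ← mul_assoc, sgn_comm, mul_assoc, ← mat_mul h,
        ← mat_mul, inv_mul_cancel, mat_one, mul_one]
    rw [mem_signSubgroup, e]
    rcases zmod_cases (commType k h) with h0 | h0 <;> rw [h0]
    · exact Or.inl sgn_zero
    · exact Or.inr sgn_one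

/-- `H / {±1}`, written additively; it is a vector space over the field with two elements. -/
abbrev A : Type := Additive (H ⧸ signSubgroup)

noncomputable instance : Module (ZMod 2) A := AddCommGroup.zmodModule (n := 2) fun x => by
  induction x using Additive.rec with | _ x
  induction x using QuotientGroup.induction_on with | _ h
  rw [two_nsmul]
  refine congrArg Additive.ofMul ((QuotientGroup.eq_one_iff (h * h)).2 ?_)
  rw [mem_signSubgroup, mat_mul]
  exact mat_sq h

instance : Finite A := inferInstanceAs (Finite (H ⧸ signSubgroup))

/-- The class `{±h}` of `h`. -/
noncomputable def toA (h : H) : A := Additive.ofMul (h : H ⧸ signSubgroup)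

theorem toA_mul (h k : H) : toA (h * k) = toA h + toA k := rfl

theorem toA_surjective : Function.Surjective toA := fun x => by
  induction x using Additive.rec with | _ x
  induction x using QuotientGroup.induction_on with | _ h
  exact ⟨h, rfl⟩

/-- The function `{±h} ↦ sqType h`. -/
noncomputable def Qfun (x : A) : ZMod 2 :=
  Quotient.liftOn' x.toMul sqType fun _ _ e => sqType_congr (QuotientGroup.leftRel_apply.1 e)

theorem Qfun_toA (h : H) : Qfun (toA h) = sqType h := rfl

theorem polar_toA (h k : H) : QuadraticMap.polar Qfun (toA h) (toA k) = commType h k := rfl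

theorem sqType_one : sqType 1 = 0 := if_pos (by rw [mat_one, mul_one])

theorem polar_zero_left (y : A) : QuadraticMap.polar Qfun 0 y = 0 := by
  rw [QuadraticMap.polar, zero_add, sub_right_comm, sub_self, zero_sub]
  exact neg_eq_zero.2 sqType_one

/-- The quadratic form on `H / {±1}` with `Q {±h} = 0` if `h² = 1` and `Q {±h} = 1` if `h² = -1`. -/
noncomputable def Q : QuadraticForm (ZMod 2) A :=
  QuadraticMap.ofPolar Qfun
    (fun a x => by
      rcases zmod_cases a with rfl | rfl
      · rw [zero_smul, mul_zero, zero_smul]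
        exact sqType_one
      · rw [one_smul, mul_one, one_smul])
    (fun x x' y => by
      obtain ⟨h, rfl⟩ := toA_surjective x
      obtain ⟨h', rfl⟩ := toA_surjective x'
      obtain ⟨k, rfl⟩ := toA_surjective y
      exact commType_mul_left h h' k)
    (fun a x y => by
      rcases zmod_cases a with rfl | rfl
      · rw [zero_smul, zero_smul, polar_zero_left]
      · rw [one_smul, one_smul])

theorem kron_left_cancel {m n : Type} {a : Matrix m m ℝ} {b b' : Matrix n n ℝ} (ha : a ≠ 0)
    (e : a ⊗ₖ b = a ⊗ₖ b') : b = b' := by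
  obtain ⟨i, j, hij⟩ : ∃ i j, a i j ≠ 0 := by
    by_contra! hc
    exact ha (Matrix.ext hc)
  ext k l
  have := congrFun (congrFun e (i, k)) (j, l)
  exact mul_left_cancel₀ hij this

theorem kron_right_cancel {m n : Type} {a a' : Matrix m m ℝ} {b : Matrix n n ℝ} (hb : b ≠ 0)
    (e : a ⊗ₖ b = a' ⊗ₖ b) : a = a' := by
  obtain ⟨i, j, hij⟩ : ∃ i j, b i j ≠ 0 := by
    by_contra! hc
    exact hb (Matrix.ext hc)
  ext k l
  have := congrFun (congrFun e (k, i)) (l, j)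
  exact mul_right_cancel₀ hij this

theorem kron_ne_zero {m n : Type} {a : Matrix m m ℝ} {b : Matrix n n ℝ} (ha : a ≠ 0) (hb : b ≠ 0) :
    a ⊗ₖ b ≠ 0 := by
  intro e
  refine hb (kron_left_cancel ha (e.trans ?_))
  ext; simp

theorem orth_ne_zero (w : Matrix.orthogonalGroup (Fin 2) ℝ) : w.1 ≠ 0 := by
  intro e
  have := (Matrix.mem_orthogonalGroup_iff _ _).1 w.2
  rw [e, zero_mul] at this
  exact zero_ne_one this

theorem WI24_central {w : Matrix.orthogonalGroup (Fin 2) ℝ} (hw : w ∈ WI24)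
    (h₁ : w.1 * refl₁.1 = refl₁.1 * w.1) (h₂ : w.1 * refl₂.1 = refl₂.1 * w.1) :
    w.1 = 1 ∨ w.1 = -1 := by
  obtain ⟨a, b, ha, hb, h⟩ := WI24_form hw
  rw [refl₁] at h₁
  rw [refl₂] at h₂
  have e1 := congrFun (congrFun h₁ 0) 1
  have e2 := congrFun (congrFun h₂ 0) 1
  rcases h with h | h <;> rw [h] at e1 e2 ⊢ <;> rcases ha with rfl | rfl <;>
    rcases hb with rfl | rfl <;> rw [Matrix.one_fin_two] <;>
    simp [Matrix.mul_apply, Fin.sum_univ_two] at e1 e2 ⊢ <;> linarith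

theorem refl₁_mem : refl₁ ∈ WI24 := Subgroup.subset_closure (by simp)

theorem refl₂_mem : refl₂ ∈ WI24 := Subgroup.subset_closure (by simp)

theorem H_central {h : H} (hc : ∀ k : H, mat h * mat k = mat k * mat h) : h ∈ signSubgroup := by
  obtain ⟨a, ha, b, hb, c, hc', e⟩ := mem_H.1 h.2
  have e' : mat h = a.1 ⊗ₖ (b.1 ⊗ₖ c.1) := congrArg Subtype.val e
  have key : ∀ u ∈ WI24, ∀ v ∈ WI24, ∀ w ∈ WI24,
      (a.1 * u.1) ⊗ₖ ((b.1 * v.1) ⊗ₖ (c.1 * w.1)) = (u.1 * a.1) ⊗ₖ ((v.1 * b.1) ⊗ₖ (w.1 * c.1)) := by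
    intro u hu v hv w hw
    have := hc ⟨tensorHom (u, v, w), mem_H.2 ⟨u, hu, v, hv, w, hw, rfl⟩⟩
    rw [e'] at this
    change a.1 ⊗ₖ (b.1 ⊗ₖ c.1) * u.1 ⊗ₖ (v.1 ⊗ₖ w.1) = u.1 ⊗ₖ (v.1 ⊗ₖ w.1) * a.1 ⊗ₖ (b.1 ⊗ₖ c.1) at this
    simpa only [← Matrix.mul_kronecker_mul] using this
  have one : (1 : Matrix.orthogonalGroup (Fin 2) ℝ).1 = 1 := rfl
  have ka : ∀ u ∈ WI24, a.1 * u.1 = u.1 * a.1 := fun u hu => by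
    have := key u hu 1 (one_mem _) 1 (one_mem _)
    simp only [one, mul_one, one_mul] at this
    exact kron_right_cancel (kron_ne_zero (orth_ne_zero b) (orth_ne_zero c)) this
  have kb : ∀ u ∈ WI24, b.1 * u.1 = u.1 * b.1 := fun u hu => by
    have := key 1 (one_mem _) u hu 1 (one_mem _)
    simp only [one, mul_one, one_mul] at this
    exact kron_right_cancel (orth_ne_zero c) (kron_left_cancel (orth_ne_zero a) this)
  have kc : ∀ u ∈ WI24, c.1 * u.1 = u.1 * c.1 := fun u hu => by
    have := key 1 (one_mem _) 1 (one_mem _) u hu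
    simp only [one, mul_one, one_mul] at this
    exact kron_left_cancel (orth_ne_zero b) (kron_left_cancel (orth_ne_zero a) this)
  have neg_left : ∀ {m : Type} {n : Type} (A : Matrix m m ℝ) (B : Matrix n n ℝ),
      (-A) ⊗ₖ B = -(A ⊗ₖ B) := fun A B => by ext; simp
  have neg_right : ∀ {m : Type} {n : Type} (A : Matrix m m ℝ) (B : Matrix n n ℝ),
      A ⊗ₖ (-B) = -(A ⊗ₖ B) := fun A B => by ext; simp
  rw [mem_signSubgroup, e']
  rcases WI24_central ha (ka _ refl₁_mem) (ka _ refl₂_mem) with h1 | h1 <;>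
    rcases WI24_central hb (kb _ refl₁_mem) (kb _ refl₂_mem) with h2 | h2 <;>
    rcases WI24_central hc' (kc _ refl₁_mem) (kc _ refl₂_mem) with h3 | h3 <;>
    rw [h1, h2, h3] <;> simp [neg_left, neg_right]

theorem Q_nondegenerate : Q.polarBilin.Nondegenerate := by
  have left : ∀ x : A, (∀ y, Q.polarBilin x y = 0) → x = 0 := by
    intro x hx
    obtain ⟨h, rfl⟩ := toA_surjective x
    refine congrArg Additive.ofMul ((QuotientGroup.eq_one_iff h).2 (H_central fun k => ?_))
    have : commType h k = 0 := hx (toA k)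
    rw [mat_comm, this, sgn_zero, one_mul]
  refine ⟨left, fun y hy => left y fun x => ?_⟩
  rw [← hy x]
  exact QuadraticMap.polar_comm _ _ _

theorem mat_normalizer (n : N) (h : H) :
    mat (Subgroup.normalizerMonoidHom H n h) = n.1.1 * mat h * (n.1⁻¹).1 := rfl

theorem normalizer_map_le (n : N) :
    signSubgroup.map (Subgroup.normalizerMonoidHom H n : H →* H) ≤ signSubgroup := by
  rintro _ ⟨h, hh, rfl⟩
  have key : n.1.1 * (n.1⁻¹).1 = 1 := congrArg Subtype.val (mul_inv_cancel n.1)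
  change mat (Subgroup.normalizerMonoidHom H n h) = 1 ∨
    mat (Subgroup.normalizerMonoidHom H n h) = -1
  rw [mat_normalizer]
  rcases hh with e | e <;> rw [e] <;> simp only [mul_one, mul_neg, neg_mul, key]
  · exact Or.inl trivial
  · exact Or.inr trivial

theorem normalizer_map (n : N) :
    signSubgroup.map (Subgroup.normalizerMonoidHom H n : H →* H) = signSubgroup := by
  refine le_antisymm (normalizer_map_le n) fun h hh => ?_
  refine ⟨Subgroup.normalizerMonoidHom H n⁻¹ h, normalizer_map_le n⁻¹ ⟨h, hh, rfl⟩, ?_⟩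
  change (Subgroup.normalizerMonoidHom H n * Subgroup.normalizerMonoidHom H n⁻¹) h = h
  rw [← map_mul, mul_inv_cancel, map_one]
  rfl

/-- The action of `N` on `H / {±1}` by conjugation. -/
noncomputable def conjAction : N →* (A ≃ₗ[ZMod 2] A) where
  toFun n := (MulEquiv.toAdditive (QuotientGroup.congr signSubgroup signSubgroup
    (Subgroup.normalizerMonoidHom H n) (normalizer_map n))).toLinearEquiv
      fun c x => ZMod.map_smul (MulEquiv.toAdditive (QuotientGroup.congr signSubgroup signSubgroup
        (Subgroup.normalizerMonoidHom H n) (normalizer_map n))) c x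
  map_one' := by
    ext x
    obtain ⟨h, rfl⟩ := toA_surjective x
    change toA (Subgroup.normalizerMonoidHom H 1 h) = toA h
    rw [map_one]
    rfl
  map_mul' m n := by
    ext x
    obtain ⟨h, rfl⟩ := toA_surjective x
    change toA (Subgroup.normalizerMonoidHom H (m * n) h) =
      toA (Subgroup.normalizerMonoidHom H m (Subgroup.normalizerMonoidHom H n h))
    rw [map_mul]
    rfl

theorem conjAction_toA (n : N) (h : H) :
    conjAction n (toA h) = toA (Subgroup.normalizerMonoidHom H n h) := rfl

/-- `L`: the preimage in `N` of `O⁺(Q)`, i.e. of the isometries of `(H / {±1}, Q)` whose Dickson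
invariant is `0`. -/
noncomputable def L : Subgroup SO8 :=
  ((SpecialIsometryGroup Q Q_nondegenerate).comap conjAction).map N.subtype

end RotationGroup

/-! Conjugation makes `N` act on `H / {±1}` by isometries of `Q`, with kernel `H`, and the space `(H
/ {±1}, Q)` is the space of bivectors of 𝔽₂⁴ with the Klein form. Under this identification
rotations in `N` act as transvections of 𝔽₂⁴, so the classification reduces to one of sets of
transvections.

Let `r ∈ N` be a rotation inducing `g`, and let `h ∈ H`. The fixed space of `r` and its image under
`h` have dimension 6 in ℝ⁸, so they meet, and the commutator of `r` and `h` has a nonzero fixed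
vector. Hence this commutator squares to 1 and is not -1. It follows that the image of `g - 1` is
totally singular, of dimension at most 3. Its dimension is even because `B ((g - 1) x) y` is
alternating, and nonzero by Schur's lemma; so `g` is the Siegel transformation of a totally singular
plane (`IsRotation.isSiegel`). Conversely, lift a basis of such a plane to commuting involutions in
`H`: the map that is -1 on their two-dimensional common 1-eigenspace and 1 on its complement is a
rotation inducing the Siegel transformation (`IsSingularPlane.exists_rotation`). Siegel
transformations have Dickson invariant 0 and generate `O⁺(Q)` (`specialIsometryGroup_le`); each is
the action of a transvection of 𝔽₂⁴ (`IsSingularPlane.exists_transvect`).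

That `L` qualifies follows from the irreducibility of the group generated by Siegel transformations
on `H / {±1}`. Commutators of rotations with `H` fill up `H`, so the rotations generate `L`. In a
system of imprimitivity, the classes stabilizing every block form an invariant subspace. It is
nonzero, since 64 classes act on at most 8 blocks, so it is everything, against the irreducibility
of `H` on ℝ⁸.

For uniqueness, let `G` be a primitive rotation group between `H` and `N`; being generated by
rotations, it lies in `L`. By `IsTransvectionSet.trichotomy` its transvections are all
transvections, or preserve a nonzero totally singular space, or fix a nonzero bivector. In the first
case `G` contains `L`. In the second, the joint eigenspaces of the commuting involutions over the
singular space form a system of imprimitivity. In the third, a lift of the fixed bivector to `H`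
would centralize `G`, hence `H`, although the centre of `H` is `{±1}`. -/

namespace RotationGroup

/-! ### Bivectors of a four-dimensional space over the field with two elements -/

/-- The space `𝔽₂⁴`; its dual is identified with it by the dot product. -/
abbrev Vec : Type := Fin 4 → ZMod 2

/-- The bivectors of `𝔽₂⁴`, in the coordinates `p₀₁, p₂₃, p₀₂, p₁₃, p₀₃, p₁₂`. -/
abbrev Biv : Type := Fin 6 → ZMod 2

/-- The Klein quadratic form. -/
def klein (w : Biv) : ZMod 2 := w 0 * w 1 + w 2 * w 3 + w 4 * w 5

/-- The polar form of the Klein quadratic form. -/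
def kleinPolar (v w : Biv) : ZMod 2 :=
  v 0 * w 1 + v 1 * w 0 + v 2 * w 3 + v 3 * w 2 + v 4 * w 5 + v 5 * w 4

/-- The exterior product of two vectors. -/
def wedge (p x : Vec) : Biv :=
  ![p 0 * x 1 + p 1 * x 0, p 2 * x 3 + p 3 * x 2, p 0 * x 2 + p 2 * x 0,
    p 1 * x 3 + p 3 * x 1, p 0 * x 3 + p 3 * x 0, p 1 * x 2 + p 2 * x 1]

/-- The contraction of a bivector by a functional. -/
def contract (φ : Vec) (w : Biv) : Vec :=
  ![w 0 * φ 1 + w 2 * φ 2 + w 4 * φ 3, w 0 * φ 0 + w 5 * φ 2 + w 3 * φ 3,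
    w 2 * φ 0 + w 5 * φ 1 + w 1 * φ 3, w 4 * φ 0 + w 3 * φ 1 + w 1 * φ 2]

/-- The action on bivectors of the transvection `x ↦ x + φ(x) p`. -/
def transvect (p φ : Vec) (w : Biv) : Biv := w + wedge p (contract φ w)

theorem wedge_add_left (p p' x : Vec) : wedge (p + p') x = wedge p x + wedge p' x := by
  ext i; fin_cases i <;> simp [wedge] <;> ring

theorem wedge_add_right (p x x' : Vec) : wedge p (x + x') = wedge p x + wedge p x' := by
  ext i; fin_cases i <;> simp [wedge] <;> ring

theorem wedge_smul_left (a : ZMod 2) (p x : Vec) : wedge (a • p) x = a • wedge p x := by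
  ext i; fin_cases i <;> simp [wedge] <;> ring

theorem wedge_smul_right (a : ZMod 2) (p x : Vec) : wedge p (a • x) = a • wedge p x := by
  ext i; fin_cases i <;> simp [wedge] <;> ring

theorem wedge_self (p : Vec) : wedge p p = 0 := by
  ext i; fin_cases i <;> simp [wedge, mul_comm] <;> exact CharTwo.add_self_eq_zero _

theorem wedge_comm (p x : Vec) : wedge p x = wedge x p := by
  ext i; fin_cases i <;> simp [wedge] <;> ring

theorem wedge_zero (p : Vec) : wedge p 0 = 0 := by
  ext i; fin_cases i <;> simp [wedge]

theorem contract_add_left (φ ψ : Vec) (w : Biv) :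
    contract (φ + ψ) w = contract φ w + contract ψ w := by
  ext i; fin_cases i <;> simp [contract] <;> ring

theorem contract_smul_left (a : ZMod 2) (φ : Vec) (w : Biv) :
    contract (a • φ) w = a • contract φ w := by
  ext i; fin_cases i <;> simp [contract] <;> ring

theorem contract_add_right (φ : Vec) (v w : Biv) :
    contract φ (v + w) = contract φ v + contract φ w := by
  ext i; fin_cases i <;> simp [contract] <;> ring

theorem two_smul_zero {M : Type*} [AddCommGroup M] [Module (ZMod 2) M] (x : M) : x + x = 0 := by
  rw [← two_smul (ZMod 2) x]
  exact zero_smul _ x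

theorem contract_wedge (φ p x : Vec) :
    contract φ (wedge p x) = (φ ⬝ᵥ x) • p + (φ ⬝ᵥ p) • x := by
  ext i
  fin_cases i <;> simp [contract, wedge, dotProduct, Fin.sum_univ_succ] <;> grind

theorem dotProduct_contract_self (φ : Vec) (w : Biv) : φ ⬝ᵥ contract φ w = 0 := by
  simp [contract, dotProduct, Fin.sum_univ_succ]; grind

theorem dotProduct_contract_comm (φ ψ : Vec) (w : Biv) :
    φ ⬝ᵥ contract ψ w = ψ ⬝ᵥ contract φ w := by
  simp [contract, dotProduct, Fin.sum_univ_succ]; grind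

theorem contract_zero (φ : Vec) : contract φ 0 = 0 := by
  ext i; fin_cases i <;> simp [contract]

theorem klein_add (v w : Biv) : klein (v + w) = klein v + klein w + kleinPolar v w := by
  simp [klein, kleinPolar]; ring

theorem kleinPolar_add_left (u v w : Biv) :
    kleinPolar (u + v) w = kleinPolar u w + kleinPolar v w := by
  simp [kleinPolar]; ring

theorem kleinPolar_comm (v w : Biv) : kleinPolar v w = kleinPolar w v := by
  simp [kleinPolar]; ring

theorem klein_zero : klein 0 = 0 := by simp [klein]

-- A bivector annihilated by χ ≠ 0 lives on the hyperplane ker χ, and bivectors of a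
-- three-dimensional space are decomposable.
set_option maxRecDepth 100000 in
theorem klein_eq_zero_of_contract : ∀ χ : Vec, χ ≠ 0 → ∀ w : Biv, contract χ w = 0 →
    klein w = 0 := by decide +kernel

theorem kleinPolar_eq_zero_of_contract {χ : Vec} (hχ : χ ≠ 0) {v w : Biv}
    (hv : contract χ v = 0) (hw : contract χ w = 0) : kleinPolar v w = 0 := by
  have h := klein_add v w
  rw [klein_eq_zero_of_contract χ hχ v hv, klein_eq_zero_of_contract χ hχ w hw,
    klein_eq_zero_of_contract χ hχ (v + w) (by rw [contract_add_right, hv, hw, add_zero])] at h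
  simpa using h.symm

/-- The span of pairwise orthogonal singular bivectors is totally singular. -/
theorem klein_eq_zero_of_mem_span {X : Set Biv} (hq : ∀ x ∈ X, klein x = 0)
    (hb : ∀ x ∈ X, ∀ y ∈ X, kleinPolar x y = 0) {w : Biv}
    (hw : w ∈ Submodule.span (ZMod 2) X) : klein w = 0 := by
  have aux : ∀ y, (∀ x ∈ X, kleinPolar x y = 0) → ∀ w ∈ Submodule.span (ZMod 2) X,
      kleinPolar w y = 0 := by
    intro y hy w hw
    induction hw using Submodule.span_induction with
    | mem x hx => exact hy x hx
    | zero => simp [kleinPolar]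
    | add u v _ _ hu hv => rw [kleinPolar_add_left, hu, hv, add_zero]
    | smul a u _ hu =>
      rcases zmod_cases a with rfl | rfl
      · simp [kleinPolar]
      · rwa [one_smul]
  have aux' : ∀ w ∈ Submodule.span (ZMod 2) X, ∀ y ∈ Submodule.span (ZMod 2) X,
      kleinPolar w y = 0 := fun w hw y hy => aux y (fun x hx => by
        rw [kleinPolar_comm]; exact aux x (fun z hz => hb z hz x hx) y hy) w hw
  induction hw using Submodule.span_induction with
  | mem x hx => exact hq x hx
  | zero => exact klein_zero
  | add u v h h' hu hv => rw [klein_add, hu, hv, aux' u h v h', add_zero, add_zero]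
  | smul a u _ hu => rcases zmod_cases a with rfl | rfl <;> simp [hu, klein_zero]

theorem transvect_add (p φ : Vec) (v w : Biv) :
    transvect p φ (v + w) = transvect p φ v + transvect p φ w := by
  simp only [transvect, contract_add_right, wedge_add_right]; abel

theorem transvect_zero (p φ : Vec) : transvect p φ 0 = 0 := by
  rw [transvect, contract_zero, wedge_zero, add_zero]

theorem transvect_span {X : Set Biv} {p φ : Vec}
    (h : ∀ x ∈ X, transvect p φ x ∈ Submodule.span (ZMod 2) X) {w : Biv}
    (hw : w ∈ Submodule.span (ZMod 2) X) : transvect p φ w ∈ Submodule.span (ZMod 2) X := by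
  induction hw using Submodule.span_induction with
  | mem x hx => exact h x hx
  | zero => rw [transvect_zero]; exact zero_mem _
  | add u v _ _ hu hv => rw [transvect_add]; exact add_mem hu hv
  | smul a u _ hu =>
    rcases zmod_cases a with rfl | rfl
    · rw [zero_smul, transvect_zero]; exact zero_mem _
    · rwa [one_smul]

theorem transvect_transvect {p φ ψ : Vec} (h : φ ⬝ᵥ p = 0) (w : Biv) :
    transvect p φ (transvect p ψ w) = transvect p (φ + ψ) w := by
  simp only [transvect, contract_add_right, contract_add_left, wedge_add_right, contract_wedge, h,
    wedge_smul_right, wedge_self, smul_zero, zero_smul, add_zero]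
  abel

/-- This identifies `transvect q ψ` with the exterior square of the transvection of vectors. -/
theorem transvect_wedge (q ψ p x : Vec) :
    transvect q ψ (wedge p x) = wedge (p + (ψ ⬝ᵥ p) • q) (x + (ψ ⬝ᵥ x) • q) := by
  simp only [transvect, contract_wedge, wedge_add_right, wedge_add_left, wedge_smul_right,
    wedge_smul_left, wedge_self, smul_zero, add_zero]
  rw [wedge_comm q p]
  abel

/-- Naturality of contraction: functionals move by the dual transvection, vectors by the
transvection itself. -/
theorem contract_transvect {q ψ : Vec} (h : ψ ⬝ᵥ q = 0) (φ : Vec) (w : Biv) :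
    contract (φ + (φ ⬝ᵥ q) • ψ) (transvect q ψ w) =
      contract φ w + (ψ ⬝ᵥ contract φ w) • q := by
  simp only [transvect, contract_add_right, contract_add_left, contract_wedge,
    contract_smul_left, add_dotProduct, smul_dotProduct, dotProduct_contract_self, h,
    smul_zero, add_zero]
  rw [dotProduct_contract_comm φ ψ]
  have := two_smul_zero ((φ ⬝ᵥ q) • contract ψ w)
  rw [add_assoc, add_left_comm ((φ ⬝ᵥ q) • contract ψ w), this, add_zero]

theorem transvect_conj {q ψ : Vec} (h : ψ ⬝ᵥ q = 0) (p φ : Vec) (w : Biv) :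
    transvect q ψ (transvect p φ w) =
      transvect (p + (ψ ⬝ᵥ p) • q) (φ + (φ ⬝ᵥ q) • ψ) (transvect q ψ w) := by
  have e : transvect p φ w = w + wedge p (contract φ w) := rfl
  rw [e, transvect_add, transvect_wedge, ← contract_transvect h]
  rfl

theorem transvect_involutive {q ψ : Vec} (h : ψ ⬝ᵥ q = 0) (w : Biv) :
    transvect q ψ (transvect q ψ w) = w := by
  rw [transvect_transvect h, two_smul_zero, transvect]
  have : contract 0 w = 0 := by ext i; fin_cases i <;> simp [contract]
  rw [this, wedge_zero, add_zero]

/-! ### Sets of transvections of a four-dimensional space over the field with two elements -/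

/-- A set of transvections `x ↦ x + φ(x) p`, closed under conjugation and under products of
transvections with the same centre. -/
structure IsTransvectionSet (T : Vec → Vec → Prop) : Prop where
  center_ne : ∀ {p φ}, T p φ → p ≠ 0
  axis_ne : ∀ {p φ}, T p φ → φ ≠ 0
  flag : ∀ {p φ}, T p φ → φ ⬝ᵥ p = 0
  add : ∀ {p φ ψ}, T p φ → T p ψ → φ ≠ ψ → T p (φ + ψ)
  conj : ∀ {p φ q ψ}, T q ψ → T p φ → T (p + (ψ ⬝ᵥ p) • q) (φ + (φ ⬝ᵥ q) • ψ)

/-- There is a nonzero totally singular space of bivectors invariant under all transvections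
in `T`. -/
def HasSingularInvariant (T : Vec → Vec → Prop) : Prop :=
  ∃ S : Submodule (ZMod 2) Biv, S ≠ ⊥ ∧ (∀ w ∈ S, klein w = 0) ∧
    ∀ p φ, T p φ → ∀ w ∈ S, transvect p φ w ∈ S

theorem add_ne_zero_of_ne {M : Type*} [AddCommGroup M] [Module (ZMod 2) M] {x y : M}
    (h : x ≠ y) : x + y ≠ 0 := fun e => h <| by
  rw [← add_zero x, ← two_smul_zero y, ← add_assoc, e, zero_add]

set_option maxRecDepth 100000 in
theorem exists_wedge_ne_zero : ∀ v : Vec, v ≠ 0 → ∃ x, wedge v x ≠ 0 := by decide +kernel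

set_option maxRecDepth 100000 in
theorem wedge_ne_zero : ∀ u v : Vec, u ≠ 0 → v ≠ 0 → u ≠ v → wedge u v ≠ 0 := by decide +kernel

set_option maxRecDepth 100000 in
theorem exists_dot_ne_zero : ∀ v : Vec, v ≠ 0 → ∃ x, x ⬝ᵥ v = 1 := by decide +kernel

set_option maxRecDepth 100000 in
theorem exists_dot_eq_zero_one : ∀ u v : Vec, v ≠ 0 → u ≠ v → ∃ x, x ⬝ᵥ u = 0 ∧ x ⬝ᵥ v = 1 := by
  decide +kernel

set_option maxRecDepth 100000 in
theorem exists_dot_eq_zero : ∀ u v : Vec, ∃ x, x ≠ 0 ∧ x ⬝ᵥ u = 0 ∧ x ⬝ᵥ v = 0 := by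
  decide +kernel

/-- A proper subspace of `𝔽₂⁴` is contained in a hyperplane. -/
theorem exists_dot_eq_zero_of_ne_top {Z : Submodule (ZMod 2) Vec} (hZ : Z ≠ ⊤) :
    ∃ χ : Vec, χ ≠ 0 ∧ ∀ z ∈ Z, χ ⬝ᵥ z = 0 := by
  obtain ⟨f, hf, hf'⟩ := Submodule.exists_le_ker_of_lt_top Z (lt_top_iff_ne_top.2 hZ)
  have e : ∀ z : Vec, (fun i => f (Pi.single i 1)) ⬝ᵥ z = f z := fun z => by
    conv_rhs => rw [← Finset.univ_sum_single z, map_sum]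
    refine Finset.sum_congr rfl fun i _ => ?_
    rw [mul_comm, ← smul_eq_mul, ← map_smul, ← Pi.single_smul, smul_eq_mul, mul_one]
  refine ⟨fun i => f (Pi.single i 1), fun h => hf ?_, fun z hz => ?_⟩
  · refine LinearMap.ext fun z => ?_
    rw [← e, h, zero_dotProduct, LinearMap.zero_apply]
  · rw [e]
    exact hf' hz

/-- The space is `v ∧ 𝔽₂⁴`: its elements are decomposable, and it is invariant because every
transvection in `T` fixes `v`. -/
theorem hasSingularInvariant_of_fixed {T : Vec → Vec → Prop} {v : Vec} (hv : v ≠ 0)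
    (h : ∀ p φ, T p φ → φ ⬝ᵥ v = 0) : HasSingularInvariant T := by
  obtain ⟨χ, hχ, hχv, -⟩ := exists_dot_eq_zero v v
  refine ⟨Submodule.span (ZMod 2) (Set.range (wedge v)), ?_, fun w hw => ?_, fun p φ hp w hw => ?_⟩
  · obtain ⟨x, hx⟩ := exists_wedge_ne_zero v hv
    intro e
    have : wedge v x ∈ Submodule.span (ZMod 2) (Set.range (wedge v)) := Submodule.subset_span ⟨x, rfl⟩
    rw [e] at this
    exact hx this
  · have key : ∀ x, klein (wedge v x) = 0 := fun x => by
      simp [klein, wedge]; grind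
    refine klein_eq_zero_of_mem_span ?_ ?_ hw
    · rintro _ ⟨x, rfl⟩
      exact key x
    · rintro _ ⟨x, rfl⟩ _ ⟨y, rfl⟩
      have := klein_add (wedge v x) (wedge v y)
      rw [← wedge_add_right, key, key, key] at this
      simpa using this.symm
  · refine transvect_span ?_ hw
    rintro _ ⟨x, rfl⟩
    rw [transvect_wedge, h p φ hp, zero_smul, add_zero]
    exact Submodule.subset_span ⟨_, rfl⟩

/-- An invariant plane or hyperplane gives rise to a totally singular invariant space. -/
theorem hasSingularInvariant_of_subspace {T : Vec → Vec → Prop} {Z : Submodule (ZMod 2) Vec}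
    (hZ : Z ≠ ⊤) {u v : Vec} (hu : u ∈ Z) (hv : v ∈ Z) (hu0 : u ≠ 0) (hv0 : v ≠ 0) (huv : u ≠ v)
    (h : ∀ p φ, T p φ → ∀ z ∈ Z, z + (φ ⬝ᵥ z) • p ∈ Z) : HasSingularInvariant T := by
  obtain ⟨χ, hχ, hχZ⟩ := exists_dot_eq_zero_of_ne_top hZ
  -- These span the exterior square of `Z`. Since `Z` lies in the kernel of χ, all its bivectors are
  -- annihilated by χ, which makes the span totally singular; `u ∧ v` shows that it is nonzero.
  set X : Set Biv := {w | ∃ x ∈ Z, ∃ y ∈ Z, w = wedge x y} with hX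
  have key : ∀ w ∈ X, contract χ w = 0 := by
    rintro _ ⟨x, hx, y, hy, rfl⟩
    rw [contract_wedge, hχZ x hx, hχZ y hy, zero_smul, zero_smul, add_zero]
  refine ⟨Submodule.span (ZMod 2) X, ?_, fun w hw => ?_, fun p φ hp w hw => ?_⟩
  · intro e
    have : wedge u v ∈ Submodule.span (ZMod 2) X := Submodule.subset_span ⟨u, hu, v, hv, rfl⟩
    rw [e] at this
    exact wedge_ne_zero u v hu0 hv0 huv this
  · refine klein_eq_zero_of_mem_span (fun x hx => ?_) (fun x hx y hy => ?_) hw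
    · exact klein_eq_zero_of_contract χ hχ x (key x hx)
    · exact kleinPolar_eq_zero_of_contract hχ (key x hx) (key y hy)
  · refine transvect_span ?_ hw
    rintro _ ⟨x, hx, y, hy, rfl⟩
    rw [transvect_wedge]
    exact Submodule.subset_span ⟨_, h p φ hp x hx, _, h p φ hp y hy, rfl⟩

/-- All transvections with centre `p` belong to `T`. -/
def IsFullCenter (T : Vec → Vec → Prop) (p : Vec) : Prop :=
  p ≠ 0 ∧ ∀ φ, φ ≠ 0 → φ ⬝ᵥ p = 0 → T p φ

theorem dot_transvect {q ψ : Vec} (h : ψ ⬝ᵥ q = 0) (p φ : Vec) :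
    (φ + (φ ⬝ᵥ q) • ψ) ⬝ᵥ (p + (ψ ⬝ᵥ p) • q) = φ ⬝ᵥ p := by
  simp only [add_dotProduct, dotProduct_add, smul_dotProduct, dotProduct_smul, h, smul_eq_mul,
    mul_zero, add_zero]
  rw [mul_comm (φ ⬝ᵥ q), add_assoc, CharTwo.add_self_eq_zero, add_zero]

theorem vec_transvect_involutive {q ψ : Vec} (h : ψ ⬝ᵥ q = 0) (p : Vec) :
    (p + (ψ ⬝ᵥ p) • q) + (ψ ⬝ᵥ (p + (ψ ⬝ᵥ p) • q)) • q = p := by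
  rw [dotProduct_add, dotProduct_smul, h, smul_zero, add_zero, add_assoc, two_smul_zero, add_zero]

/-! ### Full centres. -/

namespace IsTransvectionSet

variable {T : Vec → Vec → Prop}

/-- Fullness is transported by conjugation: as a transvection and its dual are involutions, every
axis at the new centre is the image of an axis at `p`. -/
theorem isFullCenter_transvect (hT : IsTransvectionSet T) {p q ψ : Vec} (hp : IsFullCenter T p)
    (hq : T q ψ) : IsFullCenter T (p + (ψ ⬝ᵥ p) • q) := by
  have h := hT.flag hq
  refine ⟨fun e => hp.1 ?_, fun φ hφ hφp => ?_⟩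
  · rw [← vec_transvect_involutive h p, e]; simp
  · have h' : q ⬝ᵥ ψ = 0 := by rwa [dotProduct_comm]
    have inv := vec_transvect_involutive h' φ
    rw [dotProduct_comm q φ, dotProduct_comm q] at inv
    have hne : φ + (φ ⬝ᵥ q) • ψ ≠ 0 := fun e => hφ <| by
      rw [← inv, e]; simp
    have hd : (φ + (φ ⬝ᵥ q) • ψ) ⬝ᵥ p = 0 := by
      have := dot_transvect h (p + (ψ ⬝ᵥ p) • q) φ
      rwa [vec_transvect_involutive h, hφp] at this
    have := hT.conj hq (hp.2 _ hne hd)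
    rwa [inv] at this

/-- A transvection with centre `p` whose axis takes the value 0 at `p` and 1 at `q` moves `q` to `p
+ q`. -/
theorem isFullCenter_add (hT : IsTransvectionSet T) {p q : Vec} (hp : IsFullCenter T p)
    (hq : IsFullCenter T q) (h : p ≠ q) : IsFullCenter T (p + q) := by
  obtain ⟨ψ, hψ, hψ'⟩ := exists_dot_eq_zero_one p q hq.1 h
  have hψ0 : ψ ≠ 0 := by rintro rfl; simp at hψ'
  have := hT.isFullCenter_transvect hq (hp.2 ψ hψ0 hψ)
  rwa [hψ', one_smul, add_comm] at this

/-- Full centres together with 0 form an invariant subspace `Z`. If `Z` is everything, so is `T`. If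
`Z` is proper with two nonzero vectors, its exterior square is singular and invariant; if `Z = {0,
p}`, then `p` is fixed by `T`. -/
theorem of_isFullCenter (hT : IsTransvectionSet T) {p : Vec} (hp : IsFullCenter T p) :
    (∀ p φ, p ≠ 0 → φ ≠ 0 → φ ⬝ᵥ p = 0 → T p φ) ∨ HasSingularInvariant T := by
  let Z : Submodule (ZMod 2) Vec :=
    { carrier := {z | z = 0 ∨ IsFullCenter T z}
      zero_mem' := Or.inl rfl
      add_mem' := by
        rintro x y (rfl | hx) (rfl | hy)
        · exact Or.inl (add_zero 0)
        · rw [zero_add]; exact Or.inr hy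
        · rw [add_zero]; exact Or.inr hx
        · by_cases h : x = y
          · subst h; exact Or.inl (two_smul_zero x)
          · exact Or.inr (hT.isFullCenter_add hx hy h)
      smul_mem' := fun a x hx => by
        rcases zmod_cases a with rfl | rfl
        · rw [zero_smul]; exact Or.inl rfl
        · rwa [one_smul] }
  have hinv : ∀ q ψ, T q ψ → ∀ z ∈ Z, z + (ψ ⬝ᵥ z) • q ∈ Z := by
    rintro q ψ hq z (rfl | hz)
    · left; simp
    · exact Or.inr (hT.isFullCenter_transvect hz hq)
  by_cases hZ : Z = ⊤
  · left
    intro q φ hq hφ h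
    have : q ∈ Z := hZ ▸ Submodule.mem_top
    exact (this.resolve_left hq).2 φ hφ h
  right
  by_cases h1 : ∃ q, IsFullCenter T q ∧ q ≠ p
  · obtain ⟨q, hq, hqp⟩ := h1
    exact hasSingularInvariant_of_subspace hZ (Or.inr hq) (Or.inr hp) hq.1 hp.1 hqp hinv
  · push Not at h1
    refine hasSingularInvariant_of_fixed hp.1 fun q ψ hq => ?_
    by_contra h
    have h1' := h1 _ (hT.isFullCenter_transvect hp hq)
    rw [add_eq_left, smul_eq_zero] at h1'
    exact h1'.elim h (hT.center_ne hq)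

end IsTransvectionSet

/-! ### Independence of axes, and centres with several axes. -/

theorem exists_relation_of_dot_eq_zero {r : Vec} (hr : r ≠ 0) (v : Fin 4 → Vec)
    (h : ∀ i, v i ⬝ᵥ r = 0) : ∃ g : Fin 4 → ZMod 2, g ≠ 0 ∧ ∑ i, g i • v i = 0 := by
  by_contra! hc
  have hli : LinearIndependent (ZMod 2) v := by
    rw [Fintype.linearIndependent_iff]
    intro g hg
    by_contra! hg'
    obtain ⟨i, hi⟩ := hg'
    exact hc g (fun e => hi (by rw [e]; rfl)) hg
  have hspan : Submodule.span (ZMod 2) (Set.range v) = ⊤ :=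
    hli.span_eq_top_of_card_eq_finrank' (by simp)
  obtain ⟨x, hx⟩ := exists_dot_ne_zero r hr
  have hx' : x ∈ Submodule.span (ZMod 2) (Set.range v) := hspan ▸ Submodule.mem_top
  have : x ⬝ᵥ r = 0 := by
    clear hx
    induction hx' using Submodule.span_induction with
    | mem y hy =>
      obtain ⟨i, rfl⟩ := hy
      exact h i
    | zero => exact zero_dotProduct r
    | add y z _ _ hy hz => rw [add_dotProduct, hy, hz, add_zero]
    | smul a y _ hy => rw [smul_dotProduct, hy, smul_zero]
  rw [this] at hx
  exact zero_ne_one hx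

theorem independent_pair {M : Type*} [AddCommGroup M] [Module (ZMod 2) M] {x y : M} (hx : x ≠ 0)
    (hy : y ≠ 0) (h : x ≠ y) {a b : ZMod 2} (e : a • x + b • y = 0) : a = 0 ∧ b = 0 := by
  rcases zmod_cases a with rfl | rfl <;> rcases zmod_cases b with rfl | rfl
  · exact ⟨rfl, rfl⟩
  · simp [hy] at e
  · simp [hx] at e
  · rw [one_smul, one_smul] at e
    exact absurd e (add_ne_zero_of_ne h)

/-- If non-orthogonal bivectors are annihilated by two pairs of functionals, then these four
functionals are independent. -/
theorem independent_of_kleinPolar_ne_zero {w w' : Biv} (hw : kleinPolar w w' ≠ 0)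
    {α β α' β' : Vec} (hα : α ≠ 0) (hβ : β ≠ 0) (hαβ : α ≠ β) (hα' : α' ≠ 0) (hβ' : β' ≠ 0)
    (hαβ' : α' ≠ β') (h1 : contract α w = 0) (h2 : contract β w = 0) (h3 : contract α' w' = 0)
    (h4 : contract β' w' = 0) {a b c d : ZMod 2}
    (e : a • α + b • β + (c • α' + d • β') = 0) : (a = 0 ∧ b = 0) ∧ c = 0 ∧ d = 0 := by
  have e' : a • α + b • β = c • α' + d • β' := by
    have := two_smul_zero (c • α' + d • β')
    rw [← sub_eq_zero, ← e, sub_eq_add_neg, add_right_inj, neg_eq_iff_add_eq_zero, this]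
  -- A nonzero functional common to both pencils would annihilate `w` and `w'`, forcing them to be
  -- orthogonal.
  have h0 : a • α + b • β = 0 := by
    by_contra hne
    refine hw (kleinPolar_eq_zero_of_contract hne ?_ ?_)
    · simp [contract_add_left, contract_smul_left, h1, h2]
    · rw [e']
      simp [contract_add_left, contract_smul_left, h3, h4]
  exact ⟨independent_pair hα hβ hαβ h0, independent_pair hα' hβ' hαβ' (e' ▸ h0)⟩

-- The common kernel of two functionals has dimension at least two; the wedge of two independent
-- vectors in it works.
set_option maxRecDepth 100000 in
theorem exists_contract_eq_zero : ∀ φ ψ : Vec,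
    ∃ w : Biv, w ≠ 0 ∧ contract φ w = 0 ∧ contract ψ w = 0 := by
  intro φ ψ
  obtain ⟨u, hu, h1, h2⟩ := exists_dot_eq_zero φ ψ
  have : ∀ φ ψ u : Vec, u ≠ 0 → φ ⬝ᵥ u = 0 → ψ ⬝ᵥ u = 0 →
      ∃ v, v ≠ 0 ∧ u ≠ v ∧ φ ⬝ᵥ v = 0 ∧ ψ ⬝ᵥ v = 0 := by decide +kernel
  rw [dotProduct_comm] at h1 h2
  obtain ⟨v, hv, huv, h3, h4⟩ := this φ ψ u hu h1 h2
  refine ⟨wedge u v, wedge_ne_zero u v hu hv huv, ?_, ?_⟩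
  · simp [contract_wedge, h1, h3]
  · simp [contract_wedge, h2, h4]

namespace IsTransvectionSet

variable {T : Vec → Vec → Prop}

/-- The axes of the transvections in `T` with a given centre. -/
def axes (hT : IsTransvectionSet T) (p : Vec) : Submodule (ZMod 2) Vec where
  carrier := {φ | φ = 0 ∨ T p φ}
  zero_mem' := Or.inl rfl
  add_mem' := by
    rintro x y (rfl | hx) (rfl | hy)
    · exact Or.inl (add_zero 0)
    · rw [zero_add]; exact Or.inr hy
    · rw [add_zero]; exact Or.inr hx
    · by_cases h : x = y
      · subst h; exact Or.inl (two_smul_zero x)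
      · exact Or.inr (hT.add hx hy h)
  smul_mem' := fun a x hx => by
    rcases zmod_cases a with rfl | rfl
    · rw [zero_smul]; exact Or.inl rfl
    · rwa [one_smul]

/-- The functionals vanishing at `r` form a three-dimensional space, so three independent axes span
it, and the axes at `r` are closed under addition. -/
theorem isFullCenter_of_independent (hT : IsTransvectionSet T) {r α β γ : Vec} (hα : T r α)
    (hβ : T r β) (hγ : T r γ)
    (h : ∀ a b c : ZMod 2, a • α + b • β + c • γ = 0 → a = 0 ∧ b = 0 ∧ c = 0) :
    IsFullCenter T r := by
  refine ⟨hT.center_ne hα, fun φ hφ hφr => ?_⟩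
  obtain ⟨g, hg, e⟩ := exists_relation_of_dot_eq_zero (hT.center_ne hα) ![α, β, γ, φ] (by
    intro i
    fin_cases i
    exacts [hT.flag hα, hT.flag hβ, hT.flag hγ, hφr])
  simp only [Fin.sum_univ_four, Matrix.cons_val_zero, Matrix.cons_val_one, Matrix.cons_val] at e
  rcases zmod_cases (g 3) with h3 | h3
  · rw [h3, zero_smul, add_zero] at e
    obtain ⟨h0, h1, h2⟩ := h _ _ _ e
    refine absurd ?_ hg
    ext i
    fin_cases i <;> assumption
  · rw [h3, one_smul] at e
    have hmem : g 0 • α + g 1 • β + g 2 • γ ∈ hT.axes r :=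
      add_mem (add_mem (Submodule.smul_mem _ _ (Or.inr hα)) (Submodule.smul_mem _ _ (Or.inr hβ)))
        (Submodule.smul_mem _ _ (Or.inr hγ))
    rw [add_eq_zero_iff_eq_neg] at e
    rw [e] at hmem
    exact ((neg_mem_iff.1 hmem).resolve_left hφ)

/-- Normalizes a pair of axes inside the pencil `{φ, ψ, φ + ψ}`: unless both kill `q`, exactly one
of the three vanishes at `q`. -/
theorem exists_dot_zero_one (hT : IsTransvectionSet T) {p φ ψ q : Vec} {w : Biv} (hφ : T p φ)
    (hψ : T p ψ) (h : φ ≠ ψ) (hφw : contract φ w = 0) (hψw : contract ψ w = 0)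
    (hq : ¬(φ ⬝ᵥ q = 0 ∧ ψ ⬝ᵥ q = 0)) :
    ∃ α β, T p α ∧ T p β ∧ contract α w = 0 ∧ contract β w = 0 ∧ α ⬝ᵥ q = 0 ∧ β ⬝ᵥ q = 1 := by
  have hs : contract (φ + ψ) w = 0 := by rw [contract_add_left, hφw, hψw, add_zero]
  rcases zmod_cases (φ ⬝ᵥ q) with h1 | h1 <;> rcases zmod_cases (ψ ⬝ᵥ q) with h2 | h2
  · exact absurd ⟨h1, h2⟩ hq
  · exact ⟨φ, ψ, hφ, hψ, hφw, hψw, h1, h2⟩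
  · exact ⟨ψ, φ, hψ, hφ, hψw, hφw, h2, h1⟩
  · refine ⟨φ + ψ, ψ, hT.add hφ hψ h, hψ, hs, hψw, ?_, h2⟩
    rw [add_dotProduct, h1, h2]
    decide

/-- The four axes are independent, so they have no common zero. They can be normalized to φ, φ' at
`p` and ψ, ψ' at `q` with φ(q) = 0, φ'(q) = 1, ψ(p) = 0, ψ'(p) = 1. Conjugating transvections with
centre `q` by transvections with centre `p` then yields the centre `p + q` with the independent axes
ψ, φ' + ψ' and φ + φ' + ψ'. -/
theorem exists_isFullCenter (hT : IsTransvectionSet T) {w w' : Biv} (hw : kleinPolar w w' ≠ 0)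
    {p α β q α' β' : Vec} (hα : T p α) (hβ : T p β) (hαβ : α ≠ β) (hα' : T q α') (hβ' : T q β')
    (hαβ' : α' ≠ β') (h1 : contract α w = 0) (h2 : contract β w = 0) (h3 : contract α' w' = 0)
    (h4 : contract β' w' = 0) : ∃ r, IsFullCenter T r := by
  have indep := fun {a b c d : ZMod 2} => independent_of_kleinPolar_ne_zero hw (hT.axis_ne hα)
    (hT.axis_ne hβ) hαβ (hT.axis_ne hα') (hT.axis_ne hβ') hαβ' h1 h2 h3 h4 (a := a) (b := b)
    (c := c) (d := d)
  have nondeg : ∀ r : Vec, r ≠ 0 →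
      ¬((α ⬝ᵥ r = 0 ∧ β ⬝ᵥ r = 0) ∧ (α' ⬝ᵥ r = 0 ∧ β' ⬝ᵥ r = 0)) := by
    rintro r hr ⟨⟨k1, k2⟩, k3, k4⟩
    obtain ⟨g, hg, e⟩ := exists_relation_of_dot_eq_zero hr ![α, β, α', β'] (by
      intro i
      fin_cases i
      exacts [k1, k2, k3, k4])
    simp only [Fin.sum_univ_four, Matrix.cons_val_zero, Matrix.cons_val_one, Matrix.cons_val] at e
    rw [add_assoc] at e
    obtain ⟨⟨l1, l2⟩, l3, l4⟩ := indep e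
    refine hg ?_
    ext i
    fin_cases i <;> assumption
  obtain ⟨φ, φ', hφ, hφ', hφw, hφw', hφq, hφq'⟩ := hT.exists_dot_zero_one (q := q) hα hβ hαβ h1 h2
    fun h => nondeg q (hT.center_ne hα') ⟨h, hT.flag hα', hT.flag hβ'⟩
  obtain ⟨ψ, ψ', hψ, hψ', hψw, hψw', hψp, hψp'⟩ := hT.exists_dot_zero_one (q := p) hα' hβ' hαβ' h3 h4
    fun h => nondeg p (hT.center_ne hα) ⟨⟨hT.flag hα, hT.flag hβ⟩, h⟩
  have hφφ' : φ ≠ φ' := by rintro rfl; rw [hφq] at hφq'; exact zero_ne_one hφq'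
  have hψψ' : ψ ≠ ψ' := by rintro rfl; rw [hψp] at hψp'; exact zero_ne_one hψp'
  have t1 := hT.conj hφ' hψ
  have t2 := hT.conj hφ' hψ'
  have t3 := hT.conj (hT.add hφ hφ' hφφ') hψ'
  rw [add_dotProduct, hφq, hφq', hψp', zero_add, one_smul, one_smul] at t3
  rw [hφq', hψp, one_smul, zero_smul, add_zero] at t1
  rw [hφq', hψp', one_smul, one_smul] at t2
  refine ⟨_, hT.isFullCenter_of_independent t1 t2 t3 fun a b c e => ?_⟩
  have e' : c • φ + (b + c) • φ' + (a • ψ + (b + c) • ψ') = 0 := by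
    rw [← e]; module
  obtain ⟨⟨k1, k2⟩, k3, -⟩ := independent_of_kleinPolar_ne_zero hw (hT.axis_ne hφ) (hT.axis_ne hφ')
    hφφ' (hT.axis_ne hψ) (hT.axis_ne hψ') hψψ' hφw hφw' hψw hψw' e'
  rw [k1, add_zero] at k2
  exact ⟨k3, k2, k1⟩

/-- The space is spanned by the bivectors annihilated by two distinct axes at one centre. Two such
bivectors that were not orthogonal would produce a full centre, and conjugation permutes them. -/
theorem hasSingularInvariant_of_two_axes (hT : IsTransvectionSet T)
    (hfull : ∀ r, ¬IsFullCenter T r) {p α β : Vec} (hα : T p α) (hβ : T p β) (hαβ : α ≠ β) :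
    HasSingularInvariant T := by
  set X : Set Biv := {w | ∃ p α β, T p α ∧ T p β ∧ α ≠ β ∧ contract α w = 0 ∧ contract β w = 0}
    with hX
  refine ⟨Submodule.span (ZMod 2) X, ?_, fun w hw => ?_, fun q ψ hq w hw => ?_⟩
  · obtain ⟨w, hw, h1, h2⟩ := exists_contract_eq_zero α β
    intro e
    have : w ∈ Submodule.span (ZMod 2) X :=
      Submodule.subset_span ⟨p, α, β, hα, hβ, hαβ, h1, h2⟩
    rw [e] at this
    exact hw this
  · refine klein_eq_zero_of_mem_span ?_ ?_ hw
    · rintro x ⟨p, α, β, hα, -, -, h, -⟩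
      exact klein_eq_zero_of_contract α (hT.axis_ne hα) x h
    · rintro x ⟨p, α, β, hα, hβ, hαβ, h1, h2⟩ y ⟨q, α', β', hα', hβ', hαβ', h3, h4⟩
      by_contra hne
      obtain ⟨r, hr⟩ := hT.exists_isFullCenter hne hα hβ hαβ hα' hβ' hαβ' h1 h2 h3 h4
      exact hfull r hr
  · refine transvect_span ?_ hw
    rintro x ⟨p, α, β, hα, hβ, hαβ, h1, h2⟩
    refine Submodule.subset_span ⟨_, _, _, hT.conj hq hα, hT.conj hq hβ, fun e => hαβ ?_, ?_, ?_⟩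
    · have inv := vec_transvect_involutive (q := ψ) (ψ := q) (by
        rw [dotProduct_comm]; exact hT.flag hq)
      rw [← inv α, ← inv β, dotProduct_comm q α, dotProduct_comm q β, e]
    · rw [contract_transvect (hT.flag hq), h1, dotProduct_zero, zero_smul, add_zero]
    · rw [contract_transvect (hT.flag hq), h2, dotProduct_zero, zero_smul, add_zero]

/-- The case in which each centre has exactly one axis: the transvections preserve an alternating
form, that is, a bivector. -/
theorem of_unique_axis (hT : IsTransvectionSet T)
    (huniq : ∀ p φ ψ, T p φ → T p ψ → φ = ψ) :
    HasSingularInvariant T ∨ ∃ w, w ≠ 0 ∧ ∀ p φ, T p φ → transvect p φ w = w := by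
  -- If ψ(p) = 0, conjugating by the transvection `(q, ψ)` gives one with centre `p` and axis φ +
  -- φ(q) ψ; uniqueness of the axis forces φ(q) = 0.
  have symm : ∀ {p φ q ψ}, T p φ → T q ψ → φ ⬝ᵥ q = ψ ⬝ᵥ p := by
    have aux : ∀ {p φ q ψ}, T p φ → T q ψ → ψ ⬝ᵥ p = 0 → φ ⬝ᵥ q = 0 := by
      intro p φ q ψ hp hq h
      have h1 := hT.conj hq hp
      rw [h, zero_smul, add_zero] at h1
      have h2 := huniq _ _ _ h1 hp
      rw [add_eq_left, smul_eq_zero] at h2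
      exact h2.resolve_right (hT.axis_ne hq)
    intro p φ q ψ hp hq
    rcases zmod_cases (φ ⬝ᵥ q) with h1 | h1 <;> rcases zmod_cases (ψ ⬝ᵥ p) with h2 | h2
    · rw [h1, h2]
    · rw [aux hq hp h1, h1]
    · rw [aux hp hq h2, h2]
    · rw [h1, h2]
  set X : Set (Vec × Vec) := {x | T x.2 x.1} with hX
  set R := Submodule.span (ZMod 2) X with hR
  have polar : ∀ x ∈ R, ∀ y ∈ R, x.1 ⬝ᵥ y.2 = y.1 ⬝ᵥ x.2 := by
    have aux : ∀ y : Vec × Vec, (∀ x ∈ X, x.1 ⬝ᵥ y.2 = y.1 ⬝ᵥ x.2) →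
        ∀ x ∈ R, x.1 ⬝ᵥ y.2 = y.1 ⬝ᵥ x.2 := by
      intro y hy x hx
      induction hx using Submodule.span_induction with
      | mem x hx => exact hy x hx
      | zero => simp
      | add u v _ _ hu hv => simp [hu, hv]
      | smul a u _ hu => simp [hu]
    exact fun x hx y hy => aux y (fun z hz => (aux z (fun t ht => symm hz ht |>.symm) y hy).symm) x hx
  have alt : ∀ x ∈ R, x.1 ⬝ᵥ x.2 = 0 := by
    intro x hx
    induction hx using Submodule.span_induction with
    | mem x hx => exact hT.flag hx
    | zero => simp
    | add u v h h' hu hv =>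
      rw [Prod.fst_add, Prod.snd_add, add_dotProduct, dotProduct_add, dotProduct_add, hu, hv,
        polar u h v h', zero_add, add_zero, CharTwo.add_self_eq_zero]
    | smul a u _ hu => simp [hu]
  by_cases hne : ∃ p φ, T p φ
  swap
  · push Not at hne
    exact Or.inl (hasSingularInvariant_of_fixed (v := fun _ => 1) (by decide)
      fun p φ h => absurd h (hne p φ))
  -- If the axes do not span the dual, they have a common zero, which is a vector fixed by `T`. If
  -- they do, `R` is the graph of an alternating map from functionals to vectors.
  by_cases htop : R.map (LinearMap.fst (ZMod 2) Vec Vec) = ⊤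
  swap
  · obtain ⟨χ, hχ, h⟩ := exists_dot_eq_zero_of_ne_top htop
    refine Or.inl (hasSingularInvariant_of_fixed hχ fun p φ hp => ?_)
    rw [dotProduct_comm]
    exact h φ ⟨(φ, p), Submodule.subset_span hp, rfl⟩
  right
  have hex : ∀ φ : Vec, ∃ p, (φ, p) ∈ R := fun φ => by
    have : φ ∈ R.map (LinearMap.fst (ZMod 2) Vec Vec) := htop ▸ Submodule.mem_top
    obtain ⟨⟨φ', p⟩, h, rfl⟩ := this
    exact ⟨p, h⟩
  have hgraph : ∀ φ p q, (φ, p) ∈ R → (φ, q) ∈ R → p = q := fun φ p q h h' => by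
    by_contra hpq
    have h0 := sub_mem h h'
    obtain ⟨ψ, hψ⟩ := exists_dot_ne_zero (p - q) (sub_ne_zero.2 hpq)
    obtain ⟨r, hr⟩ := hex ψ
    have := polar _ hr _ h0
    rw [Prod.mk_sub_mk, sub_self, zero_dotProduct, hψ] at this
    exact one_ne_zero this
  choose s hs using fun i : Fin 4 => hex (Pi.single i 1)
  have s_symm : ∀ i j, s i j = s j i := fun i j => by
    simpa using polar _ (hs j) _ (hs i)
  have s_alt : ∀ i, s i i = 0 := fun i => by simpa using alt _ (hs i)
  -- The matrix `s` of that map is symmetric with zero diagonal, so the map is contraction by the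
  -- bivector with these entries. Each axis contracts `w` to its centre `p`, and `transvect` then
  -- adds only `p ∧ p = 0`.
  set w : Biv := ![s 0 1, s 2 3, s 0 2, s 1 3, s 0 3, s 1 2] with hw
  have hcontract : ∀ p φ, T p φ → contract φ w = p := fun p φ hp => by
    refine hgraph φ _ _ ?_ (Submodule.subset_span hp)
    have e : (φ, contract φ w) = ∑ i, φ i • ((Pi.single i 1, s i) : Vec × Vec) := by
      refine Prod.ext ?_ ?_
      · rw [Prod.fst_sum]
        ext j
        simp [Finset.sum_apply, Pi.single_apply]
      · rw [Prod.snd_sum]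
        ext j
        have h10 := s_symm 1 0
        have h20 := s_symm 2 0
        have h30 := s_symm 3 0
        have h21 := s_symm 2 1
        have h31 := s_symm 3 1
        have h32 := s_symm 3 2
        fin_cases j <;>
          simp [contract, hw, Fin.sum_univ_four, s_alt, h10, h20, h30, h21, h31, h32] <;> ring
    rw [e]
    exact sum_mem fun i _ => Submodule.smul_mem _ _ (hs i)
  refine ⟨w, ?_, fun p φ hp => ?_⟩
  · obtain ⟨p, φ, hp⟩ := hne
    rintro h0
    refine hT.center_ne hp ?_
    rw [← hcontract p φ hp, h0, contract_zero]
  · rw [transvect, hcontract p φ hp, wedge_self, add_zero]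

/-- A set of transvections consists of all transvections, or preserves a totally singular space of
bivectors, or fixes a bivector. -/
theorem trichotomy (hT : IsTransvectionSet T) :
    (∀ p φ, p ≠ 0 → φ ≠ 0 → φ ⬝ᵥ p = 0 → T p φ) ∨ HasSingularInvariant T ∨
      ∃ w, w ≠ 0 ∧ ∀ p φ, T p φ → transvect p φ w = w := by
  by_cases hfull : ∃ r, IsFullCenter T r
  · obtain ⟨r, hr⟩ := hfull
    exact (hT.of_isFullCenter hr).imp_right Or.inl
  push Not at hfull
  right
  by_cases h2 : ∃ p φ ψ, T p φ ∧ T p ψ ∧ φ ≠ ψ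
  · obtain ⟨p, φ, ψ, hφ, hψ, h⟩ := h2
    exact Or.inl (hT.hasSingularInvariant_of_two_axes hfull hφ hψ h)
  · push Not at h2
    exact hT.of_unique_axis h2

end IsTransvectionSet

/-! ### Finite geometry of the Klein quadric -/

/-- `s` and `a` span a totally singular plane of bivectors. -/
structure IsSingularPlane (s a : Biv) : Prop where
  klein_left : klein s = 0
  klein_right : klein a = 0
  polar : kleinPolar s a = 0
  left_ne : s ≠ 0
  right_ne : a ≠ 0
  ne : s ≠ a

theorem isSingularPlane_of_polar {s a x : Biv} (hs : klein s = 0) (ha : klein a = 0)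
    (h : kleinPolar s a = 0) (hs0 : s ≠ 0) (hxs : kleinPolar x s = 0) (hxa : kleinPolar x a = 1) :
    IsSingularPlane s a := by
  refine ⟨hs, ha, h, hs0, ?_, ?_⟩
  · rintro rfl
    simp [kleinPolar] at hxa
  · rintro rfl
    rw [hxs] at hxa
    exact zero_ne_one hxa

/-! ### Incidence facts about the Klein quadric, by exhaustion. -/

section Decide

set_option maxRecDepth 100000

theorem exists_kleinPolar_zero_one : ∀ v w : Biv, v ≠ 0 → v ≠ w →
    ∃ y, kleinPolar y w = 0 ∧ kleinPolar y v = 1 := by decide +kernel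

theorem exists_kleinPolar_eq_one : ∀ v : Biv, v ≠ 0 → ∃ y, kleinPolar y v = 1 := by decide +kernel

theorem exists_singular_zero_one : ∀ s : Biv, klein s = 0 → s ≠ 0 → ∀ v, kleinPolar s v = 0 ∧
    s ≠ v ∧ v ≠ 0 → ∃ a, klein a = 0 ∧ kleinPolar s a = 0 ∧ kleinPolar v a = 1 := by decide +kernel

theorem exists_singular_orthogonal : ∀ s : Biv, klein s = 0 → ∀ t, klein t = 0 →
    kleinPolar s t = 1 → ∃ r, klein r = 0 ∧ kleinPolar s r = 0 ∧ kleinPolar t r = 0 ∧ r ≠ 0 := by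
  decide +kernel

theorem exists_singular_mem_orthogonal : ∀ v : Biv,
    ∃ s, klein s = 0 ∧ kleinPolar v s = 0 ∧ s ≠ 0 ∧ s ≠ v := by
  decide +kernel

theorem exists_nonsingular_orthogonal : ∀ s : Biv, klein s = 0 → ∀ a, klein a = 0 →
    kleinPolar s a = 0 → ∃ v, klein v = 1 ∧ kleinPolar v s = 0 ∧ kleinPolar v a = 0 := by
  decide +kernel

theorem exists_nonsingular_orthogonal' : ∀ v : Biv, klein v = 1 → ∀ w, klein w = 1 →
    kleinPolar v w = 1 → ∃ u, klein u = 1 ∧ kleinPolar u v = 0 ∧ kleinPolar u w = 0 := by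
  decide +kernel

/-- A basis of nonsingular bivectors. -/
def witt : Fin 6 → Biv :=
  ![![0, 0, 0, 0, 1, 1], ![0, 0, 1, 1, 0, 1], ![0, 1, 0, 0, 1, 1], ![1, 0, 0, 1, 1, 1],
    ![0, 0, 1, 0, 1, 1], ![0, 0, 0, 1, 1, 1]]

theorem klein_witt : ∀ i, klein (witt i) = 1 := by decide +kernel

/-- One step of Witt's extension argument: `v` plays the image of `witt k` under an isometry fixing
the earlier vectors. The vector `u` is an intermediate stop for when `v` cannot be moved to `witt k`
by a single reflection. -/
theorem witt_step : ∀ k : Fin 6, ∀ v, klein v = 1 →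
    (∀ j < k, kleinPolar v (witt j) = kleinPolar (witt k) (witt j) ∧ v ≠ witt j) →
    v = witt k ∨ kleinPolar v (witt k) = 1 ∨ ∃ u, klein u = 1 ∧
      (∀ j < k, kleinPolar u (witt j) = kleinPolar (witt k) (witt j)) ∧
      kleinPolar v u = 1 ∧ kleinPolar u (witt k) = 1 := by decide +kernel

theorem single_eq_witt :
    (Pi.single 0 1 : Biv) = witt 3 + witt 5 ∧ (Pi.single 1 1 : Biv) = witt 0 + witt 2 ∧
    (Pi.single 2 1 : Biv) = witt 0 + witt 4 ∧ (Pi.single 3 1 : Biv) = witt 0 + witt 5 ∧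
    (Pi.single 4 1 : Biv) = witt 0 + witt 1 + witt 4 + witt 5 ∧
    (Pi.single 5 1 : Biv) = witt 1 + witt 4 + witt 5 := by decide +kernel

/-- The swapped coordinates are those of the dual bivector, whose contraction by `p` vanishes
exactly when `p ∧ s = 0`. Orthogonal decomposable bivectors correspond to planes of 𝔽₂⁴ that meet
nontrivially. -/
theorem exists_common_vector : ∀ s : Biv, klein s = 0 → ∀ a, klein a = 0 → kleinPolar s a = 0 →
    ∃ p : Vec, p ≠ 0 ∧ contract p ![s 1, s 0, s 3, s 2, s 5, s 4] = 0 ∧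
      contract p ![a 1, a 0, a 3, a 2, a 5, a 4] = 0 := by decide +kernel

theorem exists_eq_wedge : ∀ p : Vec, p ≠ 0 → ∀ s : Biv,
    contract p ![s 1, s 0, s 3, s 2, s 5, s 4] = 0 → ∃ x, s = wedge p x := by decide +kernel

end Decide

theorem linearMap_eq_of_witt {M : Type*} [AddCommGroup M] [Module (ZMod 2) M]
    {f g : Biv →ₗ[ZMod 2] M} (h : ∀ j, f (witt j) = g (witt j)) : f = g := by
  obtain ⟨h0, h1, h2, h3, h4, h5⟩ := single_eq_witt
  refine LinearMap.pi_ext' fun i => LinearMap.ext_ring ?_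
  simp only [LinearMap.coe_comp, Function.comp_apply, LinearMap.coe_single]
  fin_cases i
  · change f (Pi.single 0 1) = g (Pi.single 0 1)
    simp only [h0, map_add, h]
  · change f (Pi.single 1 1) = g (Pi.single 1 1)
    simp only [h1, map_add, h]
  · change f (Pi.single 2 1) = g (Pi.single 2 1)
    simp only [h2, map_add, h]
  · change f (Pi.single 3 1) = g (Pi.single 3 1)
    simp only [h3, map_add, h]
  · change f (Pi.single 4 1) = g (Pi.single 4 1)
    simp only [h4, map_add, h]
  · change f (Pi.single 5 1) = g (Pi.single 5 1)
    simp only [h5, map_add, h]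

/-- The functional `det (p, x, y, ·)`. -/
def triple (p x y : Vec) : Vec :=
  contract y ![wedge p x 1, wedge p x 0, wedge p x 3, wedge p x 2, wedge p x 5, wedge p x 4]

theorem triple_dot (p x y : Vec) : triple p x y ⬝ᵥ p = 0 := by
  simp [triple, contract, wedge, dotProduct, Fin.sum_univ_succ]
  grind

theorem contract_triple (p x y : Vec) (w : Biv) :
    contract (triple p x y) w = kleinPolar w (wedge p x) • y + kleinPolar w (wedge p y) • x +
      kleinPolar w (wedge x y) • p := by
  ext i
  fin_cases i <;> simp [triple, contract, wedge, kleinPolar] <;> grind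

/-- The Siegel transformations of totally singular planes are the actions of transvections. -/
theorem IsSingularPlane.exists_transvect {s a : Biv} (h : IsSingularPlane s a) :
    ∃ p φ : Vec, p ≠ 0 ∧ φ ≠ 0 ∧ φ ⬝ᵥ p = 0 ∧
      ∀ w, transvect p φ w = w + (kleinPolar w s • a + kleinPolar w a • s) := by
  obtain ⟨p, hp, h1, h2⟩ := exists_common_vector s h.klein_left a h.klein_right h.polar
  obtain ⟨x, rfl⟩ := exists_eq_wedge p hp s h1
  obtain ⟨y, rfl⟩ := exists_eq_wedge p hp a h2
  -- Contraction by the functional `det (p, x, y, ·)` gives a combination of `y`, `x` and `p`, and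
  -- wedging with `p` removes the last term.
  have key : ∀ w, transvect p (triple p x y) w =
      w + (kleinPolar w (wedge p x) • wedge p y + kleinPolar w (wedge p y) • wedge p x) := by
    intro w
    simp only [transvect, contract_triple, wedge_add_right, wedge_smul_right, wedge_self,
      smul_zero, add_zero]
  refine ⟨p, triple p x y, hp, fun h0 => h.right_ne ?_, triple_dot p x y, key⟩
  obtain ⟨w, hw, hw'⟩ := exists_kleinPolar_zero_one _ _ h.left_ne h.ne
  have := key w
  rw [h0, hw, hw', one_smul, zero_smul, add_zero, transvect] at this
  have e : contract 0 w = 0 := by ext i; fin_cases i <;> simp [contract]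
  rw [e, wedge_zero] at this
  exact (add_left_cancel this).symm

/-! ### Coordinates on `H / {±1}` -/

/-- The inclusions of `O₂` as the three tensor factors. -/
def factor (i : Fin 3) : Matrix.orthogonalGroup (Fin 2) ℝ →* SO8 :=
  tensorHom.comp (![MonoidHom.inl _ _, (MonoidHom.inr _ _).comp (MonoidHom.inl _ _),
    (MonoidHom.inr _ _).comp (MonoidHom.inr _ _)] i)

theorem factor_zero (a : Matrix.orthogonalGroup (Fin 2) ℝ) :
    factor 0 a = tensorHom (a, 1, 1) := rfl

theorem factor_one (a : Matrix.orthogonalGroup (Fin 2) ℝ) :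
    factor 1 a = tensorHom (1, a, 1) := rfl

theorem factor_two (a : Matrix.orthogonalGroup (Fin 2) ℝ) :
    factor 2 a = tensorHom (1, 1, a) := rfl

theorem factor_mem (i : Fin 3) {a : Matrix.orthogonalGroup (Fin 2) ℝ} (ha : a ∈ WI24) :
    factor i a ∈ H := by
  fin_cases i
  · exact mem_H.2 ⟨a, ha, 1, one_mem _, 1, one_mem _, rfl⟩
  · exact mem_H.2 ⟨1, one_mem _, a, ha, 1, one_mem _, rfl⟩
  · exact mem_H.2 ⟨1, one_mem _, 1, one_mem _, a, ha, rfl⟩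

theorem factor_commute {i j : Fin 3} (h : i ≠ j) (a b : Matrix.orthogonalGroup (Fin 2) ℝ) :
    factor i a * factor j b = factor j b * factor i a := by
  fin_cases i <;> fin_cases j <;> first
    | exact absurd rfl h
    | simp [factor, ← map_mul]

/-- The generators of `H`, in an order such that their classes correspond to the coordinates of
bivectors. -/
def gen (k : Fin 6) : H :=
  ![⟨factor 0 refl₂, factor_mem 0 refl₂_mem⟩, ⟨factor 0 refl₁, factor_mem 0 refl₁_mem⟩,
    ⟨factor 1 refl₂, factor_mem 1 refl₂_mem⟩, ⟨factor 1 refl₁, factor_mem 1 refl₁_mem⟩,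
    ⟨factor 2 refl₂, factor_mem 2 refl₂_mem⟩, ⟨factor 2 refl₁, factor_mem 2 refl₁_mem⟩] k

theorem refl₁_mul_self : refl₁ * refl₁ = 1 := by
  refine Subtype.ext ?_
  change refl₁.1 * refl₁.1 = 1
  simp [refl₁, Matrix.one_fin_two]

theorem refl₂_mul_self : refl₂ * refl₂ = 1 := by
  refine Subtype.ext ?_
  change refl₂.1 * refl₂.1 = 1
  simp [refl₂, Matrix.one_fin_two]

theorem refl_not_commute : refl₁.1 * refl₂.1 ≠ refl₂.1 * refl₁.1 := by
  intro h
  have := congrFun (congrFun h 0) 1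
  simp [refl₁, refl₂] at this
  norm_num at this

theorem factor_not_commute (i : Fin 3) : factor i refl₁ * factor i refl₂ ≠
    factor i refl₂ * factor i refl₁ := by
  have one : (1 : Matrix.orthogonalGroup (Fin 2) ℝ).1 ≠ 0 := orth_ne_zero 1
  intro h
  rw [← map_mul, ← map_mul] at h
  have h' := congrArg Subtype.val h
  refine refl_not_commute ?_
  fin_cases i
  · exact kron_right_cancel (kron_ne_zero one one) h'
  · exact kron_right_cancel one (kron_left_cancel one h')
  · exact kron_left_cancel one (kron_left_cancel one h')

theorem gen_mul_self (k : Fin 6) : gen k * gen k = 1 := by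
  have key : ∀ i a, a * a = 1 → factor i a * factor i a = 1 := fun i a h => by
    rw [← map_mul, h, map_one]
  refine Subtype.ext ?_
  fin_cases k
  exacts [key _ _ refl₂_mul_self, key _ _ refl₁_mul_self, key _ _ refl₂_mul_self,
    key _ _ refl₁_mul_self, key _ _ refl₂_mul_self, key _ _ refl₁_mul_self]

theorem sqType_eq_zero {h : H} (e : h * h = 1) : sqType h = 0 :=
  if_pos (by rw [← mat_mul, e, mat_one])

theorem commType_eq_zero_iff {h k : H} : commType h k = 0 ↔ h * k = k * h := by
  constructor
  · intro e
    have := mat_comm h k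
    rw [e, sgn_zero, one_mul] at this
    exact mat_inj this
  · intro e
    have := mat_comm h k
    rw [← mat_mul, ← mat_mul, ← e] at this
    refine sgn_inj ?_
    rw [sgn_zero]
    have h2 := congrArg (· * mat (h * k)⁻¹) this
    simp only [mul_assoc, mat_mul_inv, mul_one] at h2
    exact h2.symm

theorem polar_eq_commType (h k : H) : Q.polarBilin (toA h) (toA k) = commType h k := rfl

theorem Q_toA (h : H) : Q (toA h) = sqType h := rfl

theorem polar_gen_eq_zero {k l : Fin 6} (h : gen k * gen l = gen l * gen k) :
    Q.polarBilin (toA (gen k)) (toA (gen l)) = 0 := commType_eq_zero_iff.2 h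

theorem polar_gen_eq_one {k l : Fin 6} (h : gen k * gen l ≠ gen l * gen k) :
    Q.polarBilin (toA (gen k)) (toA (gen l)) = 1 :=
  (zmod_cases _).resolve_left (mt commType_eq_zero_iff.1 h)

/-- The linear map from bivectors to `H / {±1}` given by the generators of `H`. -/
noncomputable def coordMap : Biv →ₗ[ZMod 2] A :=
  Fintype.linearCombination (ZMod 2) (fun k => toA (gen k))

/-- The generators are involutions. The two from one tensor factor anticommute and those from
different factors commute, so their classes form three mutually orthogonal hyperbolic pairs. -/
theorem Q_coordMap (x : Biv) : Q (coordMap x) = klein x := by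
  have hq : ∀ k, Q (toA (gen k)) = 0 := fun k => sqType_eq_zero (gen_mul_self k)
  have c : ∀ (i j : Fin 3) (_ : i ≠ j) (a b : Matrix.orthogonalGroup (Fin 2) ℝ) (ha hb),
      (⟨factor i a, ha⟩ : H) * ⟨factor j b, hb⟩ = ⟨factor j b, hb⟩ * ⟨factor i a, ha⟩ :=
    fun i j h a b _ _ => Subtype.ext (factor_commute h a b)
  have n : ∀ (i : Fin 3), (⟨factor i refl₂, factor_mem i refl₂_mem⟩ : H) *
      ⟨factor i refl₁, factor_mem i refl₁_mem⟩ ≠ ⟨factor i refl₁, factor_mem i refl₁_mem⟩ *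
      ⟨factor i refl₂, factor_mem i refl₂_mem⟩ :=
    fun i e => factor_not_commute i (congrArg Subtype.val e).symm
  have h01 := polar_gen_eq_one (k := 0) (l := 1) (n 0)
  have h23 := polar_gen_eq_one (k := 2) (l := 3) (n 1)
  have h45 := polar_gen_eq_one (k := 4) (l := 5) (n 2)
  have h02 := polar_gen_eq_zero (k := 0) (l := 2) (c 0 1 (by decide) _ _ _ _)
  have h03 := polar_gen_eq_zero (k := 0) (l := 3) (c 0 1 (by decide) _ _ _ _)
  have h12 := polar_gen_eq_zero (k := 1) (l := 2) (c 0 1 (by decide) _ _ _ _)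
  have h13 := polar_gen_eq_zero (k := 1) (l := 3) (c 0 1 (by decide) _ _ _ _)
  have h04 := polar_gen_eq_zero (k := 0) (l := 4) (c 0 2 (by decide) _ _ _ _)
  have h05 := polar_gen_eq_zero (k := 0) (l := 5) (c 0 2 (by decide) _ _ _ _)
  have h14 := polar_gen_eq_zero (k := 1) (l := 4) (c 0 2 (by decide) _ _ _ _)
  have h15 := polar_gen_eq_zero (k := 1) (l := 5) (c 0 2 (by decide) _ _ _ _)
  have h24 := polar_gen_eq_zero (k := 2) (l := 4) (c 1 2 (by decide) _ _ _ _)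
  have h25 := polar_gen_eq_zero (k := 2) (l := 5) (c 1 2 (by decide) _ _ _ _)
  have h34 := polar_gen_eq_zero (k := 3) (l := 4) (c 1 2 (by decide) _ _ _ _)
  have h35 := polar_gen_eq_zero (k := 3) (l := 5) (c 1 2 (by decide) _ _ _ _)
  have add : ∀ a b : A, Q (a + b) = Q a + Q b + Q.polarBilin a b := fun a b =>
    QuadraticMap.map_add Q a b
  rw [coordMap, Fintype.linearCombination_apply, Fin.sum_univ_six]
  simp only [add, map_add, map_smul, LinearMap.add_apply, LinearMap.smul_apply,
    QuadraticMap.map_smul, hq, h01, h23, h45, h02, h03, h12, h13, h04, h05, h14, h15, h24, h25,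
    h34, h35, smul_eq_mul, mul_one, klein]
  ring

theorem polar_coordMap (x y : Biv) :
    Q.polarBilin (coordMap x) (coordMap y) = kleinPolar x y := by
  have h : Q (coordMap x + coordMap y) = Q (coordMap x) + Q (coordMap y) +
    Q.polarBilin (coordMap x) (coordMap y) := QuadraticMap.map_add Q _ _
  rw [← map_add, Q_coordMap, Q_coordMap, Q_coordMap, klein_add] at h
  exact (add_left_cancel h).symm

theorem coordMap_injective : Function.Injective coordMap := by
  rw [injective_iff_map_eq_zero]
  intro x hx
  by_contra h
  obtain ⟨y, hy⟩ := exists_kleinPolar_eq_one x h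
  rw [← polar_coordMap, hx, map_zero] at hy
  exact zero_ne_one hy

theorem coordMap_single (k : Fin 6) : coordMap (Pi.single k 1) = toA (gen k) := by
  rw [coordMap, Fintype.linearCombination_apply_single, one_smul]

theorem toA_factor_mem_range (i : Fin 3) (a : Matrix.orthogonalGroup (Fin 2) ℝ) (ha : a ∈ WI24) :
    toA ⟨factor i a, factor_mem i ha⟩ ∈ LinearMap.range coordMap := by
  have h0 : toA 1 = 0 := rfl
  induction ha using Subgroup.closure_induction with
  | mem x hx =>
    rcases hx with rfl | rfl
    · fin_cases i
      exacts [⟨_, coordMap_single 1⟩, ⟨_, coordMap_single 3⟩, ⟨_, coordMap_single 5⟩]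
    · fin_cases i
      exacts [⟨_, coordMap_single 0⟩, ⟨_, coordMap_single 2⟩, ⟨_, coordMap_single 4⟩]
  | one =>
    have : (⟨factor i 1, factor_mem i (one_mem _)⟩ : H) = 1 := Subtype.ext (map_one _)
    rw [this, h0]
    exact zero_mem _
  | mul x y hx hy h h' =>
    have e : (⟨factor i (x * y), factor_mem i (mul_mem hx hy)⟩ : H) =
      ⟨factor i x, factor_mem i hx⟩ * ⟨factor i y, factor_mem i hy⟩ := Subtype.ext (map_mul _ _ _)
    rw [e, toA_mul]
    exact add_mem h h'
  | inv x hx h =>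
    have e : (⟨factor i x, factor_mem i hx⟩ : H) * ⟨factor i x⁻¹, factor_mem i (inv_mem hx)⟩ = 1 :=
      Subtype.ext (by
        change factor i x * factor i x⁻¹ = 1
        rw [← map_mul, mul_inv_cancel, map_one])
    have e2 := congrArg toA e
    rw [toA_mul, h0, add_comm, add_eq_zero_iff_eq_neg] at e2
    rw [e2]
    exact neg_mem h

theorem coordMap_surjective : Function.Surjective coordMap := by
  intro x
  obtain ⟨⟨h, hh⟩, rfl⟩ := toA_surjective x
  obtain ⟨a, ha, b, hb, c, hc, rfl⟩ := mem_H.1 hh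
  have e : (⟨tensorHom (a, b, c), hh⟩ : H) = ⟨factor 0 a, factor_mem 0 ha⟩ *
      ⟨factor 1 b, factor_mem 1 hb⟩ * ⟨factor 2 c, factor_mem 2 hc⟩ := by
    refine Subtype.ext ?_
    change _ = factor 0 a * factor 1 b * factor 2 c
    simp only [factor_zero, factor_one, factor_two, ← map_mul, Prod.mk_mul_mk, one_mul, mul_one]
  rw [e, toA_mul, toA_mul]
  exact add_mem (add_mem (toA_factor_mem_range 0 a ha) (toA_factor_mem_range 1 b hb))
    (toA_factor_mem_range 2 c hc)

/-- The isometry between bivectors with the Klein form and `H / {±1}`. -/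
noncomputable def coord : Biv ≃ₗ[ZMod 2] A :=
  LinearEquiv.ofBijective coordMap ⟨coordMap_injective, coordMap_surjective⟩

theorem Q_coord (x : Biv) : Q (coord x) = klein x := Q_coordMap x

theorem polar_coord (x y : Biv) : Q.polarBilin (coord x) (coord y) = kleinPolar x y :=
  polar_coordMap x y

theorem finrank_A : finrank (ZMod 2) A = 6 := by
  rw [← coord.finrank_eq, Module.finrank_fin_fun]

theorem natCard_A : Nat.card A = 64 := by
  rw [← Nat.card_congr coord.toEquiv]
  simp

/-! ### Generation of the group `O⁺(Q)` by Siegel transformations -/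

/-- The automorphism of `H / {±1}` that is an involution `f` in coordinates. -/
noncomputable def coordConj (f : Biv →ₗ[ZMod 2] Biv) (hf : Function.Involutive f) :
    A ≃ₗ[ZMod 2] A :=
  coord.symm.trans ((LinearEquiv.ofInvolutive f hf).trans coord)

theorem coordConj_coord (f : Biv →ₗ[ZMod 2] Biv) (hf : Function.Involutive f) (x : Biv) :
    coordConj f hf (coord x) = coord (f x) := by
  simp [coordConj]

/-! ### Orthogonal transvections and Siegel transformations in coordinates. -/

theorem kleinPolar_smul_left (c : ZMod 2) (v w : Biv) :
    kleinPolar (c • v) w = c * kleinPolar v w := by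
  simp [kleinPolar]; ring

theorem kleinPolar_add_right (u v w : Biv) :
    kleinPolar u (v + w) = kleinPolar u v + kleinPolar u w := by
  simp [kleinPolar]; ring

theorem kleinPolar_smul_right (c : ZMod 2) (v w : Biv) :
    kleinPolar v (c • w) = c * kleinPolar v w := by
  simp [kleinPolar]; ring

theorem kleinPolar_self (v : Biv) : kleinPolar v v = 0 := by
  simp [kleinPolar]; grind

theorem klein_smul (c : ZMod 2) (v : Biv) : klein (c • v) = c * klein v := by
  rcases zmod_cases c with rfl | rfl <;> simp [klein]

/-- The orthogonal transvection in the direction of `v`. -/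
def reflectMap (v : Biv) : Biv →ₗ[ZMod 2] Biv where
  toFun x := x + kleinPolar x v • v
  map_add' x y := by rw [kleinPolar_add_left]; module
  map_smul' c x := by rw [kleinPolar_smul_left, RingHom.id_apply]; module

theorem reflectMap_apply (v x : Biv) : reflectMap v x = x + kleinPolar x v • v := rfl

theorem reflectMap_involutive (v : Biv) : Function.Involutive (reflectMap v) := fun x => by
  simp only [reflectMap_apply, kleinPolar_add_left, kleinPolar_smul_left, kleinPolar_self,
    mul_zero, add_zero]
  rw [add_assoc, two_smul_zero, add_zero]

/-- The orthogonal transvection in the direction of `v`, acting on `H / {±1}`. -/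
noncomputable def reflect (v : Biv) : A ≃ₗ[ZMod 2] A :=
  coordConj (reflectMap v) (reflectMap_involutive v)

theorem reflect_coord (v x : Biv) : reflect v (coord x) = coord (x + kleinPolar x v • v) :=
  coordConj_coord _ _ _

/-- The Siegel transformation of a pair of orthogonal vectors. -/
def siegelMap (s a : Biv) : Biv →ₗ[ZMod 2] Biv where
  toFun x := x + (kleinPolar x s • a + kleinPolar x a • s)
  map_add' x y := by simp only [kleinPolar_add_left]; module
  map_smul' c x := by simp only [kleinPolar_smul_left, RingHom.id_apply]; module

theorem siegelMap_apply (s a x : Biv) :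
    siegelMap s a x = x + (kleinPolar x s • a + kleinPolar x a • s) := rfl

theorem siegelMap_involutive {s a : Biv} (h : kleinPolar s a = 0) :
    Function.Involutive (siegelMap s a) := fun x => by
  have h' : kleinPolar a s = 0 := by rw [kleinPolar_comm, h]
  simp only [siegelMap_apply, kleinPolar_add_left, kleinPolar_smul_left, kleinPolar_self, h, h',
    mul_zero, add_zero]
  rw [add_assoc, two_smul_zero, add_zero]

/-- The automorphisms of `H / {±1}` which are Siegel transformations of totally singular planes. -/
def IsSiegel (g : A ≃ₗ[ZMod 2] A) : Prop :=
  ∃ s a : Biv, IsSingularPlane s a ∧ ∀ x, g (coord x) = coord (siegelMap s a x)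

/-- The Siegel transformation of a totally singular plane, acting on `H / {±1}`. -/
noncomputable def siegel (s a : Biv) (h : IsSingularPlane s a) : A ≃ₗ[ZMod 2] A :=
  coordConj (siegelMap s a) (siegelMap_involutive h.polar)

theorem siegel_coord {s a : Biv} (h : IsSingularPlane s a) (x : Biv) :
    siegel s a h (coord x) = coord (siegelMap s a x) := coordConj_coord _ _ _

theorem isSiegel_siegel {s a : Biv} (h : IsSingularPlane s a) : IsSiegel (siegel s a h) :=
  ⟨s, a, h, siegel_coord h⟩

theorem equiv_ext_coord {g h : A ≃ₗ[ZMod 2] A} (e : ∀ x, g (coord x) = h (coord x)) : g = h :=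
  LinearEquiv.ext fun x => by
    obtain ⟨x, rfl⟩ := coord.surjective x
    exact e x

theorem mem_isometryGroup_coord {g : A ≃ₗ[ZMod 2] A} (h : ∀ x, Q (g (coord x)) = klein x) :
    g ∈ IsometryGroup Q := fun x => by
  obtain ⟨x, rfl⟩ := coord.surjective x
  rw [h, Q_coord]

theorem reflect_mem {v : Biv} (hv : klein v = 1) : reflect v ∈ IsometryGroup Q := by
  refine mem_isometryGroup_coord fun x => ?_
  rw [reflect_coord, Q_coord, klein_add, klein_smul, hv, kleinPolar_smul_right]
  rcases zmod_cases (kleinPolar x v) with h | h <;> rw [h]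
  · ring
  · rw [mul_one, add_assoc, CharTwo.add_self_eq_zero, add_zero]

theorem dicksonInvariant_reflect {v : Biv} (hv : klein v = 1) : dicksonInvariant (reflect v) = 1 := by
  have hv0 : v ≠ 0 := by rintro rfl; rw [klein_zero] at hv; exact zero_ne_one hv
  have e : LinearMap.range ((reflect v : A →ₗ[ZMod 2] A) - LinearMap.id) =
      Submodule.span (ZMod 2) {coord v} := by
    have app : ∀ x, ((reflect v : A →ₗ[ZMod 2] A) - LinearMap.id : A →ₗ[ZMod 2] A)
        (coord x) =
        kleinPolar x v • coord v := fun x => by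
      change reflect v (coord x) - coord x = _
      rw [reflect_coord, map_add, map_smul, add_sub_cancel_left]
    apply le_antisymm
    · rintro _ ⟨x, rfl⟩
      obtain ⟨x, rfl⟩ := coord.surjective x
      rw [app]
      exact Submodule.smul_mem _ _ (Submodule.mem_span_singleton_self _)
    · rw [Submodule.span_singleton_le_iff_mem]
      obtain ⟨y, hy⟩ := exists_kleinPolar_eq_one v hv0
      refine ⟨coord y, ?_⟩
      rw [app, hy, one_smul]
  rw [dicksonInvariant, e, finrank_span_singleton (by simpa using hv0), Nat.cast_one]

theorem siegel_mem_isometryGroup {g : A ≃ₗ[ZMod 2] A} (hg : IsSiegel g) :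
    g ∈ IsometryGroup Q := by
  obtain ⟨s, a, h, hg⟩ := hg
  refine mem_isometryGroup_coord fun x => ?_
  have h' : kleinPolar a s = 0 := by rw [kleinPolar_comm, h.polar]
  rw [hg, siegelMap_apply, Q_coord]
  simp only [klein_add, klein_smul, kleinPolar_add_right, h.klein_left, h.klein_right,
    kleinPolar_smul_right, kleinPolar_smul_left, h']
  rw [mul_comm (kleinPolar x a) (kleinPolar x s), CharTwo.add_self_eq_zero]
  ring

/-- The image of `g - 1` is the singular plane itself, of dimension two. -/
theorem dicksonInvariant_siegel {g : A ≃ₗ[ZMod 2] A} (hg : IsSiegel g) :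
    dicksonInvariant g = 0 := by
  obtain ⟨s, a, h, hg⟩ := hg
  have e : LinearMap.range ((g : A →ₗ[ZMod 2] A) - LinearMap.id) =
      Submodule.span (ZMod 2) (Set.range ![coord s, coord a]) := by
    have app : ∀ x, ((g : A →ₗ[ZMod 2] A) - LinearMap.id : A →ₗ[ZMod 2] A) (coord x) =
        kleinPolar x s • coord a + kleinPolar x a • coord s := fun x => by
      change g (coord x) - coord x = _
      rw [hg, siegelMap_apply, map_add, map_add, map_smul, map_smul, add_sub_cancel_left]
    apply le_antisymm
    · rintro _ ⟨x, rfl⟩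
      obtain ⟨x, rfl⟩ := coord.surjective x
      rw [app]
      exact add_mem (Submodule.smul_mem _ _ (Submodule.subset_span ⟨1, rfl⟩))
        (Submodule.smul_mem _ _ (Submodule.subset_span ⟨0, rfl⟩))
    · rw [Submodule.span_le]
      rintro _ ⟨i, rfl⟩
      fin_cases i
      · obtain ⟨y, hy, hy'⟩ := exists_kleinPolar_zero_one a s h.right_ne h.ne.symm
        refine ⟨coord y, ?_⟩
        rw [app, hy, hy']
        simp
      · obtain ⟨y, hy, hy'⟩ := exists_kleinPolar_zero_one s a h.left_ne h.ne
        refine ⟨coord y, ?_⟩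
        rw [app, hy, hy']
        simp
  have li : LinearIndependent (ZMod 2) ![coord s, coord a] := by
    rw [LinearIndependent.pair_iff]
    intro c d hcd
    exact independent_pair (by simpa using h.left_ne) (by simpa using h.right_ne)
      (by simpa using h.ne) hcd
  rw [dicksonInvariant, e, finrank_span_eq_card li]
  decide

theorem siegel_mem {g : A ≃ₗ[ZMod 2] A} (hg : IsSiegel g) :
    g ∈ SpecialIsometryGroup Q Q_nondegenerate :=
  ⟨siegel_mem_isometryGroup hg, dicksonInvariant_siegel hg⟩

/-- The group generated by the orthogonal transvections. -/
noncomputable def reflectGroup : Subgroup (A ≃ₗ[ZMod 2] A) :=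
  Subgroup.closure {g | ∃ v, klein v = 1 ∧ g = reflect v}

theorem reflect_mem_reflectGroup {v : Biv} (hv : klein v = 1) : reflect v ∈ reflectGroup :=
  Subgroup.subset_closure ⟨v, hv, rfl⟩

theorem klein_add_of_polar {v w : Biv} (hv : klein v = 1) (hw : klein w = 1)
    (h : kleinPolar v w = 1) : klein (v + w) = 1 := by
  rw [klein_add, hv, hw, h]; decide

/-- For nonsingular `v` and `w` with polar value 1 the sum is nonsingular as well, and reflecting in
it moves `v` to `w`. Vectors pairing equally with both are fixed, which protects the basis vectors
already dealt with. -/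
theorem reflect_add_coord {v w : Biv} (h : kleinPolar v w = 1) :
    reflect (v + w) (coord v) = coord w := by
  rw [reflect_coord, kleinPolar_add_right, kleinPolar_self, h, zero_add, one_smul, ← add_assoc,
    two_smul_zero, zero_add]

theorem reflect_add_coord_of_eq {v w x : Biv} (h : kleinPolar v x = kleinPolar w x) :
    reflect (v + w) (coord x) = coord x := by
  rw [reflect_coord, kleinPolar_comm, kleinPolar_add_left, h, CharTwo.add_self_eq_zero, zero_smul,
    add_zero]

theorem polar_isometry {g : A ≃ₗ[ZMod 2] A} (hg : g ∈ IsometryGroup Q) (x y : A) :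
    Q.polarBilin (g x) (g y) = Q.polarBilin x y := by
  change Q (g x + g y) - Q (g x) - Q (g y) = Q (x + y) - Q x - Q y
  rw [← map_add, hg, hg, hg]

/-- Witt's argument: correct `g` by reflections fixing the first `k` basis vectors until it fixes
one more. The induction variable `m` counts the vectors still to be fixed. -/
theorem mem_reflectGroup_of_fixed (m k : ℕ) (hmk : m + k = 6) {g : A ≃ₗ[ZMod 2] A}
    (hg : g ∈ IsometryGroup Q)
    (hfix : ∀ j : Fin 6, j.val < k → g (coord (witt j)) = coord (witt j)) : g ∈ reflectGroup := by
  induction m generalizing k g with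
  | zero =>
    have e : (g : A →ₗ[ZMod 2] A) ∘ₗ (coord : Biv →ₗ[ZMod 2] A) = (coord : Biv →ₗ[ZMod 2] A) :=
      linearMap_eq_of_witt fun j => hfix j (by omega)
    have : g = 1 := equiv_ext_coord fun x => LinearMap.congr_fun e x
    rw [this]
    exact one_mem _
  | succ m ih =>
    let i : Fin 6 := ⟨k, by omega⟩
    obtain ⟨v, hv⟩ := coord.surjective (g (coord (witt i)))
    have hv1 : klein v = 1 := by rw [← Q_coord, hv, hg, Q_coord, klein_witt]
    have hpol : ∀ j < i, kleinPolar v (witt j) = kleinPolar (witt i) (witt j) := fun j hj => by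
      rw [← polar_coord, hv, ← hfix j hj, polar_isometry hg, polar_coord]
    have hne : ∀ j < i, v ≠ witt j := by
      rintro j hj rfl
      rw [← hfix j hj] at hv
      have h1 := coord.injective (g.injective hv)
      have h2 : ∀ i j, witt i = witt j → i = j := by decide +kernel
      exact hj.ne (h2 _ _ h1)
    suffices ∃ h ∈ reflectGroup, h ∈ IsometryGroup Q ∧ h (coord v) = coord (witt i) ∧
        ∀ j < i, h (coord (witt j)) = coord (witt j) by
      obtain ⟨h, hh, hh', h1, h2⟩ := this
      have := ih (k + 1) (by omega) (mul_mem hh' hg) fun j hj => by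
        change h (g (coord (witt j))) = _
        rcases Nat.lt_succ_iff_lt_or_eq.1 hj with hj | hj
        · rw [hfix j hj, h2 j hj]
        · have : j = i := Fin.ext hj
          rw [this, ← hv, h1]
      simpa using mul_mem (inv_mem hh) this
    rcases witt_step i v hv1 fun j hj => ⟨hpol j hj, hne j hj⟩ with e | e | ⟨u, hu, hu', e1, e2⟩
    · exact ⟨1, one_mem _, one_mem _, by rw [e]; rfl, fun _ _ => rfl⟩
    · have hq := klein_add_of_polar hv1 (klein_witt i) e
      exact ⟨reflect (v + witt i), reflect_mem_reflectGroup hq, reflect_mem hq,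
        reflect_add_coord e, fun j hj => reflect_add_coord_of_eq (hpol j hj)⟩
    · have hq1 := klein_add_of_polar hv1 hu e1
      have hq2 := klein_add_of_polar hu (klein_witt i) e2
      refine ⟨reflect (u + witt i) * reflect (v + u),
        mul_mem (reflect_mem_reflectGroup hq2) (reflect_mem_reflectGroup hq1),
        mul_mem (reflect_mem hq2) (reflect_mem hq1), ?_, fun j hj => ?_⟩
      · change reflect (u + witt i) (reflect (v + u) (coord v)) = _
        rw [reflect_add_coord e1, reflect_add_coord e2]
      · change reflect (u + witt i) (reflect (v + u) (coord (witt j))) = _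
        rw [reflect_add_coord_of_eq ((hpol j hj).trans (hu' j hj).symm),
          reflect_add_coord_of_eq (hu' j hj)]

theorem isometryGroup_le_reflectGroup : IsometryGroup Q ≤ reflectGroup := fun _ hg =>
  mem_reflectGroup_of_fixed 6 0 rfl hg fun _ h => absurd h (Nat.not_lt_zero _)

theorem reflect_mul_self (v : Biv) : reflect v * reflect v = 1 := equiv_ext_coord fun x => by
  change reflect v (reflect v (coord x)) = coord x
  rw [reflect_coord, reflect_coord]
  exact congrArg coord (reflectMap_involutive v x)

/-! ### Products of two orthogonal transvections, and generation of `O⁺(Q)`. -/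

section Generation

variable {Γ : Subgroup (A ≃ₗ[ZMod 2] A)}

/-- Put `s = v + w`, a singular vector orthogonal to `v`. The product of reflections is the Eichler
transformation of the pair `(s, v)`. Since `v` is nonsingular, it is written as `a + (v + a)` with
both summands singular and orthogonal to `s`, which splits the product into two Siegel
transformations. -/
theorem reflect_mul_reflect_mem_of_orthogonal (hΓ : ∀ g, IsSiegel g → g ∈ Γ) {v w : Biv}
    (hv : klein v = 1) (hw : klein w = 1) (h : kleinPolar v w = 0) (hvw : v ≠ w) :
    reflect v * reflect w ∈ Γ := by
  have hv0 : v ≠ 0 := by rintro rfl; rw [klein_zero] at hv; exact zero_ne_one hv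
  have hs : klein (v + w) = 0 := by rw [klein_add, hv, hw, h]; decide
  have hsv : kleinPolar (v + w) v = 0 := by
    rw [kleinPolar_add_left, kleinPolar_self, kleinPolar_comm w, h, add_zero]
  have hs0 : v + w ≠ 0 := add_ne_zero_of_ne hvw
  obtain ⟨a, ha, has, hva⟩ := exists_singular_zero_one (v + w) hs hs0 v ⟨hsv, by
    rintro e; rw [e, hv] at hs; exact one_ne_zero hs, hv0⟩
  have hvs : kleinPolar v (v + w) = 0 := by rw [kleinPolar_comm, hsv]
  have p1 : IsSingularPlane (v + w) a := isSingularPlane_of_polar hs ha has hs0 hvs hva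
  have hva' : klein (v + a) = 0 := by rw [klein_add, hv, ha, hva]; decide
  have p2 : IsSingularPlane (v + w) (v + a) := isSingularPlane_of_polar (x := v) hs hva'
    (by rw [kleinPolar_add_right, hsv, has, add_zero]) hs0 hvs
    (by rw [kleinPolar_add_right, kleinPolar_self, hva, zero_add])
  have e : reflect v * reflect w = siegel _ _ p1 * siegel _ _ p2 := equiv_ext_coord fun x => by
    change reflect v (reflect w (coord x)) = siegel _ _ p1 (siegel _ _ p2 (coord x))
    rw [reflect_coord, reflect_coord, siegel_coord, siegel_coord, siegelMap_apply, siegelMap_apply]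
    refine congrArg coord ?_
    have h' : kleinPolar w v = 0 := by rw [kleinPolar_comm, h]
    have has' : kleinPolar v a + kleinPolar w a = 0 := by rw [← kleinPolar_add_left, has]
    rw [hva] at has'
    have hwa : kleinPolar w a = 1 := by
      rcases zmod_cases (kleinPolar w a) with e | e
      · rw [e] at has'; exact absurd has' (by decide)
      · exact e
    have hav : kleinPolar a v = 1 := by rw [kleinPolar_comm, hva]
    have haw : kleinPolar a w = 1 := by rw [kleinPolar_comm, hwa]
    simp only [kleinPolar_add_left, kleinPolar_add_right, kleinPolar_smul_left, kleinPolar_self, h,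
      h', hva, hwa, hav, haw]
    -- With the mutual polar values substituted, what remains is a coordinatewise identity over 𝔽₂
    -- in finitely many free values.
    generalize kleinPolar x v = α
    generalize kleinPolar x w = β
    generalize kleinPolar x a = γ
    have two : (1 : ZMod 2) + 1 = 0 := by decide
    ext i
    simp only [Pi.add_apply, Pi.smul_apply, smul_eq_mul]
    generalize x i = x', v i = v', w i = w', a i = a'
    revert α β γ x' v' w' a'
    decide +kernel
  rw [e]
  exact mul_mem (hΓ _ (isSiegel_siegel p1)) (hΓ _ (isSiegel_siegel p2))

/-- If `v` and `w` are not orthogonal, a pair of equal reflections in a nonsingular vector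
orthogonal to both is inserted between them. -/
theorem reflect_mul_reflect_mem (hΓ : ∀ g, IsSiegel g → g ∈ Γ) {v w : Biv}
    (hv : klein v = 1) (hw : klein w = 1) : reflect v * reflect w ∈ Γ := by
  by_cases hvw : v = w
  · rw [hvw, reflect_mul_self]
    exact one_mem _
  rcases zmod_cases (kleinPolar v w) with h | h
  · exact reflect_mul_reflect_mem_of_orthogonal hΓ hv hw h hvw
  · obtain ⟨u, hu, h1, h2⟩ := exists_nonsingular_orthogonal' v hv w hw h
    have e : reflect v * reflect w = reflect v * reflect u * (reflect u * reflect w) := by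
      rw [mul_assoc, ← mul_assoc (reflect u), reflect_mul_self, one_mul]
    rw [e]
    refine mul_mem (reflect_mul_reflect_mem_of_orthogonal hΓ hv hu ?_ ?_)
      (reflect_mul_reflect_mem_of_orthogonal hΓ hu hw h2 ?_)
    · rw [kleinPolar_comm, h1]
    · rintro rfl
      rw [h2] at h
      exact zero_ne_one h
    · rintro rfl
      rw [kleinPolar_comm, h1] at h
      exact zero_ne_one h

/-- The group `O⁺(Q)` is generated by Siegel transformations. -/
theorem specialIsometryGroup_le (hΓ : ∀ g, IsSiegel g → g ∈ Γ) :
    SpecialIsometryGroup Q Q_nondegenerate ≤ Γ := by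
  have hΓ' : ∀ g, IsSiegel g → g ∈ Γ ⊓ SpecialIsometryGroup Q Q_nondegenerate := fun g hg =>
    ⟨hΓ g hg, siegel_mem hg⟩
  have h0 : klein (witt 0) = 1 := klein_witt 0
  -- Parity argument: even products of reflections lie in `Γ`, and odd ones do after multiplication
  -- by one fixed reflection. The odd case is later excluded because a reflection has Dickson
  -- invariant 1.
  have key : ∀ g ∈ reflectGroup, g ∈ Γ ⊓ SpecialIsometryGroup Q Q_nondegenerate ∨
      reflect (witt 0) * g ∈ Γ ⊓ SpecialIsometryGroup Q Q_nondegenerate := by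
    intro g hg
    induction hg using Subgroup.closure_induction_left with
    | one => exact Or.inl (one_mem _)
    | mul_left x hx y _ hy =>
      obtain ⟨v, hv, rfl⟩ := hx
      rcases hy with hy | hy
      · right
        rw [← mul_assoc]
        exact mul_mem (reflect_mul_reflect_mem hΓ' h0 hv) hy
      · left
        have e : reflect v * y = reflect v * reflect (witt 0) * (reflect (witt 0) * y) := by
          rw [mul_assoc, ← mul_assoc (reflect (witt 0)), reflect_mul_self, one_mul]
        rw [e]
        exact mul_mem (reflect_mul_reflect_mem hΓ' hv h0) hy
    | inv_mul_cancel x hx y _ hy =>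
      obtain ⟨v, hv, rfl⟩ := hx
      have inv : (reflect v)⁻¹ = reflect v := inv_eq_of_mul_eq_one_left (reflect_mul_self v)
      rw [inv]
      rcases hy with hy | hy
      · right
        rw [← mul_assoc]
        exact mul_mem (reflect_mul_reflect_mem hΓ' h0 hv) hy
      · left
        have e : reflect v * y = reflect v * reflect (witt 0) * (reflect (witt 0) * y) := by
          rw [mul_assoc, ← mul_assoc (reflect (witt 0)), reflect_mul_self, one_mul]
        rw [e]
        exact mul_mem (reflect_mul_reflect_mem hΓ' hv h0) hy
  intro g hg
  rcases key g (isometryGroup_le_reflectGroup hg.1) with h | h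
  · exact h.1
  · exfalso
    have h1 : reflect (witt 0) ∈ SpecialIsometryGroup Q Q_nondegenerate := by
      have := Subgroup.mul_mem _ h.2 (Subgroup.inv_mem _ hg)
      rwa [mul_inv_cancel_right] at this
    have h2 := dicksonInvariant_reflect h0
    rw [h1.2] at h2
    exact zero_ne_one h2

end Generation

/-! ### Irreducibility of `H`, and the kernel of the action of `N` -/

/-- The square matrices of size eight, indexed by triples. -/
abbrev Mat8 : Type := Matrix (Fin 2 × Fin 2 × Fin 2) (Fin 2 × Fin 2 × Fin 2) ℝ

theorem span_WI24 :
    Submodule.span ℝ (Subtype.val '' (WI24 : Set (Matrix.orthogonalGroup (Fin 2) ℝ))) = ⊤ := by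
  rw [eq_top_iff]
  intro m _
  have h1 : (1 : Matrix (Fin 2) (Fin 2) ℝ) ∈ Submodule.span ℝ
      (Subtype.val '' (WI24 : Set (Matrix.orthogonalGroup (Fin 2) ℝ))) :=
    Submodule.subset_span ⟨1, one_mem _, rfl⟩
  have h2 := Submodule.subset_span (R := ℝ) (Set.mem_image_of_mem Subtype.val
    (show refl₁ ∈ (WI24 : Set (Matrix.orthogonalGroup (Fin 2) ℝ)) from refl₁_mem))
  have h3 := Submodule.subset_span (R := ℝ) (Set.mem_image_of_mem Subtype.val
    (show refl₂ ∈ (WI24 : Set (Matrix.orthogonalGroup (Fin 2) ℝ)) from refl₂_mem))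
  have h4 := Submodule.subset_span (R := ℝ) (Set.mem_image_of_mem Subtype.val
    (show refl₁ * refl₂ ∈ (WI24 : Set (Matrix.orthogonalGroup (Fin 2) ℝ)) from
      mul_mem refl₁_mem refl₂_mem))
  -- The matrices 1, `refl₁`, `refl₂` and `refl₁ * refl₂` form a basis of the 2 × 2 matrices.
  have e : m = ((m 0 0 + m 1 1) / 2) • (1 : Matrix (Fin 2) (Fin 2) ℝ) +
      ((m 0 0 - m 1 1) / 2) • refl₁.1 + ((m 0 1 + m 1 0) / 2) • refl₂.1 +
      ((m 0 1 - m 1 0) / 2) • (refl₁.1 * refl₂.1) := by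
    ext i j
    fin_cases i <;> fin_cases j <;> simp [refl₁, refl₂] <;> ring
  rw [e]
  exact add_mem (add_mem (add_mem (Submodule.smul_mem _ _ h1) (Submodule.smul_mem _ _ h2))
    (Submodule.smul_mem _ _ h3)) (Submodule.smul_mem _ _ h4)

/-- The span of the matrices in `H`. -/
def matSpan : Submodule ℝ Mat8 := Submodule.span ℝ (Set.range mat)

theorem kronecker_mem_matSpan (a b c : Matrix (Fin 2) (Fin 2) ℝ) :
    a ⊗ₖ (b ⊗ₖ c) ∈ matSpan := by
  have ha : a ∈ Submodule.span ℝ _ := (eq_top_iff.1 span_WI24) Submodule.mem_top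
  have hb : b ∈ Submodule.span ℝ _ := (eq_top_iff.1 span_WI24) Submodule.mem_top
  have hc : c ∈ Submodule.span ℝ _ := (eq_top_iff.1 span_WI24) Submodule.mem_top
  induction ha using Submodule.span_induction with
  | zero => rw [zero_kronecker]; exact zero_mem _
  | add x y _ _ hx hy => rw [add_kronecker]; exact add_mem hx hy
  | smul r x _ hx => rw [smul_kronecker]; exact Submodule.smul_mem _ _ hx
  | mem a ha =>
    obtain ⟨a, ha, rfl⟩ := ha
    induction hb using Submodule.span_induction with
    | zero => rw [zero_kronecker, kronecker_zero]; exact zero_mem _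
    | add x y _ _ hx hy => rw [add_kronecker, kronecker_add]; exact add_mem hx hy
    | smul r x _ hx => rw [smul_kronecker, kronecker_smul]; exact Submodule.smul_mem _ _ hx
    | mem b hb =>
      obtain ⟨b, hb, rfl⟩ := hb
      induction hc using Submodule.span_induction with
      | zero => rw [kronecker_zero, kronecker_zero]; exact zero_mem _
      | add x y _ _ hx hy => rw [kronecker_add, kronecker_add]; exact add_mem hx hy
      | smul r x _ hx => rw [kronecker_smul, kronecker_smul]; exact Submodule.smul_mem _ _ hx
      | mem c hc =>
        obtain ⟨c, hc, rfl⟩ := hc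
        exact Submodule.subset_span
          ⟨⟨tensorHom (a, b, c), mem_H.2 ⟨a, ha, b, hb, c, hc, rfl⟩⟩, rfl⟩

theorem mem_matSpan (M : Mat8) : M ∈ matSpan := by
  rw [matrix_eq_sum_single M]
  refine sum_mem fun i _ => sum_mem fun j _ => ?_
  have e : single i j (M i j) = M i j • (single i.1 j.1 (1 : ℝ) ⊗ₖ
      (single i.2.1 j.2.1 (1 : ℝ) ⊗ₖ single i.2.2 j.2.2 (1 : ℝ))) := by
    rw [single_kronecker_single, single_kronecker_single, smul_single]
    simp
  rw [e]
  exact Submodule.smul_mem _ _ (kronecker_mem_matSpan _ _ _)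

/-- Schur's lemma for `H`. -/
theorem exists_eq_smul_one {M : Mat8} (hM : ∀ h : H, mat h * M = M * mat h) :
    ∃ c : ℝ, M = c • 1 := by
  have : ∀ X : Mat8, X * M = M * X := by
    intro X
    have hX := mem_matSpan X
    rw [matSpan] at hX
    induction hX using Submodule.span_induction with
    | mem x hx =>
      obtain ⟨h, rfl⟩ := hx
      exact hM h
    | zero => rw [zero_mul, mul_zero]
    | add x y _ _ hx hy => rw [add_mul, mul_add, hx, hy]
    | smul c x _ hx => rw [smul_mul_assoc, mul_smul_comm, hx]
  obtain ⟨c, rfl⟩ := mem_range_scalar_of_commute_single fun i j _ => this (single i j 1)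
  exact ⟨c, (smul_one_eq_diagonal c).symm⟩

/-- `H` acts irreducibly. -/
theorem eq_top_of_H_invariant {U : Submodule ℝ (Fin 2 × Fin 2 × Fin 2 → ℝ)} (hU : U ≠ ⊥)
    (h : ∀ k : H, ∀ v ∈ U, mat k *ᵥ v ∈ U) : U = ⊤ := by
  have key : ∀ (X : Mat8), ∀ v ∈ U, X *ᵥ v ∈ U := by
    intro X v hv
    have hX := mem_matSpan X
    rw [matSpan] at hX
    induction hX using Submodule.span_induction with
    | mem x hx =>
      obtain ⟨k, rfl⟩ := hx
      exact h k v hv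
    | zero => rw [zero_mulVec]; exact zero_mem _
    | add x y _ _ hx hy => rw [add_mulVec]; exact add_mem hx hy
    | smul c x _ hx => rw [smul_mulVec]; exact Submodule.smul_mem _ _ hx
  obtain ⟨v, hv, hv0⟩ := Submodule.exists_mem_ne_zero_of_ne_bot hU
  obtain ⟨i, hi⟩ := Function.ne_iff.1 hv0
  rw [eq_top_iff]
  intro u _
  -- A rank-one matrix carrying `v` to the arbitrary vector `u`.
  have := key (vecMulVec u (Pi.single i (v i)⁻¹)) v hv
  rwa [vecMulVec_mulVec, single_dotProduct, inv_mul_cancel₀ hi, MulOpposite.op_one, one_smul]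
    at this

/-! ### Classes modulo signs, and the kernel of the conjugation action. -/

theorem toA_eq_iff {h k : H} : toA h = toA k ↔ h⁻¹ * k ∈ signSubgroup := QuotientGroup.eq

theorem toA_eq_iff_mat {h k : H} : toA h = toA k ↔ mat k = mat h ∨ mat k = -mat h := by
  rw [toA_eq_iff, mem_signSubgroup]
  have e : mat k = mat h * mat (h⁻¹ * k) := by rw [← mat_mul, mul_inv_cancel_left]
  have e' : mat h⁻¹ * mat h = 1 := by rw [← mat_mul, inv_mul_cancel, mat_one]
  constructor
  · rintro (e1 | e1) <;> rw [e, e1] <;> simp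
  · rintro (e1 | e1)
    · left; rw [mat_mul, e1, e']
    · right; rw [mat_mul, e1, mul_neg, e']

theorem toA_eq_zero_iff {h : H} : toA h = 0 ↔ mat h = 1 ∨ mat h = -1 := by
  have : toA 1 = 0 := rfl
  rw [← this, eq_comm, toA_eq_iff_mat, mat_one]

theorem N_conj_mat (n : N) (h : H) :
    mat (Subgroup.normalizerMonoidHom H n h) * n.1.1 = n.1.1 * mat h := by
  rw [mat_normalizer, mul_assoc]
  have : (n.1⁻¹).1 * n.1.1 = 1 := congrArg Subtype.val (inv_mul_cancel n.1)
  rw [this, mul_one]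

/-- A matrix commuting with the generators of `H` commutes with `H`. -/
theorem commute_of_commute_gen {M : Mat8} (hM : ∀ i, mat (gen i) * M = M * mat (gen i)) (h : H) :
    mat h * M = M * mat h := by
  have sign : ∀ {h k : H}, toA h = toA k → mat h * M = M * mat h → mat k * M = M * mat k := by
    intro h k e hh
    rcases toA_eq_iff_mat.1 e with e | e
    · rw [e, hh]
    · rw [e, neg_mul, mul_neg, hh]
  let D : Submodule (ZMod 2) A :=
    { carrier := {x | ∀ h, toA h = x → mat h * M = M * mat h}
      zero_mem' := fun h hh => sign (h := 1) hh.symm (by rw [mat_one, one_mul, mul_one])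
      add_mem' := by
        rintro x y hx hy k hk
        obtain ⟨h, rfl⟩ := toA_surjective x
        obtain ⟨h', rfl⟩ := toA_surjective y
        refine sign (h := h * h') hk.symm ?_
        rw [mat_mul, mul_assoc, hy h' rfl, ← mul_assoc, hx h rfl, mul_assoc]
      smul_mem' := fun c x hx => by
        rcases zmod_cases c with rfl | rfl
        · rw [zero_smul]
          exact fun h hh => sign (h := 1) hh.symm (by rw [mat_one, one_mul, mul_one])
        · rwa [one_smul] }
  have hgen : ∀ i, toA (gen i) ∈ D := fun i h hh => sign hh.symm (hM i)
  have : toA h ∈ D := by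
    obtain ⟨x, hx⟩ := coord.surjective (toA h)
    rw [← hx]
    change coordMap x ∈ D
    rw [coordMap, Fintype.linearCombination_apply]
    exact sum_mem fun i _ => D.smul_mem _ (hgen i)
  exact this h rfl

theorem conj_H_trivial {n : N} (hn : n.1 ∈ H) : conjAction n = 1 := by
  refine LinearEquiv.ext fun x => ?_
  obtain ⟨h, rfl⟩ := toA_surjective x
  have e : Subgroup.normalizerMonoidHom H n h = (⟨n.1, hn⟩ : H) * h * (⟨n.1, hn⟩ : H)⁻¹ :=
    Subtype.ext rfl
  rw [conjAction_toA, e, toA_mul, toA_mul, add_right_comm, ← toA_mul, mul_inv_cancel]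
  exact zero_add _

theorem eq_one_or_neg_one_of_scalar {g : SO8} {c : ℝ} (h : g.1 = c • 1) : g.1 = 1 ∨ g.1 = -1 := by
  have h1 : g.1 * g.1ᵀ = 1 := (Matrix.mem_orthogonalGroup_iff _ _).1
    ((Matrix.mem_specialOrthogonalGroup_iff).1 g.2).1
  rw [h, transpose_smul, transpose_one, smul_mul_smul_comm, mul_one] at h1
  have h2 := congrFun (congrFun h1 (0, 0, 0)) (0, 0, 0)
  simp only [Matrix.smul_apply, one_apply_eq, smul_eq_mul, mul_one] at h2
  rcases mul_self_eq_one_iff.1 h2 with h3 | h3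
  · left; rw [h, h3, one_smul]
  · right; rw [h, h3, neg_smul, one_smul]

theorem exists_neg_one_mem : ∃ k : H, mat k = -1 := by
  obtain ⟨h, hh⟩ := toA_surjective (coord (Pi.single 0 1 + Pi.single 1 1))
  have h1 : sqType h = 1 := by
    rw [← Q_toA, hh, Q_coord]; decide +kernel
  refine ⟨h * h, ?_⟩
  rw [mat_mul, mat_sq_eq, h1, sgn_one]

/-- The kernel of the action of `N` on `H / {±1}` is `H`. -/
theorem mem_H_of_conj_eq_one {n : N} (hn : conjAction n = 1) : n.1 ∈ H := by
  have hs : ∀ h : H, ∃ c : ZMod 2, n.1.1 * mat h = sgn c * (mat h * n.1.1) := by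
    intro h
    have := conjAction_toA n h
    rw [hn] at this
    rcases toA_eq_iff_mat.1 this with e | e
    · refine ⟨0, ?_⟩
      rw [← N_conj_mat, e, sgn_zero, one_mul]
    · refine ⟨1, ?_⟩
      rw [← N_conj_mat, e, sgn_one]
      simp
  choose c hc using fun i => hs (gen i)
  -- The Klein form pairs coordinates 0 with 1, 2 with 3 and 4 with 5; hence the swapped entries.
  -- The resulting `k ∈ H` has the same commutation signs with the generators as `n`, so `k⁻¹ n`
  -- commutes with `H` and is scalar by Schur's lemma.
  obtain ⟨k, hk⟩ := toA_surjective (coord ![c 1, c 0, c 3, c 2, c 5, c 4])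
  have hkc : ∀ i, commType k (gen i) = c i := by
    intro i
    rw [← polar_eq_commType, hk, ← coordMap_single]
    change Q.polarBilin (coord _) (coord _) = _
    rw [polar_coord]
    fin_cases i <;> simp [kleinPolar]
  have hkk : mat k⁻¹ * mat k = 1 := by rw [← mat_mul, inv_mul_cancel, mat_one]
  have hk' : ∀ i, mat k⁻¹ * mat (gen i) = sgn (c i) * (mat (gen i) * mat k⁻¹) := by
    intro i
    have h1 := mat_comm k (gen i)
    rw [hkc] at h1
    have h2 := congrArg (fun X => mat k⁻¹ * X * mat k⁻¹) h1
    simp only [mul_assoc, mat_mul_inv, mul_one] at h2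
    rw [← mul_assoc, hkk, one_mul, ← mul_assoc, sgn_comm, mul_assoc] at h2
    rw [h2, ← mul_assoc, sgn_mul_self, one_mul]
  have hcomm := commute_of_commute_gen (M := mat k⁻¹ * n.1.1) fun i => by
    rw [mul_assoc, hc, ← mul_assoc (mat k⁻¹), sgn_comm, mul_assoc, ← mul_assoc (mat k⁻¹), hk',
      ← mul_assoc, ← mul_assoc, ← mul_assoc, sgn_mul_self, one_mul]
  obtain ⟨r, hr⟩ := exists_eq_smul_one hcomm
  obtain ⟨z, hz⟩ := exists_neg_one_mem
  have hn' : n.1.1 = mat k * (mat k⁻¹ * n.1.1) := by rw [← mul_assoc, mat_mul_inv, one_mul]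
  rcases eq_one_or_neg_one_of_scalar (g := k.1⁻¹ * n.1) hr with e | e
  · have e' : mat k⁻¹ * n.1.1 = 1 := e
    rw [e', mul_one] at hn'
    have : n.1 = k.1 := Subtype.ext hn'
    rw [this]
    exact k.2
  · have e' : mat k⁻¹ * n.1.1 = -1 := e
    rw [e', ← hz, ← mat_mul] at hn'
    have : n.1 = (k * z).1 := Subtype.ext hn'
    rw [this]
    exact (k * z).2

theorem ker_conjAction : conjAction.ker = H.subgroupOf N := by
  ext n
  rw [MonoidHom.mem_ker, Subgroup.mem_subgroupOf]
  exact ⟨mem_H_of_conj_eq_one, conj_H_trivial⟩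

/-- The kernel of the action is the finite group `H`, and the image lies in the automorphism group
of a finite space. -/
instance : Finite N := by
  have h1 : Finite (A ≃ₗ[ZMod 2] A) := DFunLike.finite _
  have h2 : Finite conjAction.ker := by
    rw [ker_conjAction]
    exact Finite.of_injective (fun x : H.subgroupOf N => (⟨x.1.1, x.2⟩ : H)) fun x y e =>
      Subtype.ext (Subtype.ext (congrArg (fun z : H => z.1) e))
  have h3 : Finite (N ⧸ conjAction.ker) :=
    Finite.of_injective _ (QuotientGroup.kerLift_injective conjAction)
  exact Finite.of_equiv _ (Subgroup.groupEquivQuotientProdSubgroup (s := conjAction.ker)).symm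

/-! ### Rotations in `N` act as Siegel transformations -/

theorem inv_val_mul (g : SO8) : (g⁻¹).1 * g.1 = 1 := congrArg Subtype.val (inv_mul_cancel g)

theorem mul_inv_val (g : SO8) : g.1 * (g⁻¹).1 = 1 := congrArg Subtype.val (mul_inv_cancel g)

theorem mulVec_injective (g : SO8) {u v : Fin 2 × Fin 2 × Fin 2 → ℝ} (h : g.1 *ᵥ u = g.1 *ᵥ v) :
    u = v := by
  have := congrArg ((g⁻¹).1 *ᵥ ·) h
  simpa [inv_val_mul] using this

/-- The fixed space of an element of `SO₈`. -/
noncomputable def fixedSpace (g : SO8) : Submodule ℝ (Fin 2 × Fin 2 × Fin 2 → ℝ) :=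
  LinearMap.ker (Matrix.toLin' g.1 - LinearMap.id)

theorem mem_fixedSpace {g : SO8} {v : Fin 2 × Fin 2 × Fin 2 → ℝ} :
    v ∈ fixedSpace g ↔ g.1 *ᵥ v = v := by
  rw [fixedSpace, LinearMap.mem_ker, LinearMap.sub_apply, LinearMap.id_apply, sub_eq_zero,
    toLin'_apply]

theorem finrank_fixedSpace {r : SO8} (hr : IsRotation r) : finrank ℝ (fixedSpace r) = 6 := by
  have h : finrank ℝ (fixedSpace r) + 2 = 8 := hr
  omega

/-- The fixed space of `r` and its image under `h` have dimension 6, and 6 + 6 > 8. -/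
theorem IsRotation.exists_common_fixed {r : SO8} (hr : IsRotation r) (h : SO8) :
    ∃ u v, v ≠ 0 ∧ r.1 *ᵥ u = u ∧ r.1 *ᵥ v = v ∧ v = h.1 *ᵥ u := by
  have inj : Function.Injective (Matrix.toLin' h.1) := fun u v e => mulVec_injective h e
  have h1 := finrank_fixedSpace hr
  have h2 : finrank ℝ ((fixedSpace r).map (Matrix.toLin' h.1)) = 6 := by
    rw [← h1]
    exact (Submodule.equivMapOfInjective _ inj _).finrank_eq.symm
  have h3 := Submodule.finrank_sup_add_finrank_inf_eq (fixedSpace r)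
    ((fixedSpace r).map (Matrix.toLin' h.1))
  have h4 := Submodule.finrank_le (fixedSpace r ⊔ (fixedSpace r).map (Matrix.toLin' h.1))
  have h5 : finrank ℝ (Fin 2 × Fin 2 × Fin 2 → ℝ) = 8 := by
    rw [Module.finrank_fintype_fun_eq_card]; rfl
  have h6 : fixedSpace r ⊓ (fixedSpace r).map (Matrix.toLin' h.1) ≠ ⊥ := by
    intro e
    rw [e, finrank_bot] at h3
    omega
  obtain ⟨v, ⟨hv, u, hu, huv⟩, hv0⟩ := Submodule.exists_mem_ne_zero_of_ne_bot h6
  exact ⟨u, v, hv0, mem_fixedSpace.1 hu, mem_fixedSpace.1 hv, huv.symm⟩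

/-- The commutator of a rotation in `N` with an element of `H` has a nonzero fixed vector. -/
theorem IsRotation.exists_fixed_commutator {n : N} (hr : IsRotation n.1) (h : H) :
    ∃ v, v ≠ 0 ∧ mat (Subgroup.normalizerMonoidHom H n h * h⁻¹) *ᵥ v = v := by
  obtain ⟨u, v, hv, h1, h2, h3⟩ := hr.exists_common_fixed h.1
  refine ⟨v, hv, ?_⟩
  have e1 : mat h⁻¹ *ᵥ v = u := by
    rw [h3, mulVec_mulVec]
    have : mat h⁻¹ * h.1.1 = 1 := by rw [← mat_mul, inv_mul_cancel, mat_one]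
    rw [this, one_mulVec]
  rw [mat_mul, ← mulVec_mulVec, e1]
  -- Writing `u` as `r u` cancels the inverse: `r h r⁻¹ u = r h u = r v = v`.
  nth_rewrite 1 [← h1]
  rw [mulVec_mulVec, N_conj_mat, ← mulVec_mulVec]
  change n.1.1 *ᵥ (h.1.1 *ᵥ u) = v
  rw [← h3, h2]

theorem eq_zero_of_neg_one_mulVec {v : Fin 2 × Fin 2 × Fin 2 → ℝ}
    (h : (-1 : Mat8) *ᵥ v = v) : v = 0 := by
  rw [neg_mulVec, one_mulVec] at h
  exact neg_eq_self.1 h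

theorem sqType_eq_zero_of_fixed {k : H} {v : Fin 2 × Fin 2 × Fin 2 → ℝ} (hv : v ≠ 0)
    (h : mat k *ᵥ v = v) : sqType k = 0 := by
  rcases mat_sq k with e | e
  · exact if_pos e
  · exfalso
    refine hv (eq_zero_of_neg_one_mulVec ?_)
    rw [← e, ← mulVec_mulVec, h, h]

theorem sub_eq_add_A (x y : A) : x - y = x + y := by
  rw [sub_eq_add_neg, neg_eq_of_add_eq_zero_left (two_smul_zero y)]

theorem toA_inv (h : H) : toA h⁻¹ = toA h := by
  have e : toA (h⁻¹ * h) = 0 := by rw [inv_mul_cancel]; rfl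
  rw [toA_mul] at e
  rw [eq_neg_of_add_eq_zero_left e, neg_eq_of_add_eq_zero_left (two_smul_zero _)]

theorem toA_commutator (n : N) (h : H) :
    toA (Subgroup.normalizerMonoidHom H n h * h⁻¹) = conjAction n (toA h) - toA h := by
  rw [toA_mul, conjAction_toA, sub_eq_add_A, toA_inv]

theorem IsRotation.Q_sub_eq_zero {n : N} (hr : IsRotation n.1) (x : A) :
    Q (conjAction n x - x) = 0 := by
  obtain ⟨h, rfl⟩ := toA_surjective x
  obtain ⟨v, hv, hv'⟩ := hr.exists_fixed_commutator h
  rw [← toA_commutator, Q_toA]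
  exact sqType_eq_zero_of_fixed hv hv'

/-- If a rotation in `N` fixes the class of `h`, then it commutes with `h`. -/
theorem IsRotation.commute {n : N} (hr : IsRotation n.1) {h : H}
    (hh : conjAction n (toA h) = toA h) : n.1.1 * mat h = mat h * n.1.1 := by
  obtain ⟨v, hv, hv'⟩ := hr.exists_fixed_commutator h
  have h0 := toA_commutator n h
  rw [hh, sub_self, toA_eq_zero_iff] at h0
  rcases h0 with e | e
  · rw [← N_conj_mat]
    have : Subgroup.normalizerMonoidHom H n h = h := by
      have e' : Subgroup.normalizerMonoidHom H n h * h⁻¹ = 1 := mat_inj e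
      exact mul_inv_eq_one.1 e'
    rw [this]
  · rw [e] at hv'
    exact absurd (eq_zero_of_neg_one_mulVec hv') hv

theorem conjAction_mem (n : N) : conjAction n ∈ IsometryGroup Q := fun x => by
  obtain ⟨h, rfl⟩ := toA_surjective x
  rw [conjAction_toA, Q_toA, Q_toA]
  refine sgn_inj ?_
  have h1 : ∀ h : H, mat (h * h) = sgn (sqType h) := fun h => by rw [mat_mul, mat_sq_eq]
  rw [← h1, ← h1, ← map_mul, mat_normalizer, h1, sgn_comm, mul_assoc, mul_inv_val, mul_one]

/-- A rotation acting trivially would commute with `H`, hence be 1 or -1, whose fixed space has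
dimension 8 or 0. -/
theorem IsRotation.conjAction_ne_one {n : N} (hr : IsRotation n.1) : conjAction n ≠ 1 := by
  intro e
  obtain ⟨c, hc⟩ := exists_eq_smul_one (M := n.1.1) fun h =>
    (hr.commute (h := h) (by rw [e]; rfl)).symm
  have h6 := finrank_fixedSpace hr
  rcases eq_one_or_neg_one_of_scalar hc with h | h
  · have : fixedSpace n.1 = ⊤ := by
      rw [eq_top_iff]
      intro v _
      rw [mem_fixedSpace, h, one_mulVec]
    rw [this, finrank_top, Module.finrank_fintype_fun_eq_card] at h6
    exact absurd h6 (by decide)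
  · have : fixedSpace n.1 = ⊥ := by
      rw [eq_bot_iff]
      intro v hv
      rw [mem_fixedSpace, h] at hv
      exact eq_zero_of_neg_one_mulVec hv
    rw [this, finrank_bot] at h6
    omega

/-- An isometry `g ≠ 1` such that `g - 1` has totally singular image is a Siegel transformation. -/
theorem isSiegel_of_Q_sub_eq_zero {g : A ≃ₗ[ZMod 2] A} (hg : g ∈ IsometryGroup Q) (hg1 : g ≠ 1)
    (hQ : ∀ x, Q (g x - x) = 0) : IsSiegel g := by
  set B : LinearMap.BilinForm (ZMod 2) A := Q.polarBilin with hB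
  have Badd : ∀ x y, Q (x + y) = Q x + Q y + B x y := fun x y => QuadraticMap.map_add Q x y
  have Bcomm : ∀ x y, B x y = B y x := fun x y => QuadraticMap.polar_comm _ _ _
  let S : A →ₗ[ZMod 2] A := (g : A →ₗ[ZMod 2] A) - LinearMap.id
  have Sapp : ∀ x, S x = g x - x := fun _ => rfl
  have hS : ∀ x, Q (S x) = 0 := hQ
  have hSS : ∀ x y, B (S x) (S y) = 0 := fun x y => by
    have := Badd (S x) (S y)
    rw [← map_add, hS, hS, hS, zero_add, zero_add] at this
    exact this.symm
  have hself : ∀ x, B (S x) x = 0 := fun x => by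
    have h1 := Badd (S x) x
    rw [hS, zero_add, Sapp, sub_add_cancel, hg x] at h1
    exact left_eq_add.1 h1
  have hnd := Q_nondegenerate
  -- This form is alternating and its radical is the kernel of `S`, so the rank of `S` is even. As
  -- the image of `S` is totally singular, the rank is also at most 3.
  let β : LinearMap.BilinForm (ZMod 2) A := B ∘ₗ S
  have βapp : ∀ x y, β x y = B (S x) y := fun _ _ => rfl
  have hβ : β.IsAlt := hself
  have hβcomm : ∀ x y, B (S x) y = B (S y) x := fun x y => by
    have h1 := hself (x + y)
    rw [map_add, map_add, map_add, LinearMap.add_apply, LinearMap.add_apply, hself, hself,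
      zero_add, add_zero] at h1
    have h2 := eq_neg_of_add_eq_zero_left h1
    rcases zmod_cases (B (S x) y) with e | e <;> rcases zmod_cases (B (S y) x) with e' | e' <;>
      rw [e, e'] at h2 ⊢ <;> revert h2 <;> decide
  obtain ⟨k, hk⟩ := exists_finrank_eq_finrank_ker_add 6 β hβ finrank_A
  have hker : LinearMap.ker β = LinearMap.ker S := by
    ext x
    rw [LinearMap.mem_ker, LinearMap.mem_ker]
    constructor
    · intro h
      exact hnd.1 _ fun y => LinearMap.congr_fun h y
    · intro h
      ext y
      rw [βapp, h, map_zero]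
  have d1 := LinearMap.finrank_range_add_finrank_ker S
  have d2 := LinearMap.BilinForm.finrank_orthogonal hnd (LinearMap.range S)
  have d3 : LinearMap.range S ≤ B.orthogonal (LinearMap.range S) := by
    rintro _ ⟨x, rfl⟩ _ ⟨y, rfl⟩
    exact hSS y x
  have d4 := Submodule.finrank_mono d3
  rw [hker] at hk
  rw [← hB, finrank_A] at d2
  rw [finrank_A] at hk d1
  obtain ⟨x₀, hx₀⟩ : ∃ x, S x ≠ 0 := by
    by_contra! hc
    refine hg1 (LinearEquiv.ext fun x => ?_)
    exact sub_eq_zero.1 (hc x)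
  obtain ⟨y₀, hy₀⟩ : ∃ y, B (S x₀) y = 1 := by
    by_contra! hc
    refine hx₀ (hnd.1 _ fun y => ?_)
    exact (zmod_cases _).resolve_right (hc y)
  have hy₀' : B (S y₀) x₀ = 1 := by rw [← hβcomm, hy₀]
  have hy₀0 : S y₀ ≠ 0 := fun h => by
    rw [h, map_zero, LinearMap.zero_apply] at hy₀'
    exact zero_ne_one hy₀'
  have hne : S x₀ ≠ S y₀ := fun h => by
    rw [h, hself] at hy₀
    exact zero_ne_one hy₀
  have li : LinearIndependent (ZMod 2) ![S x₀, S y₀] := by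
    rw [LinearIndependent.pair_iff]
    intro c d hcd
    exact independent_pair hx₀ hy₀0 hne hcd
  have hrange : Submodule.span (ZMod 2) (Set.range ![S x₀, S y₀]) = LinearMap.range S := by
    refine Submodule.eq_of_le_of_finrank_le ?_ ?_
    · rw [Submodule.span_le]
      rintro _ ⟨i, rfl⟩
      fin_cases i
      exacts [⟨x₀, rfl⟩, ⟨y₀, rfl⟩]
    · rw [finrank_span_eq_card li, Fintype.card_fin]
      omega
  -- The coefficients of `S x` in the basis `S x₀`, `S y₀` are read off by pairing with `y₀` and
  -- `x₀`; the symmetry of β then moves `S` to the other argument.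
  have hform : ∀ x, S x = B x (S x₀) • S y₀ + B x (S y₀) • S x₀ := by
    intro x
    have hx : S x ∈ Submodule.span (ZMod 2) (Set.range ![S x₀, S y₀]) := hrange ▸ ⟨x, rfl⟩
    rw [Matrix.range_cons_cons_empty, Submodule.mem_span_pair] at hx
    obtain ⟨c, d, hcd⟩ := hx
    have e1 : B (S x) x₀ = d := by
      rw [← hcd, map_add, map_smul, map_smul, LinearMap.add_apply, LinearMap.smul_apply,
        LinearMap.smul_apply, hself, hy₀', smul_zero, zero_add, smul_eq_mul, mul_one]
    have e2 : B (S x) y₀ = c := by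
      rw [← hcd, map_add, map_smul, map_smul, LinearMap.add_apply, LinearMap.smul_apply,
        LinearMap.smul_apply, hself, hy₀, smul_zero, add_zero, smul_eq_mul, mul_one]
    rw [Bcomm x, Bcomm x, hβcomm x₀ x, hβcomm y₀ x, e1, e2, add_comm, hcd]
  obtain ⟨s, hs⟩ := coord.surjective (S x₀)
  obtain ⟨a, ha⟩ := coord.surjective (S y₀)
  refine ⟨s, a, ⟨?_, ?_, ?_, ?_, ?_, ?_⟩, fun x => ?_⟩
  · rw [← Q_coord, hs, hS]
  · rw [← Q_coord, ha, hS]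
  · rw [← polar_coord, hs, ha, ← hB, hSS]
  · rintro rfl
    exact hx₀ (by rw [← hs, map_zero])
  · rintro rfl
    exact hy₀0 (by rw [← ha, map_zero])
  · rintro rfl
    exact hne (by rw [← hs, ← ha])
  · have := hform (coord x)
    rw [← hs, ← ha, hB, polar_coord, polar_coord, Sapp, sub_eq_iff_eq_add] at this
    rw [this, siegelMap_apply, map_add, map_add, map_smul, map_smul, add_comm]

theorem IsRotation.isSiegel {n : N} (hr : IsRotation n.1) : IsSiegel (conjAction n) :=
  isSiegel_of_Q_sub_eq_zero (conjAction_mem n) hr.conjAction_ne_one hr.Q_sub_eq_zero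

theorem mem_L_iff {g : SO8} :
    g ∈ L ↔ ∃ hg : g ∈ N, conjAction ⟨g, hg⟩ ∈ SpecialIsometryGroup Q Q_nondegenerate := by
  constructor
  · rintro ⟨n, hn, rfl⟩
    exact ⟨n.2, hn⟩
  · rintro ⟨hg, h⟩
    exact ⟨⟨g, hg⟩, h, rfl⟩

theorem IsRotation.mem_L {r : SO8} (hr : IsRotation r) (hN : r ∈ N) : r ∈ L :=
  mem_L_iff.2 ⟨hN, siegel_mem (IsRotation.isSiegel (n := ⟨r, hN⟩) hr)⟩

/-! ### Every Siegel transformation is induced by a rotation -/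

theorem transpose_eq_of_sq {h : H} (e : mat h * mat h = 1) : (mat h)ᵀ = mat h := by
  have h1 : mat h * (mat h)ᵀ = 1 := (Matrix.mem_orthogonalGroup_iff _ _).1
    ((Matrix.mem_specialOrthogonalGroup_iff).1 h.1.2).1
  calc (mat h)ᵀ = mat h * mat h * (mat h)ᵀ := by rw [e, one_mul]
    _ = mat h := by rw [mul_assoc, h1, mul_one]

/-- By nondegeneracy some `k ∈ H` anticommutes with `h`, so `h` is conjugate to its negative. -/
theorem trace_eq_zero {h : H} (hh : toA h ≠ 0) : (mat h).trace = 0 := by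
  obtain ⟨x, hx⟩ := coord.surjective (toA h)
  obtain ⟨y, hy⟩ := exists_kleinPolar_eq_one x (by rintro rfl; exact hh (by rw [← hx, map_zero]))
  obtain ⟨k, hk⟩ := toA_surjective (coord y)
  have hc : commType k h = 1 := by
    rw [← polar_eq_commType, hk, ← hx, polar_coord, hy]
  have h1 := mat_comm k h
  rw [hc, sgn_one, neg_one_mul] at h1
  have h2 : mat k * mat h * mat k⁻¹ = -mat h := by
    rw [h1, neg_mul, mul_assoc, mat_mul_inv, mul_one]
  have h3 : (mat k * mat h * mat k⁻¹).trace = (mat h).trace := by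
    rw [Matrix.trace_mul_comm, ← mul_assoc]
    have : mat k⁻¹ * mat k = 1 := by rw [← mat_mul, inv_mul_cancel, mat_one]
    rw [this, one_mul]
  rw [h2, Matrix.trace_neg] at h3
  exact neg_eq_self.1 h3

/-! ### The involution of ℝ⁸ attached to two commuting involutions. -/

section Construction

variable {a b : Mat8}

/-- The projection onto the common `1`-eigenspace of commuting involutions `a` and `b`. -/
noncomputable def fixProj (a b : Mat8) : Mat8 := (1 / 4 : ℝ) • ((1 + a) * (1 + b))

/-- The involution acting as `-1` on the common `1`-eigenspace of `a` and `b`. -/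
noncomputable def flipMat (a b : Mat8) : Mat8 := 1 - (1 / 2 : ℝ) • ((1 + a) * (1 + b))

theorem flipMat_eq (a b : Mat8) : flipMat a b = 1 - fixProj a b - fixProj a b := by
  rw [flipMat, fixProj]; module

theorem fixProj_mul_self (ha : a * a = 1) (hb : b * b = 1) (hab : a * b = b * a) :
    fixProj a b * fixProj a b = fixProj a b := by
  have h1 : (1 + a) * (1 + b) = (1 + b) * (1 + a) := by
    simp only [mul_add, add_mul, mul_one, one_mul, hab]; abel
  have h2 : (1 + a) * (1 + a) = (2 : ℝ) • (1 + a) := by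
    simp only [mul_add, add_mul, mul_one, one_mul, ha]; module
  have h3 : (1 + b) * (1 + b) = (2 : ℝ) • (1 + b) := by
    simp only [mul_add, add_mul, mul_one, one_mul, hb]; module
  have h4 : (1 + a) * (1 + b) * ((1 + a) * (1 + b)) = (4 : ℝ) • ((1 + a) * (1 + b)) := by
    calc _ = (1 + a) * ((1 + b) * (1 + a)) * (1 + b) := by simp only [mul_assoc]
      _ = (1 + a) * (1 + a) * ((1 + b) * (1 + b)) := by rw [← h1]; simp only [mul_assoc]
      _ = _ := by rw [h2, h3, smul_mul_smul_comm]; norm_num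
  rw [fixProj, smul_mul_smul_comm, h4, smul_smul]
  norm_num

theorem flipMat_mul_self (ha : a * a = 1) (hb : b * b = 1) (hab : a * b = b * a) :
    flipMat a b * flipMat a b = 1 := by
  have h := fixProj_mul_self ha hb hab
  rw [flipMat_eq]
  calc _ = 1 - fixProj a b - fixProj a b - fixProj a b - fixProj a b +
      (fixProj a b * fixProj a b + fixProj a b * fixProj a b + fixProj a b * fixProj a b +
        fixProj a b * fixProj a b) := by noncomm_ring
    _ = 1 := by rw [h]; abel

/-- With `P = fixProj a b`, the square root is `1 - P + j P`, where `j` acts as a complex structure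
on the image of `P`. Being a square rules out determinant -1. -/
theorem flipMat_eq_sq {j : Mat8} (ha : a * a = 1) (hb : b * b = 1) (hab : a * b = b * a)
    (hj : j * j = -1) (hja : j * a = a * j) (hjb : j * b = b * j) :
    ∃ s, flipMat a b = s * s := by
  have hP := fixProj_mul_self ha hb hab
  have hjP : j * fixProj a b = fixProj a b * j := by
    have h1 : j * (1 + a) = (1 + a) * j := by rw [mul_add, add_mul, hja, one_mul, mul_one]
    have h2 : j * (1 + b) = (1 + b) * j := by rw [mul_add, add_mul, hjb, one_mul, mul_one]
    rw [fixProj, mul_smul_comm, smul_mul_assoc, ← mul_assoc, h1, mul_assoc, h2, mul_assoc]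
  refine ⟨1 - fixProj a b + j * fixProj a b, ?_⟩
  rw [flipMat_eq]
  generalize fixProj a b = P at *
  have e1 : P * j * P = j * P := by rw [← hjP, mul_assoc, hP]
  have e2 : j * P * j * P = -P := by
    rw [hjP, mul_assoc P, hj, mul_neg, mul_one, neg_mul, hP]
  have e : (1 - P + j * P) * (1 - P + j * P) = 1 - P - P + P * P + (j * P - P * j * P) +
      (j * P - j * (P * P)) + j * P * j * P := by noncomm_ring
  rw [e, e1, e2, hP]
  abel

theorem flipMat_transpose (ha : aᵀ = a) (hb : bᵀ = b) (hab : a * b = b * a) :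
    (flipMat a b)ᵀ = flipMat a b := by
  have h1 : (1 + a) * (1 + b) = (1 + b) * (1 + a) := by
    simp only [mul_add, add_mul, mul_one, one_mul, hab]; abel
  rw [flipMat, transpose_sub, transpose_smul, transpose_mul, transpose_add, transpose_add,
    transpose_one, ha, hb, h1]

theorem flipMat_mem {j : Mat8} (ha : a * a = 1) (hb : b * b = 1) (hab : a * b = b * a)
    (hj : j * j = -1) (hja : j * a = a * j) (hjb : j * b = b * j) (ha' : aᵀ = a) (hb' : bᵀ = b) :
    flipMat a b ∈ Matrix.specialOrthogonalGroup (Fin 2 × Fin 2 × Fin 2) ℝ := by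
  have hsq := flipMat_mul_self ha hb hab
  rw [Matrix.mem_specialOrthogonalGroup_iff, Matrix.mem_orthogonalGroup_iff]
  constructor
  · change flipMat a b * (flipMat a b)ᵀ = 1
    rw [flipMat_transpose ha' hb' hab, hsq]
  · obtain ⟨s, hs⟩ := flipMat_eq_sq ha hb hab hj hja hjb
    have h1 : 0 ≤ (flipMat a b).det := by
      rw [hs, det_mul]
      exact mul_self_nonneg _
    have h2 := congrArg Matrix.det hsq
    rw [det_mul, det_one] at h2
    rcases mul_self_eq_one_iff.1 h2 with h | h
    · exact h
    · rw [h] at h1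
      norm_num at h1

/-- The fixed space is the kernel of `fixProj a b`, an idempotent of trace 8 / 4 = 2 because `a`,
`b` and `a * b` are traceless. -/
theorem isRotation_of_flipMat {r : SO8} (hr : r.1 = flipMat a b) (ha : a * a = 1) (hb : b * b = 1)
    (hab : a * b = b * a) (ta : a.trace = 0) (tb : b.trace = 0) (tab : (a * b).trace = 0) :
    IsRotation r := by
  have hP := fixProj_mul_self ha hb hab
  have hker : LinearMap.ker (Matrix.toLin' r.1 - LinearMap.id) =
      LinearMap.ker (Matrix.toLin' (fixProj a b)) := by
    ext v
    rw [LinearMap.mem_ker, LinearMap.mem_ker, LinearMap.sub_apply, hr, flipMat_eq, toLin'_apply,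
      toLin'_apply, sub_mulVec, sub_mulVec, one_mulVec, LinearMap.id_apply]
    have e : v - fixProj a b *ᵥ v - fixProj a b *ᵥ v - v = (-2 : ℝ) • (fixProj a b *ᵥ v) := by
      module
    rw [e, smul_eq_zero]
    norm_num
  have hidem : IsIdempotentElem (Matrix.toLin' (fixProj a b)) := by
    change Matrix.toLin' _ * Matrix.toLin' _ = Matrix.toLin' _
    rw [Module.End.mul_eq_comp, ← toLin'_mul, hP]
  have htr := (LinearMap.IsIdempotentElem.isProj_range _ hidem).trace
  have htr' : (fixProj a b).trace = 2 := by
    rw [fixProj, Matrix.trace_smul]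
    simp only [mul_add, add_mul, mul_one, one_mul, Matrix.trace_add, ta, tb, tab, Matrix.trace_one,
      Fintype.card_prod, Fintype.card_fin]
    norm_num
  rw [← Matrix.toLin_eq_toLin', Matrix.trace_toLin_eq, htr'] at htr
  rw [Matrix.toLin_eq_toLin'] at htr
  have h2 : finrank ℝ (LinearMap.range (Matrix.toLin' (fixProj a b))) = 2 := by
    exact_mod_cast htr.symm
  have h3 := LinearMap.finrank_range_add_finrank_ker (Matrix.toLin' (fixProj a b))
  rw [IsRotation, hker]
  rw [h2, Module.finrank_fintype_fun_eq_card] at h3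
  omega

/-- Moving `flipMat a b` past `h` changes the signs of `a` and `b` to ε and δ, and `k` compensates
for the change. On the joint eigenspaces of `a` and `b` the required factor is seen to be 1, `-a`,
`-b` or `-(a * b)`, according to the signs. -/
theorem flipMat_conj {h k : Mat8} {ε δ : ℝ} (hε : h * a = ε • (a * h)) (hδ : h * b = δ • (b * h))
    (e : k * (1 - (1 / 2 : ℝ) • ((1 + ε • a) * (1 + δ • b))) = flipMat a b) :
    flipMat a b * h = k * h * flipMat a b := by
  have h1 : h * (1 + a) = (1 + ε • a) * h := by
    rw [mul_add, add_mul, hε, smul_mul_assoc, mul_one, one_mul]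
  have h2 : h * (1 + b) = (1 + δ • b) * h := by
    rw [mul_add, add_mul, hδ, smul_mul_assoc, mul_one, one_mul]
  have h3 : h * flipMat a b = (1 - (1 / 2 : ℝ) • ((1 + ε • a) * (1 + δ • b))) * h := by
    rw [flipMat, mul_sub, sub_mul, mul_one, one_mul, mul_smul_comm, smul_mul_assoc, ← mul_assoc, h1,
      mul_assoc, h2, mul_assoc]
  rw [mul_assoc k, h3, ← mul_assoc, e]


theorem flipMat_pos_pos (a b : Mat8) :
    1 * (1 - (1 / 2 : ℝ) • ((1 + (1 : ℝ) • a) * (1 + (1 : ℝ) • b))) = flipMat a b := by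
  rw [one_mul, one_smul, one_smul, flipMat]

theorem flipMat_pos_neg (ha : a * a = 1) :
    -a * (1 - (1 / 2 : ℝ) • ((1 + (1 : ℝ) • a) * (1 + (-1 : ℝ) • b))) = flipMat a b := by
  rw [flipMat]
  simp only [mul_add, add_mul, mul_sub, mul_one, one_mul, mul_smul_comm, smul_mul_assoc,
    neg_mul, ← mul_assoc, ha]
  module

theorem flipMat_neg_pos (hb : b * b = 1) (hab : a * b = b * a) :
    -b * (1 - (1 / 2 : ℝ) • ((1 + (-1 : ℝ) • a) * (1 + (1 : ℝ) • b))) = flipMat a b := by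
  have e : a * b * b = a := by rw [mul_assoc, hb, mul_one]
  rw [flipMat]
  simp only [mul_add, add_mul, mul_sub, mul_one, one_mul, mul_smul_comm, smul_mul_assoc,
    neg_mul, ← mul_assoc, ← hab, hb, e]
  module

theorem flipMat_neg_neg (ha : a * a = 1) (hb : b * b = 1) (hab : a * b = b * a) :
    -(a * b) * (1 - (1 / 2 : ℝ) • ((1 + (-1 : ℝ) • a) * (1 + (-1 : ℝ) • b))) = flipMat a b := by
  have e1 : a * b * a = b := by rw [hab, mul_assoc, ha, mul_one]
  have e2 : a * b * b = a := by rw [mul_assoc, hb, mul_one]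
  rw [flipMat]
  simp only [mul_add, add_mul, mul_sub, mul_one, one_mul, mul_smul_comm, smul_mul_assoc,
    neg_mul, ← mul_assoc, e1, e2, hb]
  module

end Construction

/-! ### Conjugation of `H` by the constructed rotations. -/

theorem commType_comm (h k : H) : commType h k = commType k h := by
  rw [← polar_toA, ← polar_toA, QuadraticMap.polar_comm]

theorem commType_smul (k h : H) :
    mat k * mat h = (if commType h k = 0 then (1 : ℝ) else -1) • (mat h * mat k) := by
  rw [mat_comm h k]
  rcases zmod_cases (commType h k) with e | e <;> rw [e]
  · rw [if_pos rfl, sgn_zero, one_mul, one_smul]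
  · rw [if_neg one_ne_zero, sgn_one, neg_one_mul, smul_neg, neg_smul, one_smul, neg_neg]

/-- The class of the correction `k` is exactly the displacement of the class of `h` under the Siegel
transformation. The element `z` over -1 provides the sign, which the class does not see. -/
theorem exists_flipMat_conj {p q : H} (hpp : mat p * mat p = 1) (hqq : mat q * mat q = 1)
    (hpq : mat p * mat q = mat q * mat p) (h : H) :
    ∃ k : H, toA k = commType h p • toA q + commType h q • toA p ∧
      flipMat (mat p) (mat q) * mat h = mat k * mat h * flipMat (mat p) (mat q) := by
  obtain ⟨z, hz⟩ := exists_neg_one_mem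
  have hz0 : toA z = 0 := toA_eq_zero_iff.2 (Or.inr hz)
  have sign : ∀ g : H, mat h * mat g =
      (if commType h g = 0 then (1 : ℝ) else -1) • (mat g * mat h) := fun g => by
    rw [commType_comm, ← commType_smul]
  have hp := sign p
  have hq := sign q
  rcases zmod_cases (commType h p) with h1 | h1 <;> rcases zmod_cases (commType h q) with h2 | h2
  · refine ⟨1, ?_, ?_⟩
    · rw [h1, h2, zero_smul, zero_smul, add_zero]; rfl
    · rw [if_pos h1] at hp
      rw [if_pos h2] at hq
      exact flipMat_conj hp hq (flipMat_pos_pos _ _)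
  · refine ⟨z * p, ?_, ?_⟩
    · rw [h1, h2, toA_mul, hz0, zero_add, zero_smul, zero_add, one_smul]
    · rw [if_pos h1] at hp
      rw [if_neg (by rw [h2]; exact one_ne_zero)] at hq
      rw [mat_mul, hz, neg_one_mul]
      exact flipMat_conj hp hq (flipMat_pos_neg hpp)
  · refine ⟨z * q, ?_, ?_⟩
    · rw [h1, h2, toA_mul, hz0, zero_add, zero_smul, add_zero, one_smul]
    · rw [if_neg (by rw [h1]; exact one_ne_zero)] at hp
      rw [if_pos h2] at hq
      rw [mat_mul, hz, neg_one_mul]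
      exact flipMat_conj hp hq (flipMat_neg_pos hqq hpq)
  · refine ⟨z * (p * q), ?_, ?_⟩
    · rw [h1, h2, toA_mul, hz0, zero_add, toA_mul, one_smul, one_smul, add_comm]
    · rw [if_neg (by rw [h1]; exact one_ne_zero)] at hp
      rw [if_neg (by rw [h2]; exact one_ne_zero)] at hq
      rw [mat_mul, hz, neg_one_mul, mat_mul]
      exact flipMat_conj hp hq (flipMat_neg_neg hpp hqq hpq)

/-- Every Siegel transformation of a totally singular plane is induced by a rotation in `N`. -/
theorem IsSingularPlane.exists_rotation {s t : Biv} (hst : IsSingularPlane s t) :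
    ∃ n : N, IsRotation n.1 ∧ ∀ x, conjAction n (coord x) = coord (siegelMap s t x) := by
  -- A lift of `v` is the complex structure commuting with both involutions that the determinant
  -- computation needs.
  obtain ⟨v, hv, hvs, hvt⟩ := exists_nonsingular_orthogonal s hst.klein_left t hst.klein_right
    hst.polar
  obtain ⟨p, hp⟩ := toA_surjective (coord s)
  obtain ⟨q, hq⟩ := toA_surjective (coord t)
  obtain ⟨j, hj⟩ := toA_surjective (coord v)
  have comm : ∀ {g h : H} {x y : Biv}, toA g = coord x → toA h = coord y → kleinPolar x y = 0 →
      mat g * mat h = mat h * mat g := by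
    intro g h x y hg hh hxy
    rw [mat_comm, ← polar_eq_commType, hg, hh, polar_coord, hxy, sgn_zero, one_mul]
  have sq : ∀ {g : H} {x : Biv}, toA g = coord x → mat g * mat g = sgn (klein x) := by
    intro g x hg
    rw [mat_sq_eq, ← Q_toA, hg, Q_coord]
  have hpp : mat p * mat p = 1 := by rw [sq hp, hst.klein_left, sgn_zero]
  have hqq : mat q * mat q = 1 := by rw [sq hq, hst.klein_right, sgn_zero]
  have hjj : mat j * mat j = -1 := by rw [sq hj, hv, sgn_one]
  have hpq := comm hp hq hst.polar
  have hne : ∀ {g : H} {x : Biv}, toA g = coord x → x ≠ 0 → toA g ≠ 0 := by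
    intro g x hg hx
    rw [hg]
    simpa using hx
  let r : SO8 := ⟨flipMat (mat p) (mat q), flipMat_mem hpp hqq hpq hjj (comm hj hp hvs)
    (comm hj hq hvt) (transpose_eq_of_sq hpp) (transpose_eq_of_sq hqq)⟩
  have hr : r.1 = flipMat (mat p) (mat q) := rfl
  have hrot : IsRotation r := isRotation_of_flipMat hr hpp hqq hpq
    (trace_eq_zero (hne hp hst.left_ne)) (trace_eq_zero (hne hq hst.right_ne))
    (trace_eq_zero (h := p * q) (hne (x := s + t) (by rw [toA_mul, hp, hq, map_add])
      (add_ne_zero_of_ne hst.ne)))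
  have hrr : r * r = 1 := Subtype.ext (flipMat_mul_self hpp hqq hpq)
  have hrinv : r⁻¹ = r := inv_eq_of_mul_eq_one_left hrr
  have key : ∀ h : H, ∃ k : H, toA k = commType h p • toA q + commType h q • toA p ∧
      r * h.1 = k.1 * h.1 * r := fun h => by
    obtain ⟨k, hk, e⟩ := exists_flipMat_conj hpp hqq hpq h
    exact ⟨k, hk, Subtype.ext e⟩
  have hconj : ∀ h : H, ∃ k : H, toA k = commType h p • toA q + commType h q • toA p ∧
      r * h.1 * r⁻¹ = k.1 * h.1 := by
    intro h
    obtain ⟨k, hk, e⟩ := key h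
    exact ⟨k, hk, by rw [e, mul_inv_cancel_right]⟩
  have hmem : ∀ h ∈ H, r * h * r⁻¹ ∈ H := by
    intro h hh
    obtain ⟨k, -, e⟩ := hconj ⟨h, hh⟩
    change r * h * r⁻¹ = k.1 * h at e
    rw [e]
    exact mul_mem k.2 hh
  have hN : r ∈ N := by
    refine Subgroup.mem_set_normalizer_iff.2 fun h => ⟨hmem h, fun hh => ?_⟩
    have := hmem _ hh
    rw [hrinv] at this
    have e : r * (r * h * r) * r = r * r * h * (r * r) := by simp only [mul_assoc]
    rwa [e, hrr, one_mul, mul_one] at this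
  refine ⟨⟨r, hN⟩, hrot, fun x => ?_⟩
  obtain ⟨h, hh⟩ := toA_surjective (coord x)
  obtain ⟨k, hk, e⟩ := hconj h
  have e' : Subgroup.normalizerMonoidHom H ⟨r, hN⟩ h = k * h := Subtype.ext e
  rw [← hh, conjAction_toA, e', toA_mul, hk, ← polar_eq_commType, ← polar_eq_commType, hh, hp, hq,
    polar_coord, polar_coord, siegelMap_apply, map_add, map_add, map_smul, map_smul, add_comm]

/-! ### Joint eigenspaces of commuting involutions -/

section JointEigenspace

variable {ι : Type} {n : Type} [Fintype n] [DecidableEq n]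

/-- The joint eigenspaces of a family of matrices. -/
def jointEigenspace (T : ι → Matrix n n ℝ) (χ : ι → ℝ) : Submodule ℝ (n → ℝ) :=
  ⨅ i, Module.End.eigenspace (Matrix.toLin' (T i)) (χ i)

theorem mem_jointEigenspace {T : ι → Matrix n n ℝ} {χ : ι → ℝ} {v : n → ℝ} :
    v ∈ jointEigenspace T χ ↔ ∀ i, T i *ᵥ v = χ i • v := by
  simp [jointEigenspace, Submodule.mem_iInf]

theorem iSupIndep_jointEigenspace {T : ι → Matrix n n ℝ}
    (hcomm : ∀ i j, T i * T j = T j * T i) : iSupIndep (jointEigenspace T) := by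
  have h := Module.End.independent_iInf_maxGenEigenspace_of_forall_mapsTo
    (fun i => Matrix.toLin' (T i)) fun i j φ =>
      Module.End.mapsTo_maxGenEigenspace_of_comm (by
        change Matrix.toLin' (T j) * Matrix.toLin' (T i) = Matrix.toLin' (T i) * Matrix.toLin' (T j)
        rw [Module.End.mul_eq_comp, Module.End.mul_eq_comp, ← toLin'_mul, ← toLin'_mul,
          hcomm]) φ
  exact h.mono fun χ => iInf_mono fun i => Module.End.genEigenspace_le_maximal _ _ 1

theorem iSup_jointEigenspace [Finite ι] {T : ι → Matrix n n ℝ} (hsq : ∀ i, T i * T i = 1)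
    (hcomm : ∀ i j, T i * T j = T j * T i) : ⨆ χ, jointEigenspace T χ = ⊤ := by
  -- Each matrix is annihilated by the squarefree polynomial `X ^ 2 - 1`, so generalized eigenspaces
  -- are eigenspaces.
  have hss : ∀ i, Module.End.IsSemisimple (Matrix.toLin' (T i)) := fun i => by
    refine Module.End.isSemisimple_of_squarefree_aeval_eq_zero (p := Polynomial.X ^ 2 - Polynomial.C 1)
      (Polynomial.separable_X_pow_sub_C (1 : ℝ) two_ne_zero one_ne_zero).squarefree ?_
    rw [map_sub, map_pow, Polynomial.aeval_X, Polynomial.aeval_C, pow_two, map_one, sub_eq_zero,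
      Module.End.mul_eq_comp, ← toLin'_mul, hsq, toLin'_one]
    rfl
  have heq : ∀ i μ, Module.End.maxGenEigenspace (Matrix.toLin' (T i)) μ =
      Module.End.eigenspace (Matrix.toLin' (T i)) μ := fun i μ =>
    Module.End.IsFinitelySemisimple.maxGenEigenspace_eq_eigenspace (hss i).isFinitelySemisimple μ
  have h := Module.End.iSup_iInf_maxGenEigenspace_eq_top_of_forall_mapsTo
    (fun i => Matrix.toLin' (T i)) (fun i j φ =>
      Module.End.mapsTo_maxGenEigenspace_of_comm (by
        change Matrix.toLin' (T j) * Matrix.toLin' (T i) = Matrix.toLin' (T i) * Matrix.toLin' (T j)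
        rw [Module.End.mul_eq_comp, Module.End.mul_eq_comp, ← toLin'_mul, ← toLin'_mul,
          hcomm]) φ) fun i => by
    rw [eq_top_iff]
    intro v _
    have hv : ∀ w : n → ℝ, T i *ᵥ (T i *ᵥ w) = w := fun w => by
      rw [mulVec_mulVec, hsq, one_mulVec]
    have h1 : (1 / 2 : ℝ) • (v + T i *ᵥ v) ∈
        Module.End.eigenspace (Matrix.toLin' (T i)) (1 : ℝ) := by
      rw [Module.End.mem_eigenspace_iff, toLin'_apply, mulVec_smul, mulVec_add, hv, one_smul,
        add_comm]
    have h2 : (1 / 2 : ℝ) • (v - T i *ᵥ v) ∈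
        Module.End.eigenspace (Matrix.toLin' (T i)) (-1 : ℝ) := by
      rw [Module.End.mem_eigenspace_iff, toLin'_apply, mulVec_smul, mulVec_sub, hv]
      module
    have e : v = (1 / 2 : ℝ) • (v + T i *ᵥ v) + (1 / 2 : ℝ) • (v - T i *ᵥ v) := by module
    rw [e]
    refine add_mem ?_ ?_
    · exact Submodule.mem_iSup_of_mem (1 : ℝ) (by rw [heq]; exact h1)
    · exact Submodule.mem_iSup_of_mem (-1 : ℝ) (by rw [heq]; exact h2)
  rw [← h]
  exact iSup_congr fun χ => iInf_congr fun i => (heq i _).symm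

/-- A group normalizing a finite set of commuting involutions, one of which is not a scalar, is
imprimitive. -/
theorem isImprimitive_of_involutions {G : Subgroup (Matrix.specialOrthogonalGroup n ℝ)}
    [Finite ι] {T : ι → Matrix n n ℝ} (hsq : ∀ i, T i * T i = 1)
    (hcomm : ∀ i j, T i * T j = T j * T i) (hscalar : ∃ i, ∀ c : ℝ, T i ≠ c • 1)
    (hG : ∀ g ∈ G, ∃ σ : ι ≃ ι, ∀ i, g.1 * T i = T (σ i) * g.1) : IsImprimitive G := by
  have hind := iSupIndep_jointEigenspace hcomm
  -- Characters range over an infinite set, but by independence only finitely many joint eigenspaces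
  -- are nonzero; these are the blocks.
  let J := {χ : ι → ℝ // jointEigenspace T χ ≠ ⊥}
  have hJ : Finite J := WellFoundedGT.finite_ne_bot_of_iSupIndep hind
  obtain ⟨l, ⟨e⟩⟩ := Finite.exists_equiv_fin J
  refine ⟨l, fun k => jointEigenspace T (e.symm k).1, ?_, fun k => ⟨(e.symm k).2, ?_⟩, ?_⟩
  · rw [DirectSum.isInternal_submodule_iff_iSupIndep_and_iSup_eq_top]
    constructor
    · exact hind.comp (Subtype.val_injective.comp e.symm.injective)
    · rw [eq_top_iff, ← iSup_jointEigenspace hsq hcomm]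
      refine iSup_le fun χ => ?_
      by_cases hχ : jointEigenspace T χ = ⊥
      · rw [hχ]; exact bot_le
      · refine le_trans ?_ (le_iSup _ (e ⟨χ, hχ⟩))
        rw [e.symm_apply_apply]
  · intro htop
    obtain ⟨i, hi⟩ := hscalar
    refine hi ((e.symm k).1 i) (Matrix.ext_of_mulVec_single fun j => ?_)
    have htop' : jointEigenspace T (e.symm k).1 = ⊤ := htop
    have : (Pi.single j 1 : n → ℝ) ∈ jointEigenspace T (e.symm k).1 := by
      rw [htop']
      exact Submodule.mem_top
    rw [mem_jointEigenspace.1 this i, smul_mulVec, one_mulVec]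
  · intro g hg k
    obtain ⟨σ, hσ⟩ := hG g hg
    have hinv : (g⁻¹).1 * g.1 = 1 := congrArg Subtype.val (inv_mul_cancel g)
    have hinv' : g.1 * (g⁻¹).1 = 1 := congrArg Subtype.val (mul_inv_cancel g)
    have hmap : (jointEigenspace T (e.symm k).1).map (Matrix.toLin' g.1) =
        jointEigenspace T ((e.symm k).1 ∘ σ.symm) := by
      ext v
      rw [Submodule.mem_map, mem_jointEigenspace]
      constructor
      · rintro ⟨u, hu, rfl⟩ i
        rw [mem_jointEigenspace] at hu
        have h1 := hσ (σ.symm i)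
        rw [σ.apply_symm_apply] at h1
        rw [toLin'_apply, mulVec_mulVec, ← h1, ← mulVec_mulVec, hu, mulVec_smul]
        rfl
      · intro hv
        refine ⟨(g⁻¹).1 *ᵥ v, mem_jointEigenspace.2 fun i => ?_, ?_⟩
        · have h1 := hv (σ i)
          rw [Function.comp_apply, σ.symm_apply_apply] at h1
          have h2 : T i * (g⁻¹).1 = (g⁻¹).1 * T (σ i) := by
            calc T i * (g⁻¹).1 = (g⁻¹).1 * (g.1 * T i) * (g⁻¹).1 := by
                  rw [← mul_assoc, hinv, one_mul]
              _ = (g⁻¹).1 * T (σ i) := by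
                  rw [hσ, mul_assoc, mul_assoc, hinv', mul_one]
          rw [mulVec_mulVec, h2, ← mulVec_mulVec, h1, mulVec_smul]
        · rw [toLin'_apply, mulVec_mulVec, hinv', one_mulVec]
    have hne : jointEigenspace T ((e.symm k).1 ∘ σ.symm) ≠ ⊥ := by
      rw [← hmap]
      intro h0
      refine (e.symm k).2 ?_
      rw [Submodule.eq_bot_iff] at h0 ⊢
      intro u hu
      have h1 : g.1 *ᵥ u = 0 := h0 _ (Submodule.mem_map_of_mem hu)
      rw [← one_mulVec u, ← hinv, ← mulVec_mulVec, h1, mulVec_zero]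
    refine ⟨e ⟨_, hne⟩, ?_⟩
    change _ = jointEigenspace T (e.symm (e ⟨_, hne⟩)).1
    rw [hmap, e.symm_apply_apply]

end JointEigenspace

/-- A subgroup of `N` preserving a nonzero totally singular subspace of `H / {±1}` is
imprimitive. -/
theorem isImprimitive_of_singular {G : Subgroup SO8} (hGN : G ≤ N) {S : Submodule (ZMod 2) Biv}
    (hS : S ≠ ⊥) (hq : ∀ w ∈ S, klein w = 0)
    (hinv : ∀ n : N, n.1 ∈ G → ∀ w ∈ S, coord.symm (conjAction n (coord w)) ∈ S) :
    IsImprimitive G := by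
  -- The full preimage of `S` in `H`. Its elements are involutions because `Q` vanishes on `S`, and
  -- they commute because the polar form vanishes there too.
  let ι := {h : H // coord.symm (toA h) ∈ S}
  have hmem : ∀ n : N, n.1 ∈ G → ∀ i : ι,
      coord.symm (toA (Subgroup.normalizerMonoidHom H n i.1)) ∈ S := fun n hn i => by
    have := hinv n hn _ i.2
    rwa [coord.apply_symm_apply, conjAction_toA] at this
  refine isImprimitive_of_involutions (ι := ι) (T := fun i => mat i.1) (fun i => ?_)
    (fun i j => ?_) ?_ fun g hg => ?_
  · rw [mat_sq_eq, ← Q_toA, ← coord.apply_symm_apply (toA i.1), Q_coord, hq _ i.2, sgn_zero]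
  · have h1 : kleinPolar (coord.symm (toA i.1)) (coord.symm (toA j.1)) = 0 := by
      have := klein_add (coord.symm (toA i.1)) (coord.symm (toA j.1))
      rw [hq _ i.2, hq _ j.2, hq _ (add_mem i.2 j.2), zero_add, zero_add] at this
      exact this.symm
    rw [← polar_coord, coord.apply_symm_apply, coord.apply_symm_apply, polar_eq_commType] at h1
    rw [mat_comm, h1, sgn_zero, one_mul]
  · obtain ⟨w, hw, hw0⟩ := Submodule.exists_mem_ne_zero_of_ne_bot hS
    obtain ⟨h, hh⟩ := toA_surjective (coord w)
    refine ⟨⟨h, by rw [hh, coord.symm_apply_apply]; exact hw⟩, fun c hc => ?_⟩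
    have h0 := toA_eq_zero_iff.2 (eq_one_or_neg_one_of_scalar (g := h.1) hc)
    rw [hh] at h0
    exact hw0 (by simpa using h0)
  · let n : N := ⟨g, hGN hg⟩
    let σ : ι ≃ ι :=
      { toFun := fun i => ⟨Subgroup.normalizerMonoidHom H n i.1, hmem n hg i⟩
        invFun := fun i => ⟨Subgroup.normalizerMonoidHom H n⁻¹ i.1, hmem n⁻¹ (inv_mem hg) i⟩
        left_inv := fun i => Subtype.ext (by
          change (Subgroup.normalizerMonoidHom H n⁻¹ * Subgroup.normalizerMonoidHom H n) i.1 = i.1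
          rw [← map_mul, inv_mul_cancel, map_one]
          rfl)
        right_inv := fun i => Subtype.ext (by
          change (Subgroup.normalizerMonoidHom H n * Subgroup.normalizerMonoidHom H n⁻¹) i.1 = i.1
          rw [← map_mul, mul_inv_cancel, map_one]
          rfl) }
    exact ⟨σ, fun i => (N_conj_mat n i.1).symm⟩

/-! ### The group `L` is a primitive rotation group -/

theorem siegelMap_of_polar {s a x : Biv} (h : kleinPolar x s = 0) (h' : kleinPolar x a = 1) :
    siegelMap s a x = x + s := by
  rw [siegelMap_apply, h, h', zero_smul, one_smul, zero_add]

theorem exists_singularPlane_of_orthogonal {s x : Biv} (hs : klein s = 0) (hs0 : s ≠ 0)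
    (hx : x ≠ 0) (hsx : kleinPolar s x = 0) (hne : s ≠ x) :
    ∃ a, IsSingularPlane s a ∧ siegelMap s a x = x + s := by
  obtain ⟨a, ha, has, hxa⟩ := exists_singular_zero_one s hs hs0 x ⟨hsx, hne, hx⟩
  have hxs : kleinPolar x s = 0 := by rw [kleinPolar_comm, hsx]
  exact ⟨a, isSingularPlane_of_polar hs ha has hs0 hxs hxa, siegelMap_of_polar hxs hxa⟩

/-- The group generated by the Siegel transformations acts irreducibly. -/
theorem eq_top_of_siegel_invariant {U : Submodule (ZMod 2) Biv} (hU : U ≠ ⊥)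
    (h : ∀ s a, IsSingularPlane s a → ∀ x ∈ U, siegelMap s a x ∈ U) : U = ⊤ := by
  -- Some Siegel transformation moves `x` to `x + s`, which puts `s` into `U`.
  have step : ∀ x ∈ U, x ≠ 0 → ∀ s, klein s = 0 → s ≠ 0 → kleinPolar s x = 0 → s ∈ U := by
    intro x hx hx0 s hs hs0 hsx
    by_cases hne : s = x
    · rwa [hne]
    obtain ⟨a, hp, e⟩ := exists_singularPlane_of_orthogonal hs hs0 hx0 hsx hne
    have := h s a hp x hx
    rw [e] at this
    exact (Submodule.add_mem_iff_right U hx).1 this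
  obtain ⟨x, hx, hx0⟩ := Submodule.exists_mem_ne_zero_of_ne_bot hU
  obtain ⟨s, hs, hxs, hs0, -⟩ := exists_singular_mem_orthogonal x
  have hsU := step x hx hx0 s hs hs0 (by rw [kleinPolar_comm, hxs])
  have all : ∀ t, klein t = 0 → t ≠ 0 → t ∈ U := by
    intro t ht ht0
    rcases zmod_cases (kleinPolar s t) with hst | hst
    · exact step s hsU hs0 t ht ht0 (by rw [kleinPolar_comm, hst])
    -- A singular vector not orthogonal to `s` is reached through one orthogonal to both.
    · obtain ⟨r, hr, hsr, htr, hr0⟩ := exists_singular_orthogonal s hs t ht hst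
      exact step r (step s hsU hs0 r hr hr0 (by rw [kleinPolar_comm, hsr])) hr0 t ht ht0 htr
  rw [eq_top_iff, ← (Pi.basisFun (ZMod 2) (Fin 6)).span_eq, Submodule.span_le]
  rintro _ ⟨i, rfl⟩
  rw [Pi.basisFun_apply]
  refine all _ ?_ ?_
  · revert i; decide +kernel
  · revert i; decide +kernel

theorem exists_singularPlane : ∃ s a x : Biv, IsSingularPlane s a ∧ siegelMap s a x = x + s := by
  have h0 : (Pi.single 0 1 : Biv) ≠ 0 := by decide
  obtain ⟨s, hs, hxs, hs0, hne⟩ := exists_singular_mem_orthogonal (Pi.single 0 1)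
  obtain ⟨a, hp, e⟩ :=
    exists_singularPlane_of_orthogonal hs hs0 h0 (by rw [kleinPolar_comm, hxs]) hne
  exact ⟨s, a, _, hp, e⟩

/-! ### Inclusions among `H`, `L` and `N`, and generation of `L` by rotations. -/

theorem L_le_N : L ≤ N := fun _ hg => (mem_L_iff.1 hg).1

theorem H_le_N : H ≤ N := Subgroup.le_normalizer

theorem H_le_L : H ≤ L := fun h hh => mem_L_iff.2 ⟨H_le_N hh, by
  rw [conj_H_trivial (n := ⟨h, H_le_N hh⟩) hh]
  exact one_mem _⟩

theorem H_lt_L : H < L := by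
  refine lt_of_le_of_ne H_le_L fun e => ?_
  obtain ⟨s, a, x, hp, hx⟩ := exists_singularPlane
  obtain ⟨n, hn, h⟩ := hp.exists_rotation
  have hnH : n.1 ∈ H := by
    rw [e]
    exact hn.mem_L n.2
  have h1 := h x
  rw [conj_H_trivial hnH, hx, map_add] at h1
  have h2 : coord s = 0 := left_eq_add.1 h1
  exact hp.left_ne (by simpa using h2)

theorem IsRotation.conj {r : SO8} (hr : IsRotation r) (g : SO8) : IsRotation (g * r * g⁻¹) := by
  let e : (Fin 2 × Fin 2 × Fin 2 → ℝ) ≃ₗ[ℝ] (Fin 2 × Fin 2 × Fin 2 → ℝ) :=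
    LinearEquiv.ofLinearMap (Matrix.toLin' g.1) (Matrix.toLin' (g⁻¹).1)
      (by rw [← toLin'_mul, mul_inv_val, toLin'_one])
      (by rw [← toLin'_mul, inv_val_mul, toLin'_one])
  have happ : ∀ v, e v = g.1 *ᵥ v := fun v => toLin'_apply _ _
  have h : fixedSpace (g * r * g⁻¹) = (fixedSpace r).map (e : _ →ₗ[ℝ] _) := by
    ext v
    obtain ⟨u, rfl⟩ := e.surjective v
    rw [Submodule.mem_map_equiv, e.symm_apply_apply, mem_fixedSpace, mem_fixedSpace, happ]
    have h1 : (g * r * g⁻¹).1 *ᵥ (g.1 *ᵥ u) = g.1 *ᵥ (r.1 *ᵥ u) := by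
      have : (g * r * g⁻¹).1 * g.1 = g.1 * r.1 := congrArg Subtype.val (inv_mul_cancel_right _ g)
      rw [mulVec_mulVec, this, mulVec_mulVec]
    rw [h1]
    exact ⟨fun h => mulVec_injective g h, fun h => by rw [h]⟩
  change finrank ℝ (fixedSpace (g * r * g⁻¹)) + 2 = _
  rw [h, LinearEquiv.finrank_map_eq]
  exact hr

/-- A subgroup meeting every coset of `{±1}` in `H` contains `H`. -/
theorem H_le_of_coset {R : Subgroup SO8} (hR : ∀ x : Biv, ∃ h : H, h.1 ∈ R ∧ toA h = coord x) :
    H ≤ R := by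
  obtain ⟨x, y, hxy⟩ : ∃ x y : Biv, kleinPolar x y = 1 := by
    obtain ⟨y, hy⟩ := exists_kleinPolar_eq_one (Pi.single 0 1) (by decide)
    exact ⟨y, _, hy⟩
  obtain ⟨h, hh, eh⟩ := hR x
  obtain ⟨k, hk, ek⟩ := hR y
  obtain ⟨z, hz⟩ := exists_neg_one_mem
  have hzR : z.1 ∈ R := by
    -- Classes pairing to 1 have anticommuting representatives, so -1 is a commutator of elements of
    -- `R`.
    have e : z.1 * (k.1 * h.1) = h.1 * k.1 := Subtype.ext (by
      change mat z * (mat k * mat h) = mat h * mat k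
      rw [hz, mat_comm h k, ← polar_eq_commType, eh, ek, polar_coord, hxy, sgn_one])
    rw [eq_mul_inv_of_mul_eq e]
    exact mul_mem (mul_mem hh hk) (inv_mem (mul_mem hk hh))
  intro g hg
  obtain ⟨x, hx⟩ := coord.surjective (toA ⟨g, hg⟩)
  obtain ⟨k, hk, e⟩ := hR x
  rcases toA_eq_iff_mat.1 (e.trans hx) with e | e
  · have : (⟨g, hg⟩ : H) = k := mat_inj e
    rw [← this] at hk
    exact hk
  · have : (⟨g, hg⟩ : H) = z * k := mat_inj (by rw [mat_mul, hz, e, neg_mul, one_mul])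
    have h2 : g = z.1 * k.1 := congrArg Subtype.val this
    rw [h2]
    exact mul_mem hzR hk

theorem mem_of_conjAction_eq {G : Subgroup SO8} (hG : H ≤ G) {m n : N} (hm : m.1 ∈ G)
    (h : conjAction m = conjAction n) : n.1 ∈ G := by
  have h1 : conjAction (m⁻¹ * n) = 1 := by rw [map_mul, map_inv, h, inv_mul_cancel]
  have h2 : (m⁻¹ * n).1 ∈ G := hG (mem_H_of_conj_eq_one h1)
  have h3 := mul_mem hm h2
  have e : m.1 * (m⁻¹ * n).1 = n.1 := mul_inv_cancel_left m.1 n.1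
  rwa [e] at h3

/-- A subgroup containing `H` and inducing all Siegel transformations contains `L`. -/
theorem L_le_of_siegel {G : Subgroup SO8} (hG : H ≤ G)
    (h : ∀ g, IsSiegel g → ∃ n : N, n.1 ∈ G ∧ conjAction n = g) : L ≤ G := by
  intro g hg
  obtain ⟨hN, hg⟩ := mem_L_iff.1 hg
  have := specialIsometryGroup_le (Γ := (G.subgroupOf N).map conjAction) (fun g hg => by
    obtain ⟨n, hn, e⟩ := h g hg
    exact ⟨n, hn, e⟩) hg
  obtain ⟨n, hn, e⟩ := this
  exact mem_of_conjAction_eq (n := ⟨g, hN⟩) hG hn e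

/-- The commutator of a rotation `r` with `h ∈ H` is `r (h r h⁻¹)⁻¹`, a product of rotations and
inverses of rotations, and it lies in `H`. The classes of `R ∩ H` therefore contain all
displacements of Siegel transformations, so they form a nonzero invariant subspace, hence
everything. Thus `R` contains `H` and induces all Siegel transformations, which makes it contain
`L`. -/
theorem isRotationGroup_L : IsRotationGroup L := by
  have hfin : Finite L := Finite.of_injective (Subgroup.inclusion L_le_N)
    (Subgroup.inclusion_injective L_le_N)
  refine ⟨hfin, ?_⟩
  set R := Subgroup.closure {g : SO8 | g ∈ L ∧ IsRotation g} with hRdef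
  have hRL : R ≤ L := (Subgroup.closure_le _).2 fun g hg => hg.1
  have hcomm : ∀ n : N, IsRotation n.1 → ∀ h : H,
      (Subgroup.normalizerMonoidHom H n h * h⁻¹ : H).1 ∈ R := fun n hn h => by
    have e : (Subgroup.normalizerMonoidHom H n h * h⁻¹ : H).1 =
        n.1 * (h.1 * n.1 * h.1⁻¹)⁻¹ := by
      change n.1 * h.1 * n.1⁻¹ * h.1⁻¹ = _
      group
    have h1 : n.1 ∈ L := hn.mem_L n.2
    have h2 : h.1 ∈ L := H_le_L h.2
    rw [e]
    exact mul_mem (Subgroup.subset_closure ⟨h1, hn⟩) (inv_mem (Subgroup.subset_closure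
      ⟨mul_mem (mul_mem h2 h1) (inv_mem h2), hn.conj h.1⟩))
  let U : Submodule (ZMod 2) Biv :=
    { carrier := {x | ∃ h : H, h.1 ∈ R ∧ toA h = coord x}
      add_mem' := by
        rintro x y ⟨h, hh, eh⟩ ⟨k, hk, ek⟩
        exact ⟨h * k, mul_mem hh hk, by rw [toA_mul, eh, ek, map_add]⟩
      zero_mem' := ⟨1, one_mem _, by rw [map_zero]; rfl⟩
      smul_mem' := by
        rintro c x ⟨h, hh, eh⟩
        rcases zmod_cases c with rfl | rfl
        · exact ⟨1, one_mem _, by rw [zero_smul, map_zero]; rfl⟩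
        · exact ⟨h, hh, by rw [one_smul, eh]⟩ }
  have hsub : ∀ s a, IsSingularPlane s a → ∀ x, siegelMap s a x - x ∈ U := by
    intro s a hp x
    obtain ⟨n, hn, e⟩ := hp.exists_rotation
    obtain ⟨h, hh⟩ := toA_surjective (coord x)
    exact ⟨_, hcomm n hn h, by rw [toA_commutator, hh, e, map_sub]⟩
  have hU : U = ⊤ := by
    refine eq_top_of_siegel_invariant (fun h0 => ?_) fun s a hp x hx => ?_
    · obtain ⟨s, a, x, hp, e⟩ := exists_singularPlane
      have := hsub s a hp x
      rw [e, add_sub_cancel_left, h0, Submodule.mem_bot] at this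
      exact hp.left_ne this
    · have := add_mem (hsub s a hp x) hx
      rwa [sub_add_cancel] at this
  have hHR : H ≤ R := H_le_of_coset fun x => by
    have : x ∈ U := by rw [hU]; exact Submodule.mem_top
    exact this
  refine le_antisymm hRL (L_le_of_siegel hHR ?_)
  rintro g ⟨s, a, hp, hg⟩
  obtain ⟨n, hn, e⟩ := hp.exists_rotation
  exact ⟨n, Subgroup.subset_closure ⟨hn.mem_L n.2, hn⟩,
    equiv_ext_coord fun x => by rw [e, hg]⟩

/-! ### Primitivity of `L`. -/

section Blocks

variable {m : Type} [Fintype m] [DecidableEq m]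

theorem map_toLin'_mul (M M' : Matrix m m ℝ) (S : Submodule ℝ (m → ℝ)) :
    S.map (Matrix.toLin' (M * M')) = (S.map (Matrix.toLin' M')).map (Matrix.toLin' M) := by
  rw [toLin'_mul, Submodule.map_comp]

theorem map_toLin'_one (S : Submodule ℝ (m → ℝ)) :
    S.map (Matrix.toLin' (1 : Matrix m m ℝ)) = S := by
  rw [toLin'_one, Submodule.map_id]

theorem map_toLin'_neg (M : Matrix m m ℝ) (S : Submodule ℝ (m → ℝ)) :
    S.map (Matrix.toLin' (-M)) = S.map (Matrix.toLin' M) := by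
  rw [map_neg, Submodule.map_neg]

end Blocks

theorem map_toLin'_eq_of_toA_eq {h k : H} (e : toA h = toA k)
    (S : Submodule ℝ (Fin 2 × Fin 2 × Fin 2 → ℝ)) :
    S.map (Matrix.toLin' (mat h)) = S.map (Matrix.toLin' (mat k)) := by
  rcases toA_eq_iff_mat.1 e with e | e <;> rw [e]
  rw [map_toLin'_neg]

theorem isPrimitive_L : IsPrimitive L := by
  rintro ⟨l, V, hV, hne, hperm⟩
  rw [DirectSum.isInternal_submodule_iff_iSupIndep_and_iSup_eq_top] at hV
  obtain ⟨hind, hsup⟩ := hV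
  have hl : 0 < l := by
    rcases Nat.eq_zero_or_pos l with rfl | h
    · rw [iSup_of_empty] at hsup
      have h1 : (Pi.single 0 1 : Fin 2 × Fin 2 × Fin 2 → ℝ) ∈
          (⊥ : Submodule ℝ (Fin 2 × Fin 2 × Fin 2 → ℝ)) := by rw [hsup]; exact Submodule.mem_top
      have := congrFun ((Submodule.mem_bot ℝ).1 h1) 0
      simp at this
    · exact h
  let o : Fin l := ⟨0, hl⟩
  have hl8 : l ≤ 8 := by
    have h := hind.subtype_ne_bot_le_finrank
    rw [finrank_pi] at h
    have e : Fintype.card {i // V i ≠ ⊥} = l := by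
      rw [Fintype.card_congr (Equiv.subtypeUnivEquiv fun i => (hne i).1), Fintype.card_fin]
    have h8 : Fintype.card (Fin 2 × Fin 2 × Fin 2) = 8 := rfl
    omega
  -- `H` permutes the blocks transitively
  have htrans : ∀ j, ∃ h : H, (V o).map (Matrix.toLin' (mat h)) = V j := by
    intro j
    by_contra! hj
    -- The sum of the `H`-translates of one block is `H`-invariant, hence the whole space. If `V j`
    -- were not a translate, the other blocks would already span everything, against directness.
    have htop : (⨆ h : H, (V o).map (Matrix.toLin' (mat h))) = ⊤ := by
      refine eq_top_of_H_invariant (fun h0 => (hne o).1 ?_) fun k v hv => ?_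
      · rw [eq_bot_iff, ← h0]
        refine le_trans ?_ (le_iSup _ (1 : H))
        rw [mat_one, map_toLin'_one]
      · have h1 : (⨆ h : H, (V o).map (Matrix.toLin' (mat h))).map (Matrix.toLin' (mat k)) ≤
            ⨆ h : H, (V o).map (Matrix.toLin' (mat h)) := by
          rw [Submodule.map_iSup]
          refine iSup_le fun h => ?_
          rw [← map_toLin'_mul, ← mat_mul]
          exact le_iSup (fun h : H => (V o).map (Matrix.toLin' (mat h))) (k * h)
        exact h1 (Submodule.mem_map_of_mem hv)
    have hle : (⨆ h : H, (V o).map (Matrix.toLin' (mat h))) ≤ ⨆ i ≠ j, V i := by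
      refine iSup_le fun h => ?_
      obtain ⟨i, hi⟩ := hperm h.1 (H_le_L h.2) o
      have hij : i ≠ j := by rintro rfl; exact hj h hi
      change (V o).map (Matrix.toLin' h.1.1) ≤ _
      rw [hi]
      exact le_iSup₂_of_le i hij le_rfl
    rw [htop, top_le_iff] at hle
    have := hind j
    rw [hle, disjoint_top] at this
    exact (hne j).1 this
  let U : Submodule (ZMod 2) Biv :=
    { carrier := {x | ∃ h : H, toA h = coord x ∧ ∀ j, (V j).map (Matrix.toLin' (mat h)) = V j}
      add_mem' := by
        rintro x y ⟨h, eh, hh⟩ ⟨k, ek, hk⟩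
        exact ⟨h * k, by rw [toA_mul, eh, ek, map_add], fun j => by
          rw [mat_mul, map_toLin'_mul, hk, hh]⟩
      zero_mem' := ⟨1, by rw [map_zero]; rfl, fun j => by rw [mat_one, map_toLin'_one]⟩
      smul_mem' := by
        rintro c x ⟨h, eh, hh⟩
        rcases zmod_cases c with rfl | rfl
        · exact ⟨1, by rw [zero_smul, map_zero]; rfl, fun j => by rw [mat_one, map_toLin'_one]⟩
        · exact ⟨h, by rw [one_smul, eh], hh⟩ }
  have hU : U ≠ ⊥ := by
    choose lift hlift using toA_surjective
    choose f hf using fun x : A => hperm (lift x).1 (H_le_L (lift x).2) o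
    -- Pigeonhole: 64 classes act on at most 8 blocks, so two of them agree on the block `V o`.
    obtain ⟨x, y, hxy, hfxy⟩ : ∃ x y, x ≠ y ∧ f x = f y := by
      by_contra! hc
      have hinj : Function.Injective f := fun x y h => by_contra fun hne => hc x y hne h
      have := Nat.card_le_card_of_injective f hinj
      rw [natCard_A, Nat.card_eq_fintype_card, Fintype.card_fin] at this
      omega
    let u : H := (lift y)⁻¹ * lift x
    have hu0 : toA u ≠ 0 := by
      rw [toA_mul, toA_inv, hlift, hlift, ← sub_eq_add_A]
      exact sub_ne_zero.2 hxy.symm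
    have huo : (V o).map (Matrix.toLin' (mat u)) = V o := by
      have e1 : (V o).map (Matrix.toLin' (mat (lift x))) =
          (V o).map (Matrix.toLin' (mat (lift y))) := by
        change (V o).map (Matrix.toLin' (lift x).1.1) = (V o).map (Matrix.toLin' (lift y).1.1)
        rw [hf, hf, hfxy]
      rw [mat_mul, map_toLin'_mul, e1, ← map_toLin'_mul, ← mat_mul, inv_mul_cancel, mat_one,
        map_toLin'_one]
    intro h0
    obtain ⟨w, hw⟩ := coord.surjective (toA u)
    have hwU : w ∈ U := by
      refine ⟨u, hw.symm, fun j => ?_⟩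
      obtain ⟨h, hh⟩ := htrans j
      -- `H` is commutative up to sign, and signs do not affect subspaces; so `u`, which stabilizes
      -- `V o`, stabilizes all its translates.
      have e : toA (u * h) = toA (h * u) := by
        rw [toA_mul u h, toA_mul h u, add_comm]
      rw [← hh, ← map_toLin'_mul, ← mat_mul, map_toLin'_eq_of_toA_eq e, mat_mul, map_toLin'_mul,
        huo]
    rw [h0, Submodule.mem_bot] at hwU
    rw [hwU, map_zero] at hw
    exact hu0 hw.symm
  -- The rotations in `L` permute the blocks and normalize `H`, so conjugation by them preserves the
  -- stabilizer of all blocks.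
  have htop : U = ⊤ := by
    refine eq_top_of_siegel_invariant hU ?_
    rintro s a hp x ⟨h, eh, hh⟩
    obtain ⟨n, hn, e⟩ := hp.exists_rotation
    refine ⟨Subgroup.normalizerMonoidHom H n h, by rw [← conjAction_toA, eh, e], fun j => ?_⟩
    obtain ⟨k, hk⟩ := hperm n.1⁻¹ (inv_mem (hn.mem_L n.2)) j
    rw [mat_normalizer, map_toLin'_mul, hk, map_toLin'_mul, hh, ← hk, ← map_toLin'_mul,
      mul_inv_val, map_toLin'_one]
  refine (hne o).2 (eq_top_of_H_invariant (hne o).1 fun k v hv => ?_)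
  obtain ⟨x, hx⟩ := coord.surjective (toA k)
  have hxU : x ∈ U := by rw [htop]; exact Submodule.mem_top
  obtain ⟨h, eh, hh⟩ := hxU
  have h1 := Submodule.mem_map_of_mem (f := Matrix.toLin' (mat k)) hv
  rw [map_toLin'_eq_of_toA_eq (hx.symm.trans eh.symm), hh] at h1
  exact h1

/-! ### Primitive rotation groups between `H` and `N` -/

/-- `G` induces the transvection of bivectors with center `p` and axis `φ`. -/
def InducesTransvection (G : Subgroup SO8) (p φ : Vec) : Prop :=
  p ≠ 0 ∧ φ ≠ 0 ∧ φ ⬝ᵥ p = 0 ∧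
    ∃ n : N, n.1 ∈ G ∧ ∀ x, conjAction n (coord x) = coord (transvect p φ x)

theorem isTransvectionSet_inducesTransvection (G : Subgroup SO8) :
    IsTransvectionSet (InducesTransvection G) where
  center_ne h := h.1
  axis_ne h := h.2.1
  flag h := h.2.2.1
  add := by
    rintro p φ ψ ⟨hp, hφ, hf, m, hm, em⟩ ⟨-, hψ, hf', n, hn, en⟩ hne
    refine ⟨hp, add_ne_zero_of_ne hne, by rw [add_dotProduct, hf, hf', add_zero], m * n,
      mul_mem hm hn, fun x => ?_⟩
    rw [map_mul]
    change conjAction m (conjAction n (coord x)) = _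
    rw [en, em, transvect_transvect hf]
  conj := by
    rintro p φ q ψ ⟨hq, hψ, hf', n, hn, en⟩ ⟨hp, hφ, hf, m, hm, em⟩
    -- The action of `n` is an involution, so `n * m * n` acts as the conjugate of `m`.
    refine ⟨fun h0 => hp ?_, fun h0 => hφ ?_, by rw [dot_transvect hf', hf], n * m * n,
      mul_mem (mul_mem hn hm) hn, fun x => ?_⟩
    · rw [← vec_transvect_involutive hf' p, h0, dotProduct_zero, zero_smul, add_zero]
    · have h := vec_transvect_involutive (q := ψ) (ψ := q) (by rw [dotProduct_comm, hf']) φ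
      rw [dotProduct_comm q φ, h0, dotProduct_zero, zero_smul, add_zero] at h
      exact h.symm
    · rw [map_mul, map_mul]
      change conjAction n (conjAction m (conjAction n (coord x))) = _
      rw [en, em, en, transvect_conj hf', transvect_involutive hf']

theorem IsRotation.exists_inducesTransvection {G : Subgroup SO8} {n : N} (hn : n.1 ∈ G)
    (hr : IsRotation n.1) :
    ∃ p φ, InducesTransvection G p φ ∧ ∀ x, conjAction n (coord x) = coord (transvect p φ x) := by
  obtain ⟨s, a, hp, e⟩ := hr.isSiegel
  obtain ⟨p, φ, hp0, hφ, hf, h⟩ := hp.exists_transvect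
  have e' : ∀ x, conjAction n (coord x) = coord (transvect p φ x) := fun x => by
    rw [e, siegelMap_apply, h]
  exact ⟨p, φ, ⟨hp0, hφ, hf, n, hn, e'⟩, e'⟩

/-- A rotation group preserving a nonzero totally singular subspace is imprimitive. -/
theorem isImprimitive_of_hasSingularInvariant {G : Subgroup SO8} (hrot : IsRotationGroup G)
    (hGN : G ≤ N) (h : HasSingularInvariant (InducesTransvection G)) : IsImprimitive G := by
  obtain ⟨S, hS, hq, hinv⟩ := h
  have hfin : Finite S := inferInstance
  -- The stabilizer of `S` contains every rotation of `G`, hence all of `G`; finiteness of `S` gives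
  -- closure under inverses.
  let K : Subgroup N :=
    { carrier := {n | ∀ w ∈ S, coord.symm (conjAction n (coord w)) ∈ S}
      one_mem' := fun w hw => by
        rw [map_one]
        change coord.symm (coord w) ∈ S
        rwa [coord.symm_apply_apply]
      mul_mem' := fun {m n} hm hn w hw => by
        rw [map_mul]
        change coord.symm (conjAction m (conjAction n (coord w))) ∈ S
        have := hm _ (hn w hw)
        rwa [coord.apply_symm_apply] at this
      inv_mem' := fun {n} hn w hw => by
        let f : S → S := fun w => ⟨_, hn w.1 w.2⟩
        have hf : Function.Injective f := fun u v huv => Subtype.ext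
          (coord.injective ((conjAction n).injective (coord.symm.injective
            (congrArg Subtype.val huv))))
        obtain ⟨u, hu⟩ := Finite.surjective_of_injective hf ⟨w, hw⟩
        have hu' : coord.symm (conjAction n (coord u.1)) = w := congrArg Subtype.val hu
        rw [← hu', coord.apply_symm_apply]
        have : conjAction n⁻¹ (conjAction n (coord u.1)) = coord u.1 := by
          change (conjAction n⁻¹ * conjAction n) (coord u.1) = _
          rw [← map_mul, inv_mul_cancel, map_one]
          rfl
        rw [this, coord.symm_apply_apply]
        exact u.2 }
  have hGK : G ≤ K.map N.subtype := by
    rw [← hrot.2, Subgroup.closure_le]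
    rintro r ⟨hrG, hr⟩
    refine ⟨⟨r, hGN hrG⟩, fun w hw => ?_, rfl⟩
    obtain ⟨p, φ, hT, e⟩ := hr.exists_inducesTransvection (n := ⟨r, hGN hrG⟩) hrG
    rw [e, coord.symm_apply_apply]
    exact hinv p φ hT w hw
  refine isImprimitive_of_singular hGN hS hq fun n hn => ?_
  obtain ⟨m, hm, e⟩ := hGK hn
  have : m = n := Subtype.ext e
  rwa [← this]

/-- A rotation group between `H` and `N` has no nonzero fixed vector in `H / {±1}`. -/
theorem eq_zero_of_transvect_fixed {G : Subgroup SO8} (hrot : IsRotationGroup G) (hHG : H ≤ G)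
    (hGN : G ≤ N) {w : Biv} (h : ∀ p φ, InducesTransvection G p φ → transvect p φ w = w) :
    w = 0 := by
  obtain ⟨k, hk⟩ := toA_surjective (coord w)
  -- A rotation fixing the class of `k` commutes with `k` exactly, not merely up to sign, so the
  -- group generated by such rotations centralizes `k`.
  have hG : G ≤ Subgroup.centralizer {k.1} := by
    rw [← hrot.2, Subgroup.closure_le]
    rintro r ⟨hrG, hr⟩
    obtain ⟨p, φ, hT, e⟩ := hr.exists_inducesTransvection (n := ⟨r, hGN hrG⟩) hrG
    have h1 := hr.commute (n := ⟨r, hGN hrG⟩) (h := k) (by rw [hk, e, h p φ hT])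
    rw [SetLike.mem_coe, Subgroup.mem_centralizer_singleton_iff]
    exact Subtype.ext h1
  have hc : k ∈ signSubgroup := H_central fun g => by
    have := Subgroup.mem_centralizer_singleton_iff.1 (hG (hHG g.2))
    exact (congrArg Subtype.val this).symm
  have h0 := toA_eq_zero_iff.2 hc
  rw [hk] at h0
  simpa using h0

theorem eq_L_of_isPrimitive {G : Subgroup SO8} (hrot : IsRotationGroup G) (hprim : IsPrimitive G)
    (hHG : H ≤ G) (hGN : G ≤ N) : G = L := by
  refine le_antisymm ?_ ?_
  · rw [← hrot.2, Subgroup.closure_le]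
    exact fun r hr => hr.2.mem_L (hGN hr.1)
  rcases (isTransvectionSet_inducesTransvection G).trichotomy with h | h | ⟨w, hw, h⟩
  · refine L_le_of_siegel hHG ?_
    rintro g ⟨s, a, hp, hg⟩
    obtain ⟨p, φ, hp0, hφ, hf, e⟩ := hp.exists_transvect
    obtain ⟨-, -, -, n, hn, e'⟩ := h p φ hp0 hφ hf
    exact ⟨n, hn, equiv_ext_coord fun x => by rw [e', hg, e, siegelMap_apply]⟩
  · exact absurd (isImprimitive_of_hasSingularInvariant hrot hGN h) hprim
  · exact absurd (eq_zero_of_transvect_fixed hrot hHG hGN h) hw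

end RotationGroup

theorem lemma4p19 (G : Subgroup RotationGroup.SO8) :
    (RotationGroup.IsRotationGroup G ∧ RotationGroup.IsPrimitive G ∧
      RotationGroup.H < G ∧ G ≤ RotationGroup.N) ↔ G = RotationGroup.L := by
  constructor
  · rintro ⟨hrot, hprim, hHG, hGN⟩
    exact RotationGroup.eq_L_of_isPrimitive hrot hprim hHG.le hGN
  · rintro rfl
    exact ⟨RotationGroup.isRotationGroup_L, RotationGroup.isPrimitive_L, RotationGroup.H_lt_L,
      RotationGroup.L_le_N⟩
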